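/- Let $d\ge 0$ and let $\mathcal P(\mathbb R^d)$ be the set of Borel probability measures on $\mathbb R^d$ with its weak topology. Let $C^2_\infty(\mathbb R^d)$ be the space of twice continuously differentiable $f:\mathbb R^d\to\mathbb R$ such that $f,f',f''$ vanish at infinity, with the norm $\|f\|_{C^2_\infty}=\sum_{l\le 2}\sup_x\|f^{(l)}(x)\|$, and for $\mu,\eta\in\mathcal P(\mathbb R^d)$ let $$\|\mu-\eta\|_{(C^2_\infty(\mathbb R^d))'}=\sup_{\|f\|_{C^2_\infty}\le 1}|(f,\mu-\eta)|,\qquad (f,\mu)=\int f\,d\mu .$$ For every $\mu\in\mathcal P(\mathbb R^d)$ let $G(\mu)$ be a symmetric non-negative $d\times d$ matrix, $b(\mu)\in\mathbb R^d$, and $\nu(\mu,\cdot)$ a Lévy measure on $\mathbb R^d$ (a Borel measure with $\nu(\mu,\{0\})=0$ and $\int\min(1,|y|^2)\,\nu(\mu,dy)<\infty$), and let $$A_\mu f(x)=\tfrac12(G(\mu)\nabla,\nabla)f(x)+(b(\mu),\nabla f(x))+\int\bigl[f(x+y)-f(x)-(y,\nabla f(x))\mathbf 1_{|y|\le 1}\bigr]\nu(\mu,dy).$$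 Suppose that, with a constant $\kappa$, for all $\mu,\eta\in\mathcal P(\mathbb R^d)$, $$\|G(\mu)-G(\eta)\|+\|b(\mu)-b(\eta)\|+\int\min(1,|y|^2)\,|\nu(\mu,dy)-\nu(\eta,dy)|\le\kappa\,\|\mu-\eta\|_{(C^2_\infty(\mathbb R^d))'} .$$ Then there is exactly one nonlinear Lévy semigroup generated by $A_\mu$, that is, exactly one family $(T_t)_{t\ge0}$ of weakly continuous maps $T_t:\mathcal P(\mathbb R^d)\to\mathcal P(\mathbb R^d)$ such that $T_0=\mathrm{id}$, $T_{s+t}=T_sT_t$, $t\mapsto T_t\mu$ is weakly continuous for every $\mu$, and the curve $\mu_t=T_t\mu$ satisfies $$\frac{d}{dt}(f,\mu_t)=(A_{\mu_t}f,\mu_t),\qquad t\ge0,\ f\in C^2_\infty(\mathbb R^d),\tag{1}$$ (with the right derivative at $t=0$). Moreover, for every $\mu$, $T_t\mu$ is the only curve in $\mathcal P(\mathbb R^d)$ that satisfies (1) and $\mu_0=\mu$. Call a family $p_{r,t}(x,dy)$, $0\le r\le t$, of Markov kernels on $\mathbb R^d$ with $p_{r,r}(x,\cdot)=\delta_x$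 and the Chapman–Kolmogorov property generated by a family of operators $(A_t)_{t\ge0}$ if for every $r\ge0$ and every $\eta\in\mathcal P(\mathbb R^d)$ the measures $\eta_t=\int\eta(dx)\,p_{r,t}(x,\cdot)$ satisfy $\frac{d}{dt}(f,\eta_t)=(A_tf,\eta_t)$ for all $t\ge r$ and $f\in C^2_\infty(\mathbb R^d)$. A nonlinear Lévy process with initial distribution $\mu$ is a stochastic process $(X_t)_{t\ge0}$ in $\mathbb R^d$ with $X_0\sim\mu$ that is Markov (in its own filtration) with transition probabilities generated by $(A_{\mu_t})_{t\ge0}$, where $\mu_t$ is the distribution of $X_t$. For every $\mu\in\mathcal P(\mathbb R^d)$ there exists a nonlinear Lévy process with initial distribution $\mu$; its law on the path space $(\mathbb R^d)^{[0,\infty)}$ with the product $\sigma$-algebra is unique; the transition probabilities generated by $(A_{T_t\mu})_{t\ge0}$ are unique; the distribution of $X_t$ is $T_t\mu$ for all $t\ge0$; and $X$ has independent increments and is stochastically continuous. -/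

import Mathlib

open MeasureTheory ProbabilityTheory Filter Topology Set
open scoped NNReal ENNReal

noncomputable section

namespace NonlinearLevy

/-- The state space `ℝᵈ` with its Euclidean norm. -/
abbrev E (d : ℕ) : Type := EuclideanSpace ℝ (Fin d)

/-- `f` belongs to `C²_∞(ℝᵈ)`: it is twice continuously differentiable, and `f`, `f'`, `f''`
vanish at infinity. -/
def IsC2Infty {d : ℕ} (f : E d → ℝ) : Prop :=
  ContDiff ℝ 2 f ∧
    ∀ l : ℕ, l ≤ 2 → Tendsto (fun x => iteratedFDeriv ℝ l f x) (cocompact (E d)) (𝓝 0)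

/-- The norm of `C²(ℝᵈ)`: the sum of the sup norms of `f`, `f'`, `f''`
(the suprema are finite for `f` in `C²_∞(ℝᵈ)`). -/
def c2Norm {d : ℕ} (f : E d → ℝ) : ℝ :=
  ∑ l ∈ Finset.range 3, ⨆ x : E d, ‖iteratedFDeriv ℝ l f x‖

/-- The distance `‖μ - η‖` in the norm of the dual of `C²_∞(ℝᵈ)`. The set is nonempty, and it is
bounded by `2` because `|f| ≤ 1` on it. -/
def c2DualDist {d : ℕ} (μ η : ProbabilityMeasure (E d)) : ℝ :=
  sSup {r : ℝ | ∃ f : E d → ℝ, IsC2Infty f ∧ c2Norm f ≤ 1 ∧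
    r = |∫ x, f x ∂(μ : Measure (E d)) - ∫ x, f x ∂(η : Measure (E d))|}

/-- Lévy–Khintchine coefficients: a symmetric nonnegative matrix `G`, a vector `b`, and a Lévy
measure `ν`. -/
structure LevyTriplet (d : ℕ) where
  G : Matrix (Fin d) (Fin d) ℝ
  b : E d
  ν : Measure (E d)
  posSemidef_G : G.PosSemidef
  ν_zero : ν {0} = 0
  lintegral_ν_ne_top : ∫⁻ y, ENNReal.ofReal (min 1 (‖y‖ ^ 2)) ∂ν ≠ ∞

/-- The finite measure `min (1, |y|²) ν(dy)`. -/
def LevyTriplet.weighted {d : ℕ} (L : LevyTriplet d) : Measure (E d) :=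
  L.ν.withDensity fun y => ENNReal.ofReal (min 1 (‖y‖ ^ 2))

instance LevyTriplet.isFiniteMeasure_weighted {d : ℕ} (L : LevyTriplet d) :
    IsFiniteMeasure L.weighted :=
  isFiniteMeasure_withDensity L.lintegral_ν_ne_top

/-- `‖G₁ - G₂‖ + ‖b₁ - b₂‖ + ∫ min (1, |y|²) |ν₁(dy) - ν₂(dy)|`, with the operator norm for
matrices. The integral is the total variation of the signed measure
`min (1, |y|²) (ν₁(dy) - ν₂(dy))`, which is finite although `ν₁` and `ν₂` may be infinite. -/
def tripletDist {d : ℕ} (L₁ L₂ : LevyTriplet d) : ℝ :=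
  ‖Matrix.toEuclideanCLM (n := Fin d) (𝕜 := ℝ) (L₁.G - L₂.G)‖ + ‖L₁.b - L₂.b‖ +
    ((L₁.weighted.toSignedMeasure - L₂.weighted.toSignedMeasure).totalVariation univ).toReal

/-- The Lévy–Khintchine operator
`½ (G∇, ∇) f (x) + (b, ∇f (x)) + ∫ [f (x + y) - f x - (y, ∇f (x)) 1_{|y| ≤ 1}] ν(dy)`. -/
def levyOp {d : ℕ} (L : LevyTriplet d) (f : E d → ℝ) (x : E d) : ℝ :=
  (1 / 2 : ℝ) * ∑ i, ∑ j, L.G i j * iteratedFDeriv ℝ 2 f x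
      ![EuclideanSpace.single i (1 : ℝ), EuclideanSpace.single j (1 : ℝ)] +
    fderiv ℝ f x L.b +
    ∫ y, (f (x + y) - f x -
      (Metric.closedBall (0 : E d) 1).indicator (fun z => fderiv ℝ f x z) y) ∂L.ν

/-- The curve `(m t)`, `t ≥ r`, solves `d/dt (f, m t) = (A t f, m t)` for all `f ∈ C²_∞(ℝᵈ)` and
all `t ≥ r` (at `t = r` the derivative is the right one). -/
def SolvesWeakly {d : ℕ} (A : ℝ≥0 → (E d → ℝ) → E d → ℝ) (r : ℝ≥0)
    (m : ℝ≥0 → Measure (E d)) : Prop :=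
  ∀ f : E d → ℝ, IsC2Infty f → ∀ t : ℝ≥0, r ≤ t →
    HasDerivWithinAt (fun s : ℝ => ∫ x, f x ∂(m s.toNNReal)) (∫ x, A t f x ∂(m t))
      (Ici (r : ℝ)) (t : ℝ)

/-- The curve `m` of probability measures solves the nonlinear kinetic equation
`d/dt (f, m t) = (A_{m t} f, m t)`, `f ∈ C²_∞(ℝᵈ)`, `t ≥ 0`, with `m 0 = μ`. -/
def SolvesNonlinear {d : ℕ} (L : ProbabilityMeasure (E d) → LevyTriplet d)
    (μ : ProbabilityMeasure (E d)) (m : ℝ≥0 → ProbabilityMeasure (E d)) : Prop :=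
  m 0 = μ ∧
    SolvesWeakly (fun t => levyOp (L (m t))) 0 (fun t => (m t : Measure (E d)))

/-- `T` is a nonlinear Lévy semigroup generated by `A_μ = levyOp (L μ)`: a weakly continuous
semigroup of weakly continuous transformations of the set of probability measures on `ℝᵈ` whose
orbits solve the nonlinear kinetic equation. -/
structure IsNonlinearLevySemigroup {d : ℕ} (L : ProbabilityMeasure (E d) → LevyTriplet d)
    (T : ℝ≥0 → ProbabilityMeasure (E d) → ProbabilityMeasure (E d)) : Prop where
  zero : ∀ μ, T 0 μ = μ
  add : ∀ s t μ, T (s + t) μ = T s (T t μ)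
  continuous_time : ∀ μ, Continuous fun t => T t μ
  continuous_initial : ∀ t, Continuous (T t)
  solves : ∀ μ, SolvesNonlinear L μ fun t => T t μ

/-- `p r t x (dy)`, `r ≤ t`, are the transition probabilities of a (time-inhomogeneous) Markov
process generated by the family `A t`: Markov kernels with the Chapman–Kolmogorov property such
that for every starting time `r` and every initial distribution `η` the distributions
`∫ η(dx) p r t x (dy)`, `t ≥ r`, solve `d/dt (f, m t) = (A t f, m t)` for `f ∈ C²_∞(ℝᵈ)`.
The values for `t < r` play no role. -/
structure IsTransitionFamily {d : ℕ} (A : ℝ≥0 → (E d → ℝ) → E d → ℝ)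
    (p : ℝ≥0 → ℝ≥0 → Kernel (E d) (E d)) : Prop where
  isMarkovKernel : ∀ r t, r ≤ t → IsMarkovKernel (p r t)
  refl : ∀ r, p r r = Kernel.id
  chapmanKolmogorov : ∀ r s t, r ≤ s → s ≤ t → p r t = p s t ∘ₖ p r s
  solves : ∀ (r : ℝ≥0) (η : ProbabilityMeasure (E d)),
    SolvesWeakly A r fun t => p r t ∘ₘ (η : Measure (E d))

/-- `X` is, under `P`, a Markov process (in its own filtration) with transition
probabilities `p`. -/
structure IsMarkovProcess {d : ℕ} {Ω : Type*} [MeasurableSpace Ω]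
    (p : ℝ≥0 → ℝ≥0 → Kernel (E d) (E d)) (X : ℝ≥0 → Ω → E d) (P : Measure Ω) : Prop where
  measurable : ∀ t, Measurable (X t)
  markov : ∀ (r t : ℝ≥0), r ≤ t → ∀ B : Set (E d), MeasurableSet B →
    P⟦X t ⁻¹' B | ⨆ s : Set.Iic r, MeasurableSpace.comap (X s) inferInstance⟧ =ᵐ[P]
      fun ω => (p r t (X r ω)).real B

/-- `X` is, under the probability measure `P`, a nonlinear Lévy process generated by
`A_μ = levyOp (L μ)` with initial distribution `μ`: a Markov process whose transition
probabilities are generated by the family `A_{m t}`, where `m t` is the distribution of `X t`. -/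
def IsNonlinearLevyProcess {d : ℕ} {Ω : Type*} [MeasurableSpace Ω]
    (L : ProbabilityMeasure (E d) → LevyTriplet d) (μ : ProbabilityMeasure (E d))
    (X : ℝ≥0 → Ω → E d) (P : Measure Ω) : Prop :=
  ∃ (m : ℝ≥0 → ProbabilityMeasure (E d)) (p : ℝ≥0 → ℝ≥0 → Kernel (E d) (E d)),
    m 0 = μ ∧ (∀ t, P.map (X t) = (m t : Measure (E d))) ∧
      IsTransitionFamily (fun t => levyOp (L (m t))) p ∧ IsMarkovProcess p X P

end NonlinearLevy

end

/-!
Fix first a bounded continuous curve of coefficients `Λ u` (`NiceCurve`) and consider the linear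
problem with generators `levyOp (Λ u)`. Replacing diffusion, drift and small jumps by finitely many
small jumps turns each generator into a bounded jump generator (`approxOp`,
`C2Bdd.abs_approxOp_sub_le`), and random walks whose steps follow these generators (`eulerChain`)
converge weakly. Their characteristic functions are products, and since plane waves are
eigenfunctions of `levyOp` with eigenvalue the `symbol`, the limit has characteristic function
`exp ∫ symbol` (`tendsto_charFun_eulerChain`); the law exists by Lévy's continuity theorem
(`exists_flow`). Dynkin's formula passes to the limit, so the resulting increment laws `transLaw`
solve the forward equation (`hasDerivWithinAt_integral_convP_transLaw`). Conversely a weak solution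
can be tested with plane waves, after cutting them off, which gives a linear differential equation
for its characteristic function: weak solutions are unique (`SolvesForward.eq_convP`).

Comparing the random walks of two curves step by step shows that the solutions of the two linear
problems differ in the dual norm of `C²_∞` by at most the time integral of the distance of their
coefficients (`c2DualDist_convP_transLaw_le`). A solution of the nonlinear equation is therefore a
fixed point (`IsMild`) of a map that, by the Lipschitz hypothesis, is a contraction for the dual
distance with an exponential weight in time. The dual distance is complete on probability measures
and metrizes weak convergence (`exists_tendsto_of_cauchy`, `tendsto_iff_tendsto_c2DualDist`), so
Picard iteration yields a solution (`exists_isMild`), and Gronwall's inequality gives uniqueness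
and continuity in the initial law (`IsMild.c2DualDist_le`).

Once the solution is inserted into the coefficients, everything is linear. The transition kernels
are convolutions with `transLaw`, unique by the uniqueness of weak solutions
(`IsTransitionFamily.eq_transKernel`). A process is Markov with convolution kernels exactly if each
increment is independent of the past and has the prescribed law (`IsAdditiveOn`,
`IsMarkovProcess.isAdditiveOn`, `IsAdditiveOn.isMarkovProcess`). Such processes are built on finite
sets of times by adding independent increments, and on all times by Kolmogorov's extension theorem
(`exists_isProjectiveLimit`, `exists_isAdditiveOn_univ`); their finite-dimensional laws are
determined, which is uniqueness in law (`IsAdditiveOn.map_path_eq`).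
-/

namespace NonlinearLevy

/-! ### Functions with bounded derivatives -/

section

/-- `f` is twice continuously differentiable and `f`, `f'`, `f''` are bounded by `M`. -/
structure C2Bdd {d : ℕ} (f : E d → ℝ) (M : ℝ) : Prop where
  contDiff : ContDiff ℝ 2 f
  bound : ∀ l : ℕ, l ≤ 2 → ∀ x, ‖iteratedFDeriv ℝ l f x‖ ≤ M

namespace C2Bdd

variable {d : ℕ} {f g : E d → ℝ} {M N : ℝ}

lemma nonneg (hf : C2Bdd f M) : 0 ≤ M := (norm_nonneg _).trans (hf.bound 0 (by norm_num) 0)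

lemma mono (hf : C2Bdd f M) (h : M ≤ N) : C2Bdd f N :=
  ⟨hf.contDiff, fun l hl x => (hf.bound l hl x).trans h⟩

lemma abs_le (hf : C2Bdd f M) (x : E d) : |f x| ≤ M := by
  simpa using hf.bound 0 (by norm_num) x

lemma continuous (hf : C2Bdd f M) : Continuous f := hf.contDiff.continuous

lemma differentiable (hf : C2Bdd f M) : Differentiable ℝ f :=
  hf.contDiff.differentiable (by norm_num)

lemma contDiff_fderiv (hf : C2Bdd f M) : ContDiff ℝ 1 (fderiv ℝ f) :=
  hf.contDiff.fderiv_right (by norm_num)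

lemma differentiable_fderiv (hf : C2Bdd f M) : Differentiable ℝ (fderiv ℝ f) :=
  hf.contDiff_fderiv.differentiable (by norm_num)

lemma norm_fderiv_le (hf : C2Bdd f M) (x : E d) : ‖fderiv ℝ f x‖ ≤ M := by
  simpa [norm_iteratedFDeriv_one] using hf.bound 1 (by norm_num) x

lemma norm_fderiv_fderiv_le (hf : C2Bdd f M) (x : E d) :
    ‖fderiv ℝ (fderiv ℝ f) x‖ ≤ M := by
  rw [← norm_iteratedFDeriv_one, norm_iteratedFDeriv_fderiv]
  exact hf.bound 2 le_rfl x

lemma integrable (hf : C2Bdd f M) (μ : Measure (E d)) [IsFiniteMeasure μ] : Integrable f μ :=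
  Integrable.of_bound hf.continuous.aestronglyMeasurable M
    (ae_of_all _ fun x => by simpa using hf.abs_le x)

lemma abs_integral_le (hf : C2Bdd f M) (μ : Measure (E d)) [IsProbabilityMeasure μ] :
    |∫ x, f x ∂μ| ≤ M := by
  have := norm_integral_le_of_norm_le_const (μ := μ) (f := f) (C := M)
    (ae_of_all _ fun x => by simpa using hf.abs_le x)
  simpa using this

lemma const_smul (hf : C2Bdd f M) (c : ℝ) : C2Bdd (c • f) (|c| * M) := by
  refine ⟨hf.contDiff.const_smul c, fun l hl x => ?_⟩
  have hl' : (l : WithTop ℕ∞) ≤ 2 := by exact_mod_cast hl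
  rw [iteratedFDeriv_const_smul_apply (hf.contDiff.of_le hl').contDiffAt, norm_smul,
    Real.norm_eq_abs]
  exact mul_le_mul_of_nonneg_left (hf.bound l hl x) (abs_nonneg c)

lemma comp_add_right (hf : C2Bdd f M) (a : E d) : C2Bdd (fun x => f (x + a)) M := by
  refine ⟨hf.contDiff.comp (contDiff_id.add contDiff_const), fun l hl x => ?_⟩
  rw [iteratedFDeriv_comp_add_right]
  exact hf.bound l hl _

/-- First-order Taylor estimate. -/
lemma abs_taylor_le (hf : C2Bdd f M) (x y : E d) :
    |f (x + y) - f x - fderiv ℝ f x y| ≤ M * ‖y‖ ^ 2 := by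
  have hlip : ∀ z ∈ Metric.closedBall x ‖y‖, ‖fderiv ℝ f z - fderiv ℝ f x‖ ≤ M * ‖y‖ := by
    intro z hz
    have h := Convex.norm_image_sub_le_of_norm_fderiv_le (𝕜 := ℝ) (s := univ) (x := x) (y := z)
      (fun w _ => hf.differentiable_fderiv w) (fun w _ => hf.norm_fderiv_fderiv_le w)
      convex_univ (mem_univ _) (mem_univ _)
    refine h.trans (mul_le_mul_of_nonneg_left ?_ hf.nonneg)
    simpa [dist_eq_norm] using hz
  have h := Convex.norm_image_sub_le_of_norm_fderiv_le' (𝕜 := ℝ) (x := x) (y := x + y)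
    (fun w _ => hf.differentiable w) hlip (convex_closedBall x ‖y‖)
    (Metric.mem_closedBall_self (norm_nonneg _)) (by simp [dist_eq_norm])
  simp only [add_sub_cancel_left, Real.norm_eq_abs] at h
  linarith [h, show M * ‖y‖ * ‖y‖ = M * ‖y‖ ^ 2 by ring]

lemma abs_sub_le (hf : C2Bdd f M) (x y : E d) : |f (x + y) - f x| ≤ M * ‖y‖ := by
  have h := Convex.norm_image_sub_le_of_norm_fderiv_le (𝕜 := ℝ) (s := univ) (x := x) (y := x + y)
      (fun w _ => hf.differentiable w) (fun w _ => hf.norm_fderiv_le w)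
      convex_univ (mem_univ _) (mem_univ _)
  simpa using h

/-- Second-order symmetric difference estimate, in terms of the oscillation of the second
derivative near `x`. -/
lemma abs_symm_diff_sub_le (hf : C2Bdd f M) (x v : E d) {ω : ℝ}
    (hω : ∀ z, ‖z‖ ≤ ‖v‖ →
      ‖fderiv ℝ (fderiv ℝ f) (x + z) - fderiv ℝ (fderiv ℝ f) x‖ ≤ ω) :
    |f (x + v) + f (x - v) - 2 * f x - fderiv ℝ (fderiv ℝ f) x v v| ≤ 2 * ω * ‖v‖ ^ 2 := by
  set D := fderiv ℝ (fderiv ℝ f) x with hD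
  have hω0 : 0 ≤ ω := (norm_nonneg (_ : E d →L[ℝ] E d →L[ℝ] ℝ)).trans (hω 0 (by simp))
  let h : ℝ → ℝ := fun t => f (x + t • v) + f (x - t • v) - t ^ 2 * D v v
  have hd1 : ∀ t : ℝ, HasDerivAt (fun t : ℝ => x + t • v) v t := fun t => by
    simpa using ((hasDerivAt_id t).smul_const v).const_add x
  have hd2 : ∀ t : ℝ, HasDerivAt (fun t : ℝ => x - t • v) (-v) t := fun t => by
    simpa using ((hasDerivAt_id t).smul_const v).const_sub x
  have hder : ∀ t : ℝ, HasDerivAt h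
      (fderiv ℝ f (x + t • v) v + fderiv ℝ f (x - t • v) (-v) - 2 * t * D v v) t := by
    intro t
    have h1 := (hf.differentiable (x + t • v)).hasFDerivAt.comp_hasDerivAt t (hd1 t)
    have h2 := (hf.differentiable (x - t • v)).hasFDerivAt.comp_hasDerivAt t (hd2 t)
    have h3 := ((hasDerivAt_pow 2 t).mul_const (D v v))
    refine ((h1.add h2).sub h3).congr_deriv ?_
    simp
  have hbound : ∀ t ∈ Icc (0 : ℝ) 1,
      ‖fderiv ℝ f (x + t • v) v + fderiv ℝ f (x - t • v) (-v) - 2 * t * D v v‖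
        ≤ 2 * ω * ‖v‖ ^ 2 := by
    rintro t ⟨ht0, ht1⟩
    have hn : ‖t • v‖ ≤ ‖v‖ := by
      rw [norm_smul, Real.norm_eq_abs, abs_of_nonneg ht0]
      exact mul_le_of_le_one_left (norm_nonneg _) ht1
    have h := Convex.norm_image_sub_le_of_norm_fderiv_le' (𝕜 := ℝ) (f := fderiv ℝ f)
      (φ := D) (C := ω) (s := Metric.closedBall x ‖v‖) (x := x - t • v) (y := x + t • v)
      (fun w _ => hf.differentiable_fderiv w) (fun w hw => ?_) (convex_closedBall _ _)
      (by simpa [dist_eq_norm] using hn) (by simpa [dist_eq_norm] using hn)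
    · have e : x + t • v - (x - t • v) = (2 * t) • v := by module
      rw [e] at h
      have h' := ContinuousLinearMap.le_opNorm
        (fderiv ℝ f (x + t • v) - fderiv ℝ f (x - t • v) - D ((2 * t) • v)) v
      have e2 : (fderiv ℝ f (x + t • v) - fderiv ℝ f (x - t • v) - D ((2 * t) • v)) v =
          fderiv ℝ f (x + t • v) v + fderiv ℝ f (x - t • v) (-v) - 2 * t * D v v := by
        simp [sub_eq_add_neg]
      rw [e2] at h'
      refine h'.trans ?_
      have h3 : ‖(2 * t) • v‖ ≤ 2 * ‖v‖ := by
        rw [norm_smul, Real.norm_eq_abs, abs_of_nonneg (by positivity)]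
        gcongr
        linarith
      calc _ ≤ (ω * ‖(2 * t) • v‖) * ‖v‖ := by gcongr
        _ ≤ (ω * (2 * ‖v‖)) * ‖v‖ := by gcongr
        _ = _ := by ring
    · have := hω (w - x) (by simpa [dist_eq_norm] using hw)
      simpa using this
  have hmv := Convex.norm_image_sub_le_of_norm_hasDerivWithin_le (𝕜 := ℝ) (f := h)
    (s := Icc (0 : ℝ) 1) (x := 0) (y := 1)
    (fun t _ => (hder t).hasDerivWithinAt) hbound (convex_Icc 0 1) (by simp) (by simp)
  have e : h 1 - h 0 = f (x + v) + f (x - v) - 2 * f x - D v v := by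
    simp [h]; ring
  rw [e] at hmv
  simpa using hmv

end C2Bdd

lemma c2Bdd_const {d : ℕ} (c : ℝ) : C2Bdd (fun _ : E d => c) |c| := by
  refine ⟨contDiff_const, fun l hl x => ?_⟩
  rcases Nat.eq_zero_or_pos l with rfl | h
  · simp
  · rw [iteratedFDeriv_const_of_ne h.ne']
    simp

/-- The derivatives of `f ∈ C²_∞` vanish at infinity, hence are bounded, and the suprema in
`c2Norm f` are not junk values: each of them bounds its derivative. -/
lemma C2Bdd.of_isC2Infty {d : ℕ} {f : E d → ℝ} (hf : IsC2Infty f) : C2Bdd f (c2Norm f) := by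
  have hb : ∀ l ≤ 2, BddAbove (range fun x => ‖iteratedFDeriv ℝ l f x‖) := by
    intro l hl
    have hc : Continuous fun x => iteratedFDeriv ℝ l f x :=
      hf.1.continuous_iteratedFDeriv (by exact_mod_cast hl)
    have h2 : Tendsto (fun x => ‖iteratedFDeriv ℝ l f x‖) (cocompact (E d)) (𝓝 0) := by
      simpa using (hf.2 l hl).norm
    obtain ⟨t, ht, ht'⟩ := mem_cocompact.1 (h2 (Iio_mem_nhds one_pos))
    obtain ⟨B, hB⟩ := ht.bddAbove_image hc.norm.continuousOn
    refine ⟨max B 1, ?_⟩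
    rintro _ ⟨x, rfl⟩
    by_cases hx : x ∈ t
    · exact (hB (mem_image_of_mem _ hx)).trans (le_max_left _ _)
    · exact (show _ < _ from ht' hx).le.trans (le_max_right _ _)
  refine ⟨hf.1, fun l hl x => ?_⟩
  have h1 : ‖iteratedFDeriv ℝ l f x‖ ≤ ⨆ x : E d, ‖iteratedFDeriv ℝ l f x‖ := le_ciSup (hb l hl) x
  refine h1.trans ?_
  unfold c2Norm
  exact Finset.single_le_sum (f := fun l => ⨆ x : E d, ‖iteratedFDeriv ℝ l f x‖)
    (fun i _ => Real.iSup_nonneg fun x => norm_nonneg _) (Finset.mem_range.2 (by omega))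

lemma C2Bdd.c2Norm_le {d : ℕ} {f : E d → ℝ} {M : ℝ} (hf : C2Bdd f M) : c2Norm f ≤ 3 * M := by
  unfold c2Norm
  calc _ ≤ ∑ l ∈ Finset.range 3, M := Finset.sum_le_sum fun l hl =>
        ciSup_le fun x => hf.bound l (by have := Finset.mem_range.1 hl; omega) x
    _ = _ := by simp

/-! ### Integrals against differences of finite measures -/

/-- The Jordan decomposition `μ - η = p - n` gives `μ + n = η + p`, so the difference of the
integrals is an integral against `p` minus one against `n`. -/
lemma abs_integral_sub_integral_le_totalVariation {α : Type*} [MeasurableSpace α]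
    (μ η : Measure α) [IsFiniteMeasure μ] [IsFiniteMeasure η] {j : α → ℝ} (hj : Measurable j)
    {C : ℝ} (hC : ∀ x, |j x| ≤ C) :
    |∫ x, j x ∂μ - ∫ x, j x ∂η| ≤
      C * ((μ.toSignedMeasure - η.toSignedMeasure).totalVariation univ).toReal := by
  set s := μ.toSignedMeasure - η.toSignedMeasure with hs
  set p := s.toJordanDecomposition.posPart
  set n := s.toJordanDecomposition.negPart
  have hpn : p.toSignedMeasure - n.toSignedMeasure = s :=
    SignedMeasure.toSignedMeasure_toJordanDecomposition s
  have hmeas : μ + n = η + p := by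
    rw [← Measure.toSignedMeasure_eq_toSignedMeasure_iff, Measure.toSignedMeasure_add,
      Measure.toSignedMeasure_add]
    exact (sub_eq_sub_iff_add_eq_add.1 hpn.symm).trans (add_comm _ _)
  have hint : ∀ (ρ : Measure α) [IsFiniteMeasure ρ], Integrable j ρ := fun ρ _ =>
    Integrable.of_bound hj.aestronglyMeasurable C (ae_of_all _ fun x => by simpa using hC x)
  have hsum : ∫ x, j x ∂μ + ∫ x, j x ∂n = ∫ x, j x ∂η + ∫ x, j x ∂p := by
    rw [← integral_add_measure (hint μ) (hint n), hmeas, integral_add_measure (hint η) (hint p)]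
  have hb : ∀ (ρ : Measure α) [IsFiniteMeasure ρ], |∫ x, j x ∂ρ| ≤ C * ρ.real univ := fun ρ _ => by
    have := norm_integral_le_of_norm_le_const (μ := ρ) (f := j) (C := C)
      (ae_of_all _ fun x => by simpa using hC x)
    simpa using this
  have htv : (s.totalVariation univ).toReal = p.real univ + n.real univ := by
    rw [SignedMeasure.totalVariation]
    simp only [Measure.coe_add, Pi.add_apply]
    rw [ENNReal.toReal_add (measure_ne_top _ _) (measure_ne_top _ _)]
    rfl
  have e : ∫ x, j x ∂μ - ∫ x, j x ∂η = ∫ x, j x ∂p - ∫ x, j x ∂n := by linarith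
  rw [e, htv, mul_add]
  exact (abs_sub _ _).trans (add_le_add (hb p) (hb n))

end

/-! ### Estimates for the Lévy–Khintchine operator -/

section

variable {d : ℕ} {f g : E d → ℝ} {M N : ℝ}

/-- The weight `min (1, |y|²)`. -/
noncomputable def jumpWeight (y : E d) : ℝ := min 1 (‖y‖ ^ 2)

/-- The compensated jump `f (x + y) - f x - (y, ∇f (x)) 1_{|y| ≤ 1}`. -/
noncomputable def jumpFun (f : E d → ℝ) (x y : E d) : ℝ :=
  f (x + y) - f x - (Metric.closedBall (0 : E d) 1).indicator (fun z => fderiv ℝ f x z) y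

/-- The compensated jump divided by its weight `min (1, |y|²)`; it is bounded when `f ∈ C²_b`. -/
noncomputable def jumpRatio (f : E d → ℝ) (x y : E d) : ℝ := jumpFun f x y / jumpWeight y

lemma jumpWeight_nonneg (y : E d) : 0 ≤ jumpWeight y := le_min zero_le_one (sq_nonneg _)

lemma measurable_jumpWeight : Measurable (jumpWeight : E d → ℝ) := by
  unfold jumpWeight; fun_prop

lemma jumpWeight_eq_zero_iff {y : E d} : jumpWeight y = 0 ↔ y = 0 := by
  unfold jumpWeight
  constructor
  · intro h
    by_contra hy
    have : 0 < min 1 (‖y‖ ^ 2) := lt_min one_pos (by positivity)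
    linarith
  · rintro rfl; simp

lemma jumpWeight_pos {y : E d} (hy : y ≠ 0) : 0 < jumpWeight y :=
  (jumpWeight_nonneg y).lt_of_ne' fun h => hy (jumpWeight_eq_zero_iff.1 h)

lemma jumpWeight_of_norm_le_one {y : E d} (hy : ‖y‖ ≤ 1) : jumpWeight y = ‖y‖ ^ 2 :=
  min_eq_right (by have := norm_nonneg y; nlinarith)

lemma jumpWeight_of_one_le_norm {y : E d} (hy : 1 ≤ ‖y‖) : jumpWeight y = 1 :=
  min_eq_left (by nlinarith)

lemma jumpFun_zero_right (f : E d → ℝ) (x : E d) : jumpFun f x 0 = 0 := by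
  simp [jumpFun]

lemma jumpWeight_mul_jumpRatio (f : E d → ℝ) (x y : E d) :
    jumpWeight y * jumpRatio f x y = jumpFun f x y := by
  by_cases hy : y = 0
  · subst hy
    simp [jumpFun_zero_right, jumpWeight_eq_zero_iff.2 rfl]
  · unfold jumpRatio
    field_simp [(jumpWeight_pos hy).ne']

lemma measurable_jumpFun (hf : Continuous f) (x : E d) : Measurable (jumpFun f x) := by
  unfold jumpFun
  have h1 : Measurable fun y => f (x + y) - f x := by fun_prop
  exact h1.sub (Measurable.indicator (by fun_prop) Metric.isClosed_closedBall.measurableSet)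

lemma measurable_jumpRatio (hf : Continuous f) (x : E d) : Measurable (jumpRatio f x) :=
  (measurable_jumpFun hf x).div measurable_jumpWeight

lemma C2Bdd.abs_jumpFun_le (hf : C2Bdd f M) (x y : E d) :
    |jumpFun f x y| ≤ 2 * M * jumpWeight y := by
  have hM := hf.nonneg
  by_cases hy : ‖y‖ ≤ 1
  · have : jumpFun f x y = f (x + y) - f x - fderiv ℝ f x y := by
      unfold jumpFun
      rw [indicator_of_mem (by simpa using hy)]
    rw [this, jumpWeight_of_norm_le_one hy]
    have := hf.abs_taylor_le x y
    nlinarith [sq_nonneg ‖y‖]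
  · have : jumpFun f x y = f (x + y) - f x := by
      unfold jumpFun
      rw [indicator_of_notMem (by simpa using hy)]
      simp
    rw [this, jumpWeight_of_one_le_norm (not_le.1 hy).le]
    have h1 := hf.abs_le (x + y)
    have h2 := hf.abs_le x
    rw [_root_.abs_le] at *
    constructor <;> linarith [h1.1, h1.2, h2.1, h2.2]

lemma C2Bdd.abs_jumpRatio_le (hf : C2Bdd f M) (x y : E d) : |jumpRatio f x y| ≤ 2 * M := by
  have hM := hf.nonneg
  by_cases hy : y = 0
  · subst hy
    simp [jumpRatio, jumpFun_zero_right, hM]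
  · unfold jumpRatio
    rw [abs_div, abs_of_pos (jumpWeight_pos hy), div_le_iff₀ (jumpWeight_pos hy)]
    exact hf.abs_jumpFun_le x y

lemma LevyTriplet.integral_weighted (L : LevyTriplet d) (h : E d → ℝ) :
    ∫ y, h y ∂L.weighted = ∫ y, jumpWeight y * h y ∂L.ν := by
  unfold LevyTriplet.weighted
  rw [integral_withDensity_eq_integral_toReal_smul (by fun_prop) (by simp)]
  refine integral_congr_ae (ae_of_all _ fun y => ?_)
  change (ENNReal.ofReal (jumpWeight y)).toReal * h y = _
  rw [ENNReal.toReal_ofReal (jumpWeight_nonneg y)]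

lemma levyOp_eq (L : LevyTriplet d) (f : E d → ℝ) (x : E d) :
    levyOp L f x = (1 / 2 : ℝ) * ∑ i, ∑ j, L.G i j * iteratedFDeriv ℝ 2 f x
      ![EuclideanSpace.single i (1 : ℝ), EuclideanSpace.single j (1 : ℝ)] +
    fderiv ℝ f x L.b + ∫ y, jumpRatio f x y ∂L.weighted := by
  rw [L.integral_weighted]
  simp_rw [jumpWeight_mul_jumpRatio]
  rfl

lemma C2Bdd.integrable_jumpRatio (hf : C2Bdd f M) (L : LevyTriplet d) (x : E d) :
    Integrable (jumpRatio f x) L.weighted :=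
  Integrable.of_bound (measurable_jumpRatio hf.continuous x).aestronglyMeasurable (2 * M)
    (ae_of_all _ fun y => by simpa using hf.abs_jumpRatio_le x y)

lemma abs_entry_le_norm_toEuclideanCLM (G : Matrix (Fin d) (Fin d) ℝ) (i j : Fin d) :
    |G i j| ≤ ‖Matrix.toEuclideanCLM (n := Fin d) (𝕜 := ℝ) G‖ := by
  set T : E d →L[ℝ] E d := Matrix.toEuclideanCLM (n := Fin d) (𝕜 := ℝ) G with hT
  have h1 : (T (EuclideanSpace.single j (1 : ℝ))) i = G i j := by simp [hT]
  have h2 : ‖(T (EuclideanSpace.single j (1 : ℝ))) i‖ ≤ ‖T (EuclideanSpace.single j (1 : ℝ))‖ :=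
    PiLp.norm_apply_le _ i
  rw [h1, Real.norm_eq_abs] at h2
  have h3 := T.le_opNorm (EuclideanSpace.single j (1 : ℝ))
  have h4 : ‖(EuclideanSpace.single j (1 : ℝ) : E d)‖ = 1 := by simp
  rw [h4, mul_one] at h3
  exact h2.trans h3

/-- The constant in the estimates of `levyOp`. -/
noncomputable def opConst (d : ℕ) : ℝ := (d : ℝ) ^ 2 + 2

lemma opConst_pos (d : ℕ) : 0 < opConst d := by unfold opConst; positivity

lemma C2Bdd.abs_second_order_le (hf : C2Bdd f M) (x : E d) (G : Matrix (Fin d) (Fin d) ℝ) :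
    |(1 / 2 : ℝ) * ∑ i, ∑ j, G i j * iteratedFDeriv ℝ 2 f x
      ![EuclideanSpace.single i (1 : ℝ), EuclideanSpace.single j (1 : ℝ)]| ≤
      (d : ℝ) ^ 2 * M * ‖Matrix.toEuclideanCLM (n := Fin d) (𝕜 := ℝ) G‖ := by
  have hM := hf.nonneg
  have h1 : ∀ i j, |G i j * iteratedFDeriv ℝ 2 f x
      ![EuclideanSpace.single i (1 : ℝ), EuclideanSpace.single j (1 : ℝ)]| ≤
      ‖Matrix.toEuclideanCLM (n := Fin d) (𝕜 := ℝ) G‖ * M := by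
    intro i j
    rw [abs_mul]
    refine mul_le_mul (abs_entry_le_norm_toEuclideanCLM G i j) ?_ (abs_nonneg _) (norm_nonneg _)
    have := (iteratedFDeriv ℝ 2 f x).le_opNorm
      ![EuclideanSpace.single i (1 : ℝ), EuclideanSpace.single j (1 : ℝ)]
    simp only [Fin.prod_univ_two, Matrix.cons_val_zero, Matrix.cons_val_one,
      PiLp.norm_single, norm_one, mul_one, Real.norm_eq_abs] at this
    exact this.trans (hf.bound 2 le_rfl x)
  have h2 : |∑ i, ∑ j, G i j * iteratedFDeriv ℝ 2 f x
      ![EuclideanSpace.single i (1 : ℝ), EuclideanSpace.single j (1 : ℝ)]| ≤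
      ∑ _i : Fin d, ∑ _j : Fin d, ‖Matrix.toEuclideanCLM (n := Fin d) (𝕜 := ℝ) G‖ * M :=
    (Finset.abs_sum_le_sum_abs _ _).trans (Finset.sum_le_sum fun i _ =>
      (Finset.abs_sum_le_sum_abs _ _).trans (Finset.sum_le_sum fun j _ => h1 i j))
  simp only [Finset.sum_const, Finset.card_univ, Fintype.card_fin, nsmul_eq_mul] at h2
  rw [abs_mul, abs_of_pos (by norm_num : (0 : ℝ) < 1 / 2)]
  have : 0 ≤ (d : ℝ) ^ 2 * M * ‖Matrix.toEuclideanCLM (n := Fin d) (𝕜 := ℝ) G‖ := by positivity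
  nlinarith

/-- The size of a triplet, its distance to the zero triplet. -/
noncomputable def LevyTriplet.size (L : LevyTriplet d) : ℝ :=
  ‖Matrix.toEuclideanCLM (n := Fin d) (𝕜 := ℝ) L.G‖ + ‖L.b‖ + L.weighted.real univ

lemma LevyTriplet.size_nonneg (L : LevyTriplet d) : 0 ≤ L.size := by
  unfold LevyTriplet.size
  positivity

lemma tripletDist_nonneg (L₁ L₂ : LevyTriplet d) : 0 ≤ tripletDist L₁ L₂ := by
  unfold tripletDist
  positivity

lemma weighted_real_le (L₁ L₂ : LevyTriplet d) {S : Set (E d)} (hS : MeasurableSet S) :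
    L₁.weighted.real S ≤ L₂.weighted.real S +
      ((L₁.weighted.toSignedMeasure - L₂.weighted.toSignedMeasure).totalVariation univ).toReal := by
  have h := abs_integral_sub_integral_le_totalVariation L₁.weighted L₂.weighted
    (j := S.indicator 1) (measurable_one.indicator hS) (C := 1) (fun x => by
      by_cases hx : x ∈ S <;> simp [hx])
  simp only [integral_indicator_one hS, one_mul] at h
  linarith [(abs_le.1 h).2]

lemma LevyTriplet.size_le (L₁ L₂ : LevyTriplet d) : L₁.size ≤ L₂.size + tripletDist L₁ L₂ := by
  have h1 := weighted_real_le L₁ L₂ MeasurableSet.univ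
  have h2 : ‖L₁.b‖ ≤ ‖L₂.b‖ + ‖L₁.b - L₂.b‖ := by
    have := norm_add_le L₂.b (L₁.b - L₂.b); simpa using this
  have h3 : ‖Matrix.toEuclideanCLM (n := Fin d) (𝕜 := ℝ) L₁.G‖ ≤
      ‖Matrix.toEuclideanCLM (n := Fin d) (𝕜 := ℝ) L₂.G‖ +
      ‖Matrix.toEuclideanCLM (n := Fin d) (𝕜 := ℝ) (L₁.G - L₂.G)‖ := by
    have := norm_add_le (Matrix.toEuclideanCLM (n := Fin d) (𝕜 := ℝ) L₂.G)
      (Matrix.toEuclideanCLM (n := Fin d) (𝕜 := ℝ) (L₁.G - L₂.G))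
    rw [← map_add] at this
    simpa using this
  unfold LevyTriplet.size tripletDist
  linarith

lemma C2Bdd.abs_levyOp_le (hf : C2Bdd f M) (L : LevyTriplet d) (x : E d) :
    |levyOp L f x| ≤ opConst d * M * L.size := by
  have hM := hf.nonneg
  rw [levyOp_eq]
  have h1 := hf.abs_second_order_le x L.G
  have h2 : |fderiv ℝ f x L.b| ≤ M * ‖L.b‖ :=
    ((fderiv ℝ f x).le_opNorm _).trans
      (mul_le_mul_of_nonneg_right (hf.norm_fderiv_le x) (norm_nonneg _))
  have h3 : |∫ y, jumpRatio f x y ∂L.weighted| ≤ 2 * M * L.weighted.real univ := by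
    have := norm_integral_le_of_norm_le_const (μ := L.weighted) (f := jumpRatio f x) (C := 2 * M)
      (ae_of_all _ fun y => by simpa using hf.abs_jumpRatio_le x y)
    simpa using this
  refine (abs_add_three _ _ _).trans ?_
  unfold opConst LevyTriplet.size
  have a1 : 0 ≤ M * ‖Matrix.toEuclideanCLM (n := Fin d) (𝕜 := ℝ) L.G‖ := by positivity
  have a2 : 0 ≤ M * ‖L.b‖ := by positivity
  have a3 : 0 ≤ M * L.weighted.real univ := by positivity
  have a4 : (0 : ℝ) ≤ (d : ℝ) ^ 2 := by positivity
  nlinarith [mul_nonneg a4 a2, mul_nonneg a4 a3]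

lemma C2Bdd.abs_levyOp_sub_le (hf : C2Bdd f M) (L₁ L₂ : LevyTriplet d) (x : E d) :
    |levyOp L₁ f x - levyOp L₂ f x| ≤ opConst d * M * tripletDist L₁ L₂ := by
  have hM := hf.nonneg
  have h1 := hf.abs_second_order_le x (L₁.G - L₂.G)
  have h2 : |fderiv ℝ f x (L₁.b - L₂.b)| ≤ M * ‖L₁.b - L₂.b‖ :=
    ((fderiv ℝ f x).le_opNorm _).trans
      (mul_le_mul_of_nonneg_right (hf.norm_fderiv_le x) (norm_nonneg _))
  have h3 := abs_integral_sub_integral_le_totalVariation L₁.weighted L₂.weighted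
    (measurable_jumpRatio hf.continuous x) (hf.abs_jumpRatio_le x)
  have e : levyOp L₁ f x - levyOp L₂ f x =
      (1 / 2 : ℝ) * ∑ i, ∑ j, (L₁.G - L₂.G) i j * iteratedFDeriv ℝ 2 f x
      ![EuclideanSpace.single i (1 : ℝ), EuclideanSpace.single j (1 : ℝ)] +
      fderiv ℝ f x (L₁.b - L₂.b) +
      (∫ y, jumpRatio f x y ∂L₁.weighted - ∫ y, jumpRatio f x y ∂L₂.weighted) := by
    rw [levyOp_eq, levyOp_eq, map_sub]
    simp only [Matrix.sub_apply, sub_mul, Finset.sum_sub_distrib]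
    ring
  rw [e]
  refine (abs_add_three _ _ _).trans ?_
  unfold opConst tripletDist
  set T := ((L₁.weighted.toSignedMeasure - L₂.weighted.toSignedMeasure).totalVariation univ).toReal
  have a1 : 0 ≤ M * ‖Matrix.toEuclideanCLM (n := Fin d) (𝕜 := ℝ) (L₁.G - L₂.G)‖ := by positivity
  have a2 : 0 ≤ M * ‖L₁.b - L₂.b‖ := by positivity
  have a3 : 0 ≤ M * T := mul_nonneg hM ENNReal.toReal_nonneg
  have a4 : (0 : ℝ) ≤ (d : ℝ) ^ 2 := by positivity
  nlinarith [mul_nonneg a4 a2, mul_nonneg a4 a3]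

lemma jumpFun_add (hf : C2Bdd f M) (hg : C2Bdd g N) (x y : E d) :
    jumpFun (f + g) x y = jumpFun f x y + jumpFun g x y := by
  unfold jumpFun
  rw [fderiv_add (hf.differentiable x) (hg.differentiable x)]
  by_cases hy : y ∈ Metric.closedBall (0 : E d) 1
  · simp [indicator_of_mem hy]; ring
  · simp [indicator_of_notMem hy]; ring

lemma jumpFun_const_smul (hf : C2Bdd f M) (c : ℝ) (x y : E d) :
    jumpFun (c • f) x y = c * jumpFun f x y := by
  unfold jumpFun
  rw [fderiv_const_smul (hf.differentiable x)]
  by_cases hy : y ∈ Metric.closedBall (0 : E d) 1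
  · simp [indicator_of_mem hy]; ring
  · simp [indicator_of_notMem hy]; ring

lemma levyOp_add (L : LevyTriplet d) (hf : C2Bdd f M) (hg : C2Bdd g N) (x : E d) :
    levyOp L (f + g) x = levyOp L f x + levyOp L g x := by
  have h : jumpRatio (f + g) x = fun y => jumpRatio f x y + jumpRatio g x y := by
    ext y; simp [jumpRatio, jumpFun_add hf hg, add_div]
  rw [levyOp_eq, levyOp_eq, levyOp_eq, h,
    integral_add (hf.integrable_jumpRatio L x) (hg.integrable_jumpRatio L x),
    fderiv_add (hf.differentiable x) (hg.differentiable x),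
    iteratedFDeriv_add_apply hf.contDiff.contDiffAt hg.contDiff.contDiffAt]
  simp only [add_apply, mul_add, Finset.sum_add_distrib]
  ring

lemma levyOp_const_smul (L : LevyTriplet d) (hf : C2Bdd f M) (c : ℝ) (x : E d) :
    levyOp L (c • f) x = c * levyOp L f x := by
  have h : jumpRatio (c • f) x = fun y => c * jumpRatio f x y := by
    ext y; simp [jumpRatio, jumpFun_const_smul hf, mul_div_assoc]
  rw [levyOp_eq, levyOp_eq, h, integral_const_mul, fderiv_const_smul (hf.differentiable x),
    iteratedFDeriv_const_smul_apply hf.contDiff.contDiffAt]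
  simp only [smul_apply, smul_eq_mul,
    Finset.mul_sum, mul_add]
  congr 2
  refine Finset.sum_congr rfl fun i _ => Finset.sum_congr rfl fun j _ => ?_
  ring

lemma levyOp_comp_add_right (L : LevyTriplet d) (f : E d → ℝ) (a x : E d) :
    levyOp L (fun z => f (z + a)) x = levyOp L f (x + a) := by
  have h : ∀ y, x + y + a = x + a + y := fun y => add_right_comm _ _ _
  unfold levyOp
  simp only [iteratedFDeriv_comp_add_right, fderiv_comp_add_right, h]

/-- Continuity of `levyOp` under bounded pointwise convergence of functions and derivatives. -/
lemma tendsto_levyOp {ι : Type*} {l : Filter ι} [l.IsCountablyGenerated] (L : LevyTriplet d)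
    {F : ι → E d → ℝ} {x : E d} (hF : ∀ᶠ i in l, C2Bdd (F i) M)
    (h0 : ∀ y, Tendsto (fun i => F i y) l (𝓝 (f y)))
    (h1 : ∀ v, Tendsto (fun i => fderiv ℝ (F i) x v) l (𝓝 (fderiv ℝ f x v)))
    (h2 : ∀ m, Tendsto (fun i => iteratedFDeriv ℝ 2 (F i) x m) l
      (𝓝 (iteratedFDeriv ℝ 2 f x m))) :
    Tendsto (fun i => levyOp L (F i) x) l (𝓝 (levyOp L f x)) := by
  simp_rw [levyOp_eq]
  refine Tendsto.add (Tendsto.add (Tendsto.const_mul _ ?_) (h1 _)) ?_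
  · exact tendsto_finsetSum _ fun i _ => tendsto_finsetSum _ fun j _ => Tendsto.const_mul _ (h2 _)
  · refine tendsto_integral_filter_of_dominated_convergence (fun _ => 2 * M) ?_ ?_
      (integrable_const _) ?_
    · exact hF.mono fun i hi => (measurable_jumpRatio hi.continuous x).aestronglyMeasurable
    · exact hF.mono fun i hi => ae_of_all _ fun y => by simpa using hi.abs_jumpRatio_le x y
    · refine ae_of_all _ fun y => Tendsto.div_const ?_ _
      refine ((h0 _).sub (h0 _)).sub ?_
      by_cases hy : y ∈ Metric.closedBall (0 : E d) 1
      · simpa only [indicator_of_mem hy] using h1 y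
      · simpa only [indicator_of_notMem hy] using tendsto_const_nhds

lemma C2Bdd.continuous_levyOp (hf : C2Bdd f M) (L : LevyTriplet d) :
    Continuous (levyOp L f) := by
  refine continuous_iff_continuousAt.2 fun x => ?_
  have h : ∀ z, levyOp L f z = levyOp L (fun w => f (w + z)) 0 := fun z => by
    rw [levyOp_comp_add_right, zero_add]
  have hc2 : Continuous (iteratedFDeriv ℝ 2 f) :=
    hf.contDiff.continuous_iteratedFDeriv (m := 2) le_rfl
  have hc1 := hf.contDiff_fderiv.continuous
  have hx : ∀ y : E d, Tendsto (fun z : E d => y + z) (𝓝 x) (𝓝 (y + x)) := fun y =>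
    tendsto_const_nhds.add tendsto_id
  have key : Tendsto (fun z => levyOp L (fun w => f (w + z)) 0) (𝓝 x)
      (𝓝 (levyOp L (fun w => f (w + x)) 0)) := by
    refine tendsto_levyOp L (M := M) (Eventually.of_forall fun z => hf.comp_add_right z)
      (fun y => ?_) (fun v => ?_) (fun m => ?_)
    · exact (hf.continuous.tendsto (y + x)).comp (hx y)
    · simp only [fderiv_comp_add_right]
      exact ((continuous_eval_const (F := E d →L[ℝ] ℝ) v).tendsto _).comp
        ((hc1.tendsto (0 + x)).comp (hx 0))
    · simp only [iteratedFDeriv_comp_add_right]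
      exact ((continuous_eval_const (F := ContinuousMultilinearMap ℝ (fun _ : Fin 2 => E d) ℝ)
        m).tendsto _).comp ((hc2.tendsto (0 + x)).comp (hx 0))
  exact key.congr (fun z => (h z).symm) |>.trans (by rw [h x])

end

/-! ### Plane waves and the symbol -/

section

variable {d : ℕ} {f g : E d → ℝ} {M N : ℝ}

lemma C2Bdd.of_fderiv (hf : ContDiff ℝ 2 f) (h0 : ∀ x, |f x| ≤ M) (h1 : ∀ x, ‖fderiv ℝ f x‖ ≤ M)
    (h2 : ∀ x, ‖fderiv ℝ (fderiv ℝ f) x‖ ≤ M) : C2Bdd f M := by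
  refine ⟨hf, fun l hl x => ?_⟩
  interval_cases l
  · simpa using h0 x
  · simpa [norm_iteratedFDeriv_one] using h1 x
  · rw [← norm_iteratedFDeriv_fderiv, norm_iteratedFDeriv_one]
    exact h2 x

/-- The plane wave `x ↦ cos ((x, ξ) + θ)`. -/
noncomputable def wave (ξ : E d) (θ : ℝ) (x : E d) : ℝ := Real.cos (inner ℝ x ξ + θ)

lemma contDiff_wave (ξ : E d) (θ : ℝ) (n : WithTop ℕ∞) : ContDiff ℝ n (wave ξ θ) := by
  unfold wave
  exact Real.contDiff_cos.comp ((contDiff_id.inner ℝ contDiff_const).add contDiff_const)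

lemma fderiv_wave (ξ : E d) (θ : ℝ) :
    fderiv ℝ (wave ξ θ) = fun x => (-Real.sin (inner ℝ x ξ + θ)) • innerSL ℝ ξ := by
  ext1 x
  have h : HasFDerivAt (fun x : E d => inner ℝ x ξ + θ) (innerSL ℝ ξ) x := by
    have := ((innerSL ℝ ξ).hasFDerivAt (x := x)).add_const θ
    simpa [real_inner_comm] using this
  exact ((Real.hasDerivAt_cos _).comp_hasFDerivAt x h).fderiv

lemma fderiv_fderiv_wave (ξ : E d) (θ : ℝ) (x : E d) :
    fderiv ℝ (fderiv ℝ (wave ξ θ)) x =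
      (-wave ξ θ x) • (innerSL ℝ ξ).smulRight (innerSL ℝ ξ) := by
  rw [fderiv_wave]
  have h : HasFDerivAt (fun x : E d => inner ℝ x ξ + θ) (innerSL ℝ ξ) x := by
    have := ((innerSL ℝ ξ).hasFDerivAt (x := x)).add_const θ
    simpa [real_inner_comm] using this
  have h2 := ((Real.hasDerivAt_sin (inner ℝ x ξ + θ)).comp_hasFDerivAt x h).neg
  have h3 := (h2.smul_const (innerSL ℝ ξ)).fderiv
  refine h3.trans ?_
  ext v w
  simp [wave, mul_assoc]

lemma c2Bdd_wave (ξ : E d) (θ : ℝ) : C2Bdd (wave ξ θ) ((1 + ‖ξ‖) ^ 2) := by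
  have hn := norm_nonneg ξ
  refine C2Bdd.of_fderiv (contDiff_wave ξ θ 2) (fun x => ?_) (fun x => ?_) (fun x => ?_)
  · exact (Real.abs_cos_le_one _).trans (by nlinarith)
  · rw [fderiv_wave, norm_smul, innerSL_apply_norm, norm_neg, Real.norm_eq_abs]
    have := Real.abs_sin_le_one (inner ℝ x ξ + θ)
    nlinarith
  · rw [fderiv_fderiv_wave]
    refine ContinuousLinearMap.opNorm_le_bound _ (by positivity) fun v => ?_
    have h1 : |wave ξ θ x| ≤ 1 := Real.abs_cos_le_one _
    have h2 : |inner ℝ ξ v| ≤ ‖ξ‖ * ‖v‖ := abs_real_inner_le_norm ξ v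
    rw [smul_apply, ContinuousLinearMap.smulRight_apply, norm_smul, norm_smul, norm_neg,
      innerSL_apply_norm, innerSL_apply_apply, Real.norm_eq_abs, Real.norm_eq_abs]
    calc _ ≤ 1 * ((‖ξ‖ * ‖v‖) * ‖ξ‖) := by gcongr
      _ = ‖ξ‖ ^ 2 * ‖v‖ := by ring
      _ ≤ (1 + ‖ξ‖) ^ 2 * ‖v‖ := by gcongr; linarith

lemma uniformContinuous_fderiv_fderiv_wave (ξ : E d) (θ : ℝ) :
    UniformContinuous (fderiv ℝ (fderiv ℝ (wave ξ θ))) := by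
  have h : fderiv ℝ (fderiv ℝ (wave ξ θ)) =
      fun x => (-wave ξ θ x) • (innerSL ℝ ξ).smulRight (innerSL ℝ ξ) :=
    funext (fderiv_fderiv_wave ξ θ)
  have h1 : LipschitzWith ‖ξ‖₊ (wave ξ θ) :=
    lipschitzWith_of_nnnorm_fderiv_le ((contDiff_wave ξ θ 1).differentiable (by norm_num))
      fun x => by
        rw [← NNReal.coe_le_coe, coe_nnnorm, coe_nnnorm, fderiv_wave, norm_smul,
          innerSL_apply_norm, norm_neg, Real.norm_eq_abs]
        exact mul_le_of_le_one_left (norm_nonneg _) (Real.abs_sin_le_one _)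
  rw [h]
  exact (ContinuousLinearMap.uniformContinuous
    ((ContinuousLinearMap.id ℝ ℝ).smulRight ((innerSL ℝ ξ).smulRight (innerSL ℝ ξ)))).comp
      h1.uniformContinuous.neg

lemma wave_add (ξ : E d) (θ : ℝ) (x : E d) :
    (fun z => wave ξ θ (z + x)) =
      Real.cos (inner ℝ x ξ + θ) • wave ξ 0 +
        (-Real.sin (inner ℝ x ξ + θ)) • wave ξ (-(Real.pi / 2)) := by
  ext z
  simp only [wave, Pi.add_apply, Pi.smul_apply, smul_eq_mul, add_zero, inner_add_left]
  rw [add_assoc, Real.cos_add, ← sub_eq_add_neg, Real.cos_sub_pi_div_two]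
  ring

/-- The symbol of `levyOp L`, that is, its eigenvalue on `x ↦ exp (i (x, ξ))`. -/
noncomputable def symbol (L : LevyTriplet d) (ξ : E d) : ℂ :=
  levyOp L (wave ξ 0) 0 + levyOp L (wave ξ (-(Real.pi / 2))) 0 * Complex.I

lemma levyOp_wave (L : LevyTriplet d) (ξ : E d) (θ : ℝ) (x : E d) :
    levyOp L (wave ξ θ) x = Real.cos (inner ℝ x ξ + θ) * levyOp L (wave ξ 0) 0 -
      Real.sin (inner ℝ x ξ + θ) * levyOp L (wave ξ (-(Real.pi / 2))) 0 := by
  have h := levyOp_comp_add_right L (wave ξ θ) x 0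
  rw [zero_add] at h
  rw [← h, wave_add, levyOp_add L ((c2Bdd_wave ξ 0).const_smul _) ((c2Bdd_wave ξ _).const_smul _),
    levyOp_const_smul L (c2Bdd_wave ξ _), levyOp_const_smul L (c2Bdd_wave ξ _)]
  ring

/-- The exponentials are eigenfunctions of the Lévy–Khintchine operator. -/
lemma levyOp_exp (L : LevyTriplet d) (ξ x : E d) :
    (levyOp L (wave ξ 0) x : ℂ) + levyOp L (wave ξ (-(Real.pi / 2))) x * Complex.I =
      symbol L ξ * Complex.exp (inner ℝ x ξ * Complex.I) := by
  rw [levyOp_wave L ξ 0 x, levyOp_wave L ξ (-(Real.pi / 2)) x, ← sub_eq_add_neg,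
    Real.cos_sub_pi_div_two, Real.sin_sub_pi_div_two, Complex.exp_mul_I, symbol, add_zero]
  push_cast
  linear_combination (-Complex.sin (inner ℝ x ξ : ℝ) *
    (levyOp L (wave ξ (-(Real.pi / 2))) 0 : ℂ)) * Complex.I_sq

lemma charFun_eq_wave (μ : Measure (E d)) [IsFiniteMeasure μ] (ξ : E d) :
    charFun μ ξ = (∫ x, wave ξ 0 x ∂μ : ℝ) +
      (∫ x, wave ξ (-(Real.pi / 2)) x ∂μ : ℝ) * Complex.I := by
  rw [charFun_apply, ← integral_complex_ofReal, ← integral_complex_ofReal,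
    ← integral_mul_const, ← integral_add]
  · refine integral_congr_ae (ae_of_all _ fun x => ?_)
    simp only [wave, add_zero]
    rw [← sub_eq_add_neg, Real.cos_sub_pi_div_two, Complex.exp_mul_I]
    push_cast
    rfl
  · exact ((c2Bdd_wave ξ 0).integrable μ).ofReal
  · exact ((c2Bdd_wave ξ _).integrable μ).ofReal.mul_const _

lemma integral_levyOp_wave (L : LevyTriplet d) (μ : Measure (E d)) [IsFiniteMeasure μ] (ξ : E d) :
    ((∫ x, levyOp L (wave ξ 0) x ∂μ : ℝ) : ℂ) +
      (∫ x, levyOp L (wave ξ (-(Real.pi / 2))) x ∂μ : ℝ) * Complex.I =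
      symbol L ξ * charFun μ ξ := by
  have hi : ∀ θ, Integrable (levyOp L (wave ξ θ)) μ := fun θ =>
    Integrable.of_bound ((c2Bdd_wave ξ θ).continuous_levyOp L).aestronglyMeasurable _
      (ae_of_all _ fun x => by simpa using (c2Bdd_wave ξ θ).abs_levyOp_le L x)
  rw [charFun_apply, ← integral_const_mul, ← integral_complex_ofReal, ← integral_complex_ofReal,
    ← integral_mul_const, ← integral_add (hi _).ofReal ((hi _).ofReal.mul_const _)]
  exact integral_congr_ae (ae_of_all _ fun x => levyOp_exp L ξ x)

lemma norm_add_mul_I_le (a b : ℝ) : ‖(a : ℂ) + b * Complex.I‖ ≤ |a| + |b| := by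
  refine (norm_add_le _ _).trans ?_
  simp

lemma norm_symbol_sub_le (L₁ L₂ : LevyTriplet d) (ξ : E d) :
    ‖symbol L₁ ξ - symbol L₂ ξ‖ ≤ 2 * (opConst d * (1 + ‖ξ‖) ^ 2 * tripletDist L₁ L₂) := by
  have e : symbol L₁ ξ - symbol L₂ ξ =
      ((levyOp L₁ (wave ξ 0) 0 - levyOp L₂ (wave ξ 0) 0 : ℝ) : ℂ) +
      (levyOp L₁ (wave ξ (-(Real.pi / 2))) 0 - levyOp L₂ (wave ξ (-(Real.pi / 2))) 0 : ℝ) *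
        Complex.I := by
    unfold symbol; push_cast; ring
  rw [e]
  refine (norm_add_mul_I_le _ _).trans ?_
  linarith [(c2Bdd_wave ξ 0).abs_levyOp_sub_le L₁ L₂ 0,
    (c2Bdd_wave ξ (-(Real.pi / 2))).abs_levyOp_sub_le L₁ L₂ 0]

lemma continuous_symbol (L : LevyTriplet d) : Continuous (symbol L) := by
  have key : ∀ θ, Continuous fun ξ => levyOp L (wave ξ θ) (0 : E d) := by
    intro θ
    refine continuous_iff_continuousAt.2 fun ξ => ?_
    refine tendsto_levyOp (M := (2 + ‖ξ‖) ^ 2) L ?_ (fun y => ?_) (fun v => ?_) (fun m => ?_)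
    · have hlt : ‖ξ‖ < ‖ξ‖ + 1 := by linarith
      filter_upwards [(continuous_norm.tendsto ξ).eventually (gt_mem_nhds hlt)] with η hη
      refine (c2Bdd_wave η θ).mono ?_
      have hη' : ‖η‖ < ‖ξ‖ + 1 := hη
      have := norm_nonneg η
      exact pow_le_pow_left₀ (by positivity) (by linarith) 2
    · have : Continuous fun η : E d => wave η θ y := by unfold wave; fun_prop
      exact this.tendsto ξ
    · have : Continuous fun η : E d => fderiv ℝ (wave η θ) (0 : E d) v := by
        simp only [fderiv_wave, inner_zero_left, zero_add, smul_apply, innerSL_apply_apply]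
        fun_prop
      exact this.tendsto ξ
    · have : Continuous fun η : E d => iteratedFDeriv ℝ 2 (wave η θ) (0 : E d) m := by
        simp only [iteratedFDeriv_two_apply, fderiv_fderiv_wave, wave, inner_zero_left, zero_add,
          smul_apply, ContinuousLinearMap.smulRight_apply, innerSL_apply_apply]
        fun_prop
      exact this.tendsto ξ
  unfold symbol
  exact (Complex.continuous_ofReal.comp (key 0)).add
    ((Complex.continuous_ofReal.comp (key _)).mul continuous_const)

/-! ### Cutoffs and the dual norm -/

/-- The dilations of a smooth bump function by factors at least `1` are cutoffs with uniformly
bounded derivatives. -/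
lemma exists_cutoff (d : ℕ) : ∃ (χ : ℕ → E d → ℝ) (B : ℝ), (∀ n, C2Bdd (χ n) B) ∧
    (∀ n, HasCompactSupport (χ n)) ∧ ∀ x, ∀ᶠ n in atTop, χ n =ᶠ[𝓝 x] fun _ => 1 := by
  let b : ContDiffBump (0 : E d) := ⟨1, 2, one_pos, one_lt_two⟩
  have hb : ContDiff ℝ 2 b := b.contDiff
  have hbound : ∃ B, ∀ l ≤ 2, ∀ x, ‖iteratedFDeriv ℝ l b x‖ ≤ B := by
    have h1 : ∀ l, ∃ B, ∀ x, l ≤ 2 → ‖iteratedFDeriv ℝ l b x‖ ≤ B := by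
      intro l
      by_cases hl : l ≤ 2
      · obtain ⟨B, hB⟩ := (b.hasCompactSupport.iteratedFDeriv (𝕜 := ℝ) l).exists_bound_of_continuous
          (hb.continuous_iteratedFDeriv (by exact_mod_cast hl))
        exact ⟨B, fun x _ => hB x⟩
      · exact ⟨0, fun x h => absurd h hl⟩
    choose B hB using h1
    refine ⟨max (B 0) (max (B 1) (B 2)), fun l hl x => (hB l x hl).trans ?_⟩
    interval_cases l <;> simp
  obtain ⟨B, hB⟩ := hbound
  let A : ℕ → E d →L[ℝ] E d := fun n => ((n : ℝ) + 1)⁻¹ • ContinuousLinearMap.id ℝ (E d)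
  have hpos : ∀ n : ℕ, (0 : ℝ) < (n : ℝ) + 1 := fun n => by positivity
  have hA : ∀ n, ‖A n‖ ≤ 1 := by
    intro n
    refine (norm_smul_le (((n : ℝ) + 1)⁻¹) (ContinuousLinearMap.id ℝ (E d))).trans ?_
    have h1 : ‖ContinuousLinearMap.id ℝ (E d)‖ ≤ 1 := ContinuousLinearMap.norm_id_le
    have h2 : ‖((n : ℝ) + 1)⁻¹‖ ≤ 1 := by
      rw [Real.norm_eq_abs, abs_of_pos (inv_pos.2 (hpos n))]
      exact inv_le_one_of_one_le₀ (by linarith [(Nat.cast_nonneg n : (0 : ℝ) ≤ n)])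
    exact mul_le_one₀ h2 (norm_nonneg _) h1
  refine ⟨fun n => b ∘ A n, B, fun n => ⟨hb.comp (A n).contDiff, fun l hl x => ?_⟩,
    fun n => ?_, fun x => ?_⟩
  · rw [(A n).iteratedFDeriv_comp_right hb x (by exact_mod_cast hl)]
    refine (ContinuousMultilinearMap.norm_compContinuousLinearMap_le _ _).trans ?_
    have hB0 : 0 ≤ B := (norm_nonneg _).trans (hB 0 (by norm_num) 0)
    calc _ ≤ B * 1 := by
          refine mul_le_mul (hB l hl _) ?_ (Finset.prod_nonneg fun _ _ => norm_nonneg _) hB0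
          exact Finset.prod_le_one (fun _ _ => norm_nonneg _) fun _ _ => hA n
      _ = B := mul_one _
  · refine b.hasCompactSupport.comp_homeomorph
      (Homeomorph.smulOfNeZero ((n : ℝ) + 1)⁻¹ (inv_pos.2 (hpos n)).ne')
  · obtain ⟨k, hk⟩ := exists_nat_gt ‖x‖
    filter_upwards [eventually_ge_atTop k] with n hn
    have hx : ‖x‖ < (n : ℝ) + 1 := by
      have : (k : ℝ) ≤ n := by exact_mod_cast hn
      linarith
    filter_upwards [(continuous_norm.tendsto x).eventually (gt_mem_nhds hx)] with z hz
    refine b.one_of_mem_closedBall ?_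
    have hz' : ‖z‖ < (n : ℝ) + 1 := hz
    simp only [A, smul_apply, ContinuousLinearMap.id_apply,
      mem_closedBall_zero_iff, norm_smul, Real.norm_eq_abs, abs_of_pos (inv_pos.2 (hpos n))]
    change ((n : ℝ) + 1)⁻¹ * ‖z‖ ≤ 1
    rw [inv_mul_le_iff₀ (hpos n)]
    linarith

lemma isC2Infty_of_hasCompactSupport (hf : ContDiff ℝ 2 f) (hc : HasCompactSupport f) :
    IsC2Infty f := by
  refine ⟨hf, fun l _ => ?_⟩
  refine tendsto_const_nhds.congr' ?_
  have h := (hc.iteratedFDeriv (𝕜 := ℝ) l).isCompact.compl_mem_cocompact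
  filter_upwards [h] with x hx
  exact (image_eq_zero_of_notMem_tsupport hx).symm

/-- Functions with bounded derivatives are locally, and with uniform bounds, limits of functions
in `C²_∞`. -/
lemma exists_approx (d : ℕ) : ∃ C : ℝ, 0 < C ∧ ∀ (f : E d → ℝ) (M : ℝ), C2Bdd f M →
    ∃ F : ℕ → E d → ℝ, (∀ n, IsC2Infty (F n)) ∧ (∀ n, C2Bdd (F n) (C * M)) ∧
      ∀ x, ∀ᶠ n in atTop, F n =ᶠ[𝓝 x] f := by
  obtain ⟨χ, B, hχ, hc, h1⟩ := exists_cutoff d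
  have hB := (hχ 0).nonneg
  refine ⟨4 * B + 1, by positivity, fun f M hf => ⟨fun n x => χ n x * f x, fun n => ?_, fun n => ?_,
    fun x => ?_⟩⟩
  · exact isC2Infty_of_hasCompactSupport ((hχ n).contDiff.mul hf.contDiff) ((hc n).mul_right)
  · have hM := hf.nonneg
    refine ⟨(hχ n).contDiff.mul hf.contDiff, fun l hl x => ?_⟩
    refine (norm_iteratedFDeriv_mul_le (hχ n).contDiff hf.contDiff x
      (by exact_mod_cast hl)).trans ?_
    calc _ ≤ ∑ i ∈ Finset.range (l + 1), (l.choose i : ℝ) * B * M := by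
          refine Finset.sum_le_sum fun i hi => ?_
          have hi' := Finset.mem_range.1 hi
          have a1 := (hχ n).bound i (by omega) x
          have a2 := hf.bound (l - i) (by omega) x
          gcongr
      _ = 2 ^ l * B * M := by
          rw [← Finset.sum_mul, ← Finset.sum_mul]
          congr 2
          exact_mod_cast Nat.sum_range_choose l
      _ ≤ 2 ^ 2 * B * M := by gcongr; norm_num
      _ ≤ (4 * B + 1) * M := by nlinarith
  · filter_upwards [h1 x] with n hn
    filter_upwards [hn] with z hz
    rw [hz, one_mul]

end

/-! ### The dual distance and weak convergence -/

section

variable {d : ℕ} {f g : E d → ℝ} {M N : ℝ}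

lemma bddAbove_c2DualDist (μ η : ProbabilityMeasure (E d)) :
    BddAbove {r : ℝ | ∃ f : E d → ℝ, IsC2Infty f ∧ c2Norm f ≤ 1 ∧
    r = |∫ x, f x ∂(μ : Measure (E d)) - ∫ x, f x ∂(η : Measure (E d))|} := by
  refine ⟨2, ?_⟩
  rintro r ⟨f, hf, h1, rfl⟩
  have hb := (C2Bdd.of_isC2Infty hf).mono h1
  refine (abs_sub _ _).trans ?_
  linarith [hb.abs_integral_le (μ : Measure (E d)), hb.abs_integral_le (η : Measure (E d))]

lemma abs_integral_sub_le_c2DualDist (μ η : ProbabilityMeasure (E d)) (hf : IsC2Infty f)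
    (h1 : c2Norm f ≤ 1) :
    |∫ x, f x ∂(μ : Measure (E d)) - ∫ x, f x ∂(η : Measure (E d))| ≤ c2DualDist μ η :=
  le_csSup (bddAbove_c2DualDist μ η) ⟨f, hf, h1, rfl⟩

lemma isC2Infty_zero : IsC2Infty (fun _ : E d => (0 : ℝ)) := by
  refine isC2Infty_of_hasCompactSupport contDiff_const ?_
  exact HasCompactSupport.zero

lemma c2DualDist_le {μ η : ProbabilityMeasure (E d)} {r : ℝ}
    (h : ∀ f : E d → ℝ, IsC2Infty f → C2Bdd f 1 →
      |∫ x, f x ∂(μ : Measure (E d)) - ∫ x, f x ∂(η : Measure (E d))| ≤ r) :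
    c2DualDist μ η ≤ r := by
  refine csSup_le ?_ ?_
  · refine ⟨_, fun _ => 0, isC2Infty_zero, ?_, rfl⟩
    have := (c2Bdd_const (d := d) 0).c2Norm_le
    simp only [abs_zero, mul_zero] at this
    linarith
  · rintro _ ⟨f, hf, h1, rfl⟩
    exact h f hf ((C2Bdd.of_isC2Infty hf).mono h1)

lemma c2DualDist_nonneg (μ η : ProbabilityMeasure (E d)) : 0 ≤ c2DualDist μ η := by
  refine Real.sSup_nonneg ?_
  rintro r ⟨f, -, -, rfl⟩
  exact abs_nonneg _

lemma c2DualDist_le_two (μ η : ProbabilityMeasure (E d)) : c2DualDist μ η ≤ 2 :=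
  c2DualDist_le fun f _ hb => (abs_sub _ _).trans (by
    linarith [hb.abs_integral_le (μ : Measure (E d)), hb.abs_integral_le (η : Measure (E d))])

lemma c2DualDist_comm (μ η : ProbabilityMeasure (E d)) : c2DualDist μ η = c2DualDist η μ := by
  unfold c2DualDist
  simp only [abs_sub_comm]

lemma c2DualDist_self (μ : ProbabilityMeasure (E d)) : c2DualDist μ μ = 0 :=
  le_antisymm (c2DualDist_le fun f _ _ => by simp) (c2DualDist_nonneg _ _)

lemma IsC2Infty.const_smul (hf : IsC2Infty f) (c : ℝ) : IsC2Infty (c • f) := by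
  refine ⟨hf.1.const_smul c, fun l hl => ?_⟩
  have e : (fun x => iteratedFDeriv ℝ l (c • f) x) = fun x => c • iteratedFDeriv ℝ l f x := by
    ext1 x
    exact iteratedFDeriv_const_smul_apply (hf.1.of_le (by exact_mod_cast hl)).contDiffAt
  rw [e]
  simpa using (hf.2 l hl).const_smul c

lemma IsC2Infty.abs_integral_sub_le (hf : IsC2Infty f) (hb : C2Bdd f M)
    (μ η : ProbabilityMeasure (E d)) :
    |∫ x, f x ∂(μ : Measure (E d)) - ∫ x, f x ∂(η : Measure (E d))| ≤
      3 * M * c2DualDist μ η := by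
  have hM := hb.nonneg
  rcases hM.eq_or_lt with h0 | hpos
  · have : ∀ x, f x = 0 := fun x => by
      have := hb.abs_le x
      rw [← h0] at this
      exact abs_nonpos_iff.1 this
    simp [this, ← h0]
  · have h3 : 0 < 3 * M := by positivity
    have hs := (hb.const_smul (3 * M)⁻¹).c2Norm_le
    rw [abs_of_pos (inv_pos.2 h3)] at hs
    have h1 : c2Norm ((3 * M)⁻¹ • f) ≤ 1 := hs.trans (by field_simp; exact le_rfl)
    have h := abs_integral_sub_le_c2DualDist μ η (hf.const_smul (3 * M)⁻¹) h1
    simp only [Pi.smul_apply, smul_eq_mul, integral_const_mul] at h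
    rw [← mul_sub, abs_mul, abs_of_pos (inv_pos.2 h3), inv_mul_le_iff₀ h3] at h
    exact h

lemma c2DualDist_triangle (μ ρ η : ProbabilityMeasure (E d)) :
    c2DualDist μ η ≤ c2DualDist μ ρ + c2DualDist ρ η := by
  refine csSup_le ⟨_, fun _ => 0, isC2Infty_zero, ?_, rfl⟩ ?_
  · have := (c2Bdd_const (d := d) 0).c2Norm_le
    simp only [abs_zero, mul_zero] at this
    linarith
  · rintro _ ⟨f, hf, h1, rfl⟩
    exact (abs_sub_le _ _ _).trans (add_le_add (abs_integral_sub_le_c2DualDist μ ρ hf h1)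
      (abs_integral_sub_le_c2DualDist ρ η hf h1))

lemma abs_c2DualDist_sub_le (μ₁ μ₂ η₁ η₂ : ProbabilityMeasure (E d)) :
    |c2DualDist μ₁ η₁ - c2DualDist μ₂ η₂| ≤ c2DualDist μ₁ μ₂ + c2DualDist η₁ η₂ := by
  rw [abs_le]
  have h1 := c2DualDist_triangle μ₁ μ₂ η₁
  have h2 := c2DualDist_triangle μ₂ η₂ η₁
  have h3 := c2DualDist_triangle μ₂ μ₁ η₂
  have h4 := c2DualDist_triangle μ₁ η₁ η₂
  rw [c2DualDist_comm μ₂ μ₁] at h3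
  rw [c2DualDist_comm η₂ η₁] at h2
  constructor <;> linarith

/-- The dual distance also controls functions in `C²_b`: these are limits of their cutoffs. -/
lemma exists_abs_integral_sub_le (d : ℕ) : ∃ C : ℝ, 0 < C ∧ ∀ (f : E d → ℝ) (M : ℝ), C2Bdd f M →
    ∀ μ η : ProbabilityMeasure (E d),
    |∫ x, f x ∂(μ : Measure (E d)) - ∫ x, f x ∂(η : Measure (E d))| ≤ C * M * c2DualDist μ η := by
  obtain ⟨C, hC, h⟩ := exists_approx d
  refine ⟨3 * C, by positivity, fun f M hf μ η => ?_⟩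
  obtain ⟨F, hF1, hF2, hF3⟩ := h f M hf
  have hlim : ∀ ρ : ProbabilityMeasure (E d), Tendsto (fun n => ∫ x, F n x ∂(ρ : Measure (E d)))
      atTop (𝓝 (∫ x, f x ∂(ρ : Measure (E d)))) := fun ρ =>
    tendsto_integral_of_dominated_convergence (fun _ => C * M)
      (fun n => (hF2 n).continuous.aestronglyMeasurable) (integrable_const _)
      (fun n => ae_of_all _ fun x => by simpa using (hF2 n).abs_le x)
      (ae_of_all _ fun x => tendsto_const_nhds.congr' ((hF3 x).mono fun n hn => hn.eq_of_nhds.symm))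
  refine le_of_tendsto ((hlim μ).sub (hlim η)).abs (Eventually.of_forall fun n => ?_)
  exact ((hF1 n).abs_integral_sub_le (hF2 n) μ η).trans (by rw [mul_assoc 3 C M])

/-- A constant for which `exists_abs_integral_sub_le` holds. -/
noncomputable def dualConst (d : ℕ) : ℝ := (exists_abs_integral_sub_le d).choose

lemma dualConst_pos (d : ℕ) : 0 < dualConst d := (exists_abs_integral_sub_le d).choose_spec.1

lemma C2Bdd.abs_integral_sub_le (hf : C2Bdd f M) (μ η : ProbabilityMeasure (E d)) :
    |∫ x, f x ∂(μ : Measure (E d)) - ∫ x, f x ∂(η : Measure (E d))| ≤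
      dualConst d * M * c2DualDist μ η :=
  (exists_abs_integral_sub_le d).choose_spec.2 f M hf μ η

/-- Characteristic functions are integrals of plane waves, which the dual distance controls. -/
lemma norm_charFun_sub_le (μ η : ProbabilityMeasure (E d)) (ξ : E d) :
    ‖charFun (μ : Measure (E d)) ξ - charFun (η : Measure (E d)) ξ‖ ≤
      2 * (dualConst d * (1 + ‖ξ‖) ^ 2 * c2DualDist μ η) := by
  have e : charFun (μ : Measure (E d)) ξ - charFun (η : Measure (E d)) ξ =
      ((∫ x, wave ξ 0 x ∂(μ : Measure (E d)) - ∫ x, wave ξ 0 x ∂(η : Measure (E d)) : ℝ) : ℂ) +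
      (∫ x, wave ξ (-(Real.pi / 2)) x ∂(μ : Measure (E d)) -
        ∫ x, wave ξ (-(Real.pi / 2)) x ∂(η : Measure (E d)) : ℝ) * Complex.I := by
    rw [charFun_eq_wave (μ : Measure (E d)) ξ, charFun_eq_wave (η : Measure (E d)) ξ]
    push_cast
    ring
  rw [e]
  refine (norm_add_mul_I_le _ _).trans ?_
  linarith [(c2Bdd_wave ξ 0).abs_integral_sub_le μ η,
    (c2Bdd_wave ξ (-(Real.pi / 2))).abs_integral_sub_le μ η]

lemma probabilityMeasure_ext_charFun {μ η : ProbabilityMeasure (E d)}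
    (h : ∀ ξ, charFun (μ : Measure (E d)) ξ = charFun (η : Measure (E d)) ξ) : μ = η :=
  Subtype.ext <| Measure.ext_of_charFun (μ := (μ : Measure (E d))) (ν := (η : Measure (E d)))
    (funext h)

lemma eq_of_c2DualDist_eq_zero {μ η : ProbabilityMeasure (E d)} (h : c2DualDist μ η = 0) :
    μ = η := by
  refine probabilityMeasure_ext_charFun fun ξ => ?_
  have := norm_charFun_sub_le μ η ξ
  rw [h, mul_zero, mul_zero] at this
  exact sub_eq_zero.1 (norm_le_zero_iff.1 this)

lemma tendsto_of_tendsto_c2DualDist {μ : ℕ → ProbabilityMeasure (E d)}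
    {μ₀ : ProbabilityMeasure (E d)} (h : Tendsto (fun n => c2DualDist (μ n) μ₀) atTop (𝓝 0)) :
    Tendsto μ atTop (𝓝 μ₀) := by
  refine ProbabilityMeasure.tendsto_of_tendsto_charFun fun ξ => ?_
  rw [tendsto_iff_norm_sub_tendsto_zero]
  refine squeeze_zero (fun _ => norm_nonneg _) (fun n => norm_charFun_sub_le (μ n) μ₀ ξ) ?_
  simpa using (h.const_mul (dualConst d * (1 + ‖ξ‖) ^ 2)).const_mul 2

/-- Lévy's continuity theorem without a limit measure given in advance. -/
lemma exists_tendsto_of_tendsto_charFun {μ : ℕ → ProbabilityMeasure (E d)} {φ : E d → ℂ}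
    (hφ : ContinuousAt φ 0)
    (h : ∀ ξ, Tendsto (fun n => charFun (μ n : Measure (E d)) ξ) atTop (𝓝 (φ ξ))) :
    ∃ μ₀ : ProbabilityMeasure (E d), (∀ ξ, charFun (μ₀ : Measure (E d)) ξ = φ ξ) ∧
      Tendsto μ atTop (𝓝 μ₀) := by
  have htight : IsTightMeasureSet (range fun n => (μ n : Measure (E d))) :=
    isTightMeasureSet_of_tendsto_charFun hφ h
  have hcomp : IsCompact (closure (range μ)) := by
    refine isCompact_closure_of_isTightMeasureSet ?_
    convert! htight using 1
    ext ρ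
    simp
  obtain ⟨μ₀, -, s, hs, hlim⟩ := hcomp.tendsto_subseq
    (fun n => subset_closure (mem_range_self n))
  have hchar : ∀ ξ, charFun (μ₀ : Measure (E d)) ξ = φ ξ := fun ξ =>
    tendsto_nhds_unique (ProbabilityMeasure.tendsto_iff_tendsto_charFun.1 hlim ξ)
      ((h ξ).comp hs.tendsto_atTop)
  refine ⟨μ₀, hchar, ProbabilityMeasure.tendsto_of_tendsto_charFun fun ξ => ?_⟩
  rw [hchar]
  exact h ξ

lemma tendsto_integral_of_tendsto {ι : Type*} {l : Filter ι} {μ : ι → ProbabilityMeasure (E d)}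
    {μ₀ : ProbabilityMeasure (E d)} (h : Tendsto μ l (𝓝 μ₀)) (hf : Continuous f)
    (hb : ∀ x, |f x| ≤ M) :
    Tendsto (fun i => ∫ x, f x ∂(μ i : Measure (E d))) l (𝓝 (∫ x, f x ∂(μ₀ : Measure (E d)))) :=
  ProbabilityMeasure.tendsto_iff_forall_integral_tendsto.1 h
    (BoundedContinuousFunction.ofNormedAddCommGroup f hf M fun x => by simpa using hb x)

lemma c2DualDist_le_of_tendsto {μ η : ℕ → ProbabilityMeasure (E d)}
    {μ₀ η₀ : ProbabilityMeasure (E d)} (hμ : Tendsto μ atTop (𝓝 μ₀)) (hη : Tendsto η atTop (𝓝 η₀))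
    {r : ℝ} (hr : ∀ᶠ n in atTop, c2DualDist (μ n) (η n) ≤ r) : c2DualDist μ₀ η₀ ≤ r := by
  refine csSup_le ⟨_, fun _ => 0, isC2Infty_zero, ?_, rfl⟩ ?_
  · have := (c2Bdd_const (d := d) 0).c2Norm_le
    simp only [abs_zero, mul_zero] at this
    linarith
  · rintro _ ⟨f, hf, h1, rfl⟩
    have hb := (C2Bdd.of_isC2Infty hf).mono h1
    refine le_of_tendsto ((tendsto_integral_of_tendsto hμ hb.continuous hb.abs_le).sub
      (tendsto_integral_of_tendsto hη hb.continuous hb.abs_le)).abs (hr.mono fun n hn => ?_)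
    exact (abs_integral_sub_le_c2DualDist _ _ hf h1).trans hn

/-- The set of probability measures is complete for the dual distance: characteristic functions of
a Cauchy sequence converge, locally uniformly, so their limit is continuous and Lévy's continuity
theorem applies. -/
lemma exists_tendsto_of_cauchy {μ : ℕ → ProbabilityMeasure (E d)}
    (h : ∀ ε > 0, ∃ N, ∀ m ≥ N, ∀ n ≥ N, c2DualDist (μ m) (μ n) ≤ ε) :
    ∃ μ₀, Tendsto (fun n => c2DualDist (μ n) μ₀) atTop (𝓝 0) := by
  have hC := dualConst_pos d
  have hbd : ∀ ξ m n, ‖charFun (μ m : Measure (E d)) ξ - charFun (μ n : Measure (E d)) ξ‖ ≤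
      2 * (dualConst d * (1 + ‖ξ‖) ^ 2 * c2DualDist (μ m) (μ n)) := fun ξ m n =>
    norm_charFun_sub_le _ _ ξ
  have hcs : ∀ ξ, CauchySeq fun n => charFun (μ n : Measure (E d)) ξ := by
    intro ξ
    rw [Metric.cauchySeq_iff]
    intro ε hε
    have hK : 0 < 2 * (dualConst d * (1 + ‖ξ‖) ^ 2) := by positivity
    obtain ⟨N, hN⟩ := h (ε / 2 / (2 * (dualConst d * (1 + ‖ξ‖) ^ 2))) (by positivity)
    refine ⟨N, fun m hm n hn => ?_⟩
    rw [dist_eq_norm]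
    refine (hbd ξ m n).trans_lt ?_
    calc _ = 2 * (dualConst d * (1 + ‖ξ‖) ^ 2) * c2DualDist (μ m) (μ n) := by ring
      _ ≤ 2 * (dualConst d * (1 + ‖ξ‖) ^ 2) * (ε / 2 / (2 * (dualConst d * (1 + ‖ξ‖) ^ 2))) := by
        gcongr; exact hN m hm n hn
      _ = ε / 2 := by field_simp
      _ < ε := by linarith
  choose φ hφ using fun ξ => cauchySeq_tendsto_of_complete (hcs ξ)
  -- the convergence is locally uniform, so the limit is continuous
  have hcont : ContinuousAt φ 0 := by
    have hunif : TendstoUniformlyOn (fun n ξ => charFun (μ n : Measure (E d)) ξ) φ atTop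
        (Metric.ball 0 1) := by
      rw [Metric.tendstoUniformlyOn_iff]
      intro ε hε
      have hK : 0 < 2 * (dualConst d * (1 + 1) ^ 2) := by positivity
      obtain ⟨N, hN⟩ := h (ε / 2 / (2 * (dualConst d * (1 + 1) ^ 2))) (by positivity)
      filter_upwards [eventually_ge_atTop N] with n hn ξ hξ
      have hξ' : ‖ξ‖ < 1 := by simpa using hξ
      have hle : ‖φ ξ - charFun (μ n : Measure (E d)) ξ‖ ≤ ε / 2 := by
        refine le_of_tendsto ((hφ ξ).sub_const _).norm ?_
        filter_upwards [eventually_ge_atTop N] with m hm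
        refine (hbd ξ m n).trans ?_
        have h0 := c2DualDist_nonneg (μ m) (μ n)
        calc _ = 2 * (dualConst d * (1 + ‖ξ‖) ^ 2) * c2DualDist (μ m) (μ n) := by ring
          _ ≤ 2 * (dualConst d * (1 + 1) ^ 2) *
              (ε / 2 / (2 * (dualConst d * (1 + 1) ^ 2))) := by
            gcongr; exact hN m hm n hn
          _ = ε / 2 := by field_simp
      rw [dist_eq_norm]
      linarith
    exact (hunif.continuousOn (Eventually.frequently (Eventually.of_forall fun n =>
      Continuous.continuousOn (by fun_prop)))).continuousAt (Metric.ball_mem_nhds 0 one_pos)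
  obtain ⟨μ₀, -, hlim⟩ := exists_tendsto_of_tendsto_charFun hcont hφ
  refine ⟨μ₀, ?_⟩
  rw [Metric.tendsto_atTop]
  intro ε hε
  obtain ⟨N, hN⟩ := h (ε / 2) (by positivity)
  refine ⟨N, fun n hn => ?_⟩
  have := c2DualDist_le_of_tendsto (tendsto_const_nhds (x := μ n)) hlim (r := ε / 2)
    (by filter_upwards [eventually_ge_atTop N] with m hm using hN n hn m hm)
  rw [Real.dist_eq, sub_zero, abs_of_nonneg (c2DualDist_nonneg _ _)]
  linarith

/-- Test functions in the unit ball of `C²` are bounded and Lipschitz, so their integrals are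
controlled by the Lévy–Prokhorov distance through the layer-cake formula: a thickening of
`{f ≥ t}` is contained in `{f ≥ t - ε}`. -/
lemma integral_le_of_levyProkhorov {μ ν : Measure (E d)} [IsProbabilityMeasure μ]
    [IsProbabilityMeasure ν] {ε : ℝ} (hε : 0 < ε)
    (h : levyProkhorovEDist μ ν < ENNReal.ofReal ε) (hf : C2Bdd f 1) :
    ∫ x, f x ∂μ - ∫ x, f x ∂ν ≤ 3 * ε := by
  have hf1 : ∀ x, -1 ≤ f x ∧ f x ≤ 1 := fun x => abs_le.1 (hf.abs_le x)
  -- the layer-cake formula needs nonnegative functions, and `k` majorizes `g` on `ε`-thickenings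
  let g : BoundedContinuousFunction (E d) ℝ :=
    BoundedContinuousFunction.ofNormedAddCommGroup (fun x => f x + 1)
      (hf.continuous.add continuous_const) 2 fun x => by
        rw [Real.norm_eq_abs, abs_le]; constructor <;> linarith [(hf1 x).1, (hf1 x).2]
  have hg : ∀ x, g x = f x + 1 := fun x => rfl
  have hg0 : ∀ x, 0 ≤ g x := fun x => by rw [hg]; linarith [(hf1 x).1]
  let k : BoundedContinuousFunction (E d) ℝ := g + BoundedContinuousFunction.const (E d) ε
  have hk : ∀ x, k x = g x + ε := fun x => rfl
  have hgnorm : ‖g‖ ≤ 2 := BoundedContinuousFunction.norm_ofNormedAddCommGroup_le _ (by norm_num) _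
  have hgk : ‖g‖ ≤ ‖k‖ := by
    refine (BoundedContinuousFunction.norm_le (norm_nonneg _)).2 fun x => ?_
    refine le_trans ?_ (k.norm_coe_le_norm x)
    rw [Real.norm_eq_abs, Real.norm_eq_abs, abs_of_nonneg (hg0 x),
      abs_of_nonneg (by rw [hk]; linarith [hg0 x]), hk]
    linarith
  have h1 := BoundedContinuousFunction.integral_le_of_levyProkhorovEDist_lt μ ν hε h g
    (ae_of_all _ hg0)
  have h2 := BoundedContinuousFunction.integral_eq_integral_meas_le k ν
    (ae_of_all _ fun x => by show (0 : ℝ) ≤ k x; rw [hk]; linarith [hg0 x])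
  have hanti : Antitone fun t : ℝ => ν.real {a | t ≤ k a} := fun s t hst =>
    measureReal_mono (fun a (ha : t ≤ k a) => hst.trans ha)
  have hint : ∀ T, IntegrableOn (fun t => ν.real {a | t ≤ k a}) (Ioc 0 T) := fun T =>
    Measure.integrableOn_of_bounded (M := 1) measure_Ioc_lt_top.ne
      hanti.measurable.aestronglyMeasurable (ae_of_all _ fun t => by
        rw [Real.norm_eq_abs, abs_of_nonneg measureReal_nonneg]
        exact measureReal_le_one)
  have h3 : ∫ t in Ioc 0 ‖g‖, ν.real (Metric.thickening ε {a | t ≤ g a}) ≤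
      ∫ t in Ioc 0 ‖g‖, ν.real {a | t ≤ k a} := by
    refine integral_mono_of_nonneg (ae_of_all _ fun t => measureReal_nonneg) (hint _)
      (ae_of_all _ fun t => measureReal_mono fun a ha => ?_)
    obtain ⟨z, hz, hza⟩ := Metric.mem_thickening_iff.1 ha
    have hl := hf.abs_sub_le a (z - a)
    rw [add_sub_cancel, one_mul] at hl
    rw [dist_comm, dist_eq_norm] at hza
    have hz' : t ≤ g z := hz
    show t ≤ k a
    rw [hk, hg]
    rw [hg] at hz'
    linarith [(abs_le.1 hl).2]
  have h4 : ∫ t in Ioc 0 ‖g‖, ν.real {a | t ≤ k a} ≤ ∫ t in Ioc 0 ‖k‖, ν.real {a | t ≤ k a} :=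
    setIntegral_mono_set (hint _) (ae_of_all _ fun t => measureReal_nonneg)
      (Ioc_subset_Ioc_right hgk).eventuallyLE
  have h5 : ∫ x, g x ∂μ = ∫ x, f x ∂μ + 1 := by
    simp_rw [hg]; rw [integral_add (hf.integrable μ) (integrable_const _)]; simp
  have h6 : ∫ x, k x ∂ν = ∫ x, f x ∂ν + 1 + ε := by
    simp_rw [hk, hg, add_assoc]
    rw [integral_add (hf.integrable ν) (integrable_const _)]
    simp
  have h7 : ε * ‖g‖ ≤ ε * 2 := by gcongr
  linarith

/-- Weak convergence implies convergence in the dual distance: the unit ball of `C²_∞` consists of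
bounded functions with a common Lipschitz constant. -/
lemma tendsto_c2DualDist_nhds (μ₀ : ProbabilityMeasure (E d)) :
    Tendsto (fun μ => c2DualDist μ μ₀) (𝓝 μ₀) (𝓝 0) := by
  have hLP := (LevyProkhorov.continuous_ofMeasure_probabilityMeasure (Ω := E d)).tendsto μ₀
  rw [Metric.tendsto_nhds] at *
  intro ε hε
  filter_upwards [hLP (ε / 4) (by positivity)] with μ hμ
  have h1 : levyProkhorovEDist (μ : Measure (E d)) μ₀ < ENNReal.ofReal (ε / 4) := by
    rw [← edist_lt_ofReal] at hμ
    exact hμ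
  have h2 : levyProkhorovEDist (μ₀ : Measure (E d)) μ < ENNReal.ofReal (ε / 4) := by
    rwa [levyProkhorovEDist_comm]
  rw [Real.dist_eq, sub_zero, abs_of_nonneg (c2DualDist_nonneg _ _)]
  refine (c2DualDist_le (r := 3 * (ε / 4)) fun f _ hf => ?_).trans_lt (by linarith)
  have a1 := integral_le_of_levyProkhorov (by positivity) h1 hf
  have a2 := integral_le_of_levyProkhorov (by positivity) h2 hf
  exact abs_le.2 ⟨by linarith, a1⟩

/-! ### Convolution -/

/-- Convolution of probability measures. -/
noncomputable def convP (μ ν : ProbabilityMeasure (E d)) : ProbabilityMeasure (E d) :=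
  ⟨(μ : Measure (E d)) ∗ (ν : Measure (E d)), inferInstance⟩

lemma coe_convP (μ ν : ProbabilityMeasure (E d)) :
    (convP μ ν : Measure (E d)) = (μ : Measure (E d)) ∗ (ν : Measure (E d)) := rfl

lemma charFun_convP (μ ν : ProbabilityMeasure (E d)) (ξ : E d) :
    charFun (convP μ ν : Measure (E d)) ξ =
      charFun (μ : Measure (E d)) ξ * charFun (ν : Measure (E d)) ξ := charFun_conv ξ

lemma IsC2Infty.comp_add_right (hf : IsC2Infty f) (a : E d) : IsC2Infty fun x => f (x + a) := by
  refine ⟨hf.1.comp (contDiff_id.add contDiff_const), fun l hl => ?_⟩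
  simp only [iteratedFDeriv_comp_add_right]
  have h := (Homeomorph.addRight a).isClosedEmbedding.tendsto_cocompact
  exact (hf.2 l hl).comp h

lemma c2Norm_comp_add_right (f : E d → ℝ) (a : E d) : c2Norm (fun x => f (x + a)) = c2Norm f := by
  unfold c2Norm
  refine Finset.sum_congr rfl fun l _ => ?_
  simp only [iteratedFDeriv_comp_add_right]
  exact (Equiv.addRight a).surjective.iSup_comp (g := fun x => ‖iteratedFDeriv ℝ l f x‖)

lemma integral_convP (μ ν : ProbabilityMeasure (E d)) (hf : Continuous f) (hb : ∀ x, |f x| ≤ M) :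
    ∫ x, f x ∂(convP μ ν : Measure (E d)) =
      ∫ y, ∫ x, f (x + y) ∂(μ : Measure (E d)) ∂(ν : Measure (E d)) := by
  rw [coe_convP, Measure.conv_comm, integral_conv]
  · simp only [add_comm]
  · exact Integrable.of_bound hf.aestronglyMeasurable M (ae_of_all _ fun x => by simpa using hb x)

/-- Convolution with a probability measure is a contraction for the dual distance. -/
lemma c2DualDist_convP_le (μ η ν : ProbabilityMeasure (E d)) :
    c2DualDist (convP μ ν) (convP η ν) ≤ c2DualDist μ η := by
  refine csSup_le ⟨_, fun _ => 0, isC2Infty_zero, ?_, rfl⟩ ?_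
  · have := (c2Bdd_const (d := d) 0).c2Norm_le
    simp only [abs_zero, mul_zero] at this
    linarith
  · rintro _ ⟨f, hf, h1, rfl⟩
    have hb := (C2Bdd.of_isC2Infty hf).mono h1
    have hi : ∀ ρ : ProbabilityMeasure (E d),
        Integrable (fun y => ∫ x, f (x + y) ∂(ρ : Measure (E d))) (ν : Measure (E d)) := fun ρ => by
      refine Integrable.of_bound (C := 1) ?_ (ae_of_all _ fun y => ?_)
      · have hc : Continuous (Function.uncurry fun y x : E d => f (x + y)) :=
          hb.continuous.comp (continuous_snd.add continuous_fst)
        exact hc.stronglyMeasurable.integral_prod_right.aestronglyMeasurable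
      · exact (hb.comp_add_right y).abs_integral_le _
    rw [integral_convP μ ν hb.continuous hb.abs_le, integral_convP η ν hb.continuous hb.abs_le,
      ← integral_sub (hi μ) (hi η)]
    have := norm_integral_le_of_norm_le_const (μ := (ν : Measure (E d)))
      (f := fun y => ∫ x, f (x + y) ∂(μ : Measure (E d)) - ∫ x, f (x + y) ∂(η : Measure (E d)))
      (C := c2DualDist μ η) (ae_of_all _ fun y => by
        rw [Real.norm_eq_abs]
        exact abs_integral_sub_le_c2DualDist μ η (hf.comp_add_right y)
          ((c2Norm_comp_add_right f y).trans_le h1))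
    simpa using this

end

/-! ### Approximation of the generator by bounded jump generators -/

section

variable {d : ℕ} {f g : E d → ℝ} {M N : ℝ}

open scoped MatrixOrder in
lemma LevyTriplet.exists_factor (L : LevyTriplet d) :
    ∃ g : Fin d → E d, ∀ i j, L.G i j = ∑ k, g k i * g k j := by
  have hG : 0 ≤ L.G := Matrix.nonneg_iff_posSemidef.2 L.posSemidef_G
  set B := CFC.sqrt L.G with hB
  have hBB : B * B = L.G := CFC.sqrt_mul_sqrt_self L.G hG
  have hsymm : B.conjTranspose = B :=
    (Matrix.nonneg_iff_posSemidef.1 (CFC.sqrt_nonneg L.G)).isHermitian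
  refine ⟨fun k => WithLp.toLp 2 (B k), fun i j => ?_⟩
  rw [← hBB]
  nth_rewrite 1 [← hsymm]
  simp [Matrix.mul_apply]

/-- Vectors `g k` with `G = ∑ₖ g k (g k)ᵀ`. -/
noncomputable def LevyTriplet.factor (L : LevyTriplet d) : Fin d → E d := L.exists_factor.choose

lemma LevyTriplet.G_apply (L : LevyTriplet d) (i j : Fin d) :
    L.G i j = ∑ k, L.factor k i * L.factor k j := L.exists_factor.choose_spec i j

lemma LevyTriplet.sum_norm_factor_le (L : LevyTriplet d) :
    ∑ k, ‖L.factor k‖ ^ 2 ≤ d * L.size := by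
  have h1 : ∑ k, ‖L.factor k‖ ^ 2 = ∑ i, L.G i i := by
    simp_rw [EuclideanSpace.norm_sq_eq, L.G_apply, Real.norm_eq_abs, sq_abs]
    rw [Finset.sum_comm]
    simp only [sq]
  have h2 : ∀ i, L.G i i ≤ L.size := fun i => by
    have := (le_abs_self _).trans (abs_entry_le_norm_toEuclideanCLM L.G i i)
    refine this.trans ?_
    unfold LevyTriplet.size
    have h1 := norm_nonneg L.b
    have h2 : 0 ≤ L.weighted.real univ := measureReal_nonneg
    linarith
  rw [h1]
  calc _ ≤ ∑ _i : Fin d, L.size := Finset.sum_le_sum fun i _ => h2 i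
    _ = _ := by simp

lemma LevyTriplet.norm_factor_le (L : LevyTriplet d) (k : Fin d) :
    ‖L.factor k‖ ≤ 1 + d * L.size := by
  have h1 : ‖L.factor k‖ ^ 2 ≤ d * L.size :=
    (Finset.single_le_sum (f := fun k => ‖L.factor k‖ ^ 2) (fun _ _ => sq_nonneg _)
      (Finset.mem_univ k)).trans L.sum_norm_factor_le
  nlinarith [sq_nonneg (‖L.factor k‖ - 1)]

/-- In terms of the factors of `G` the second-order part is a sum of pure second derivatives, so
that symmetric difference quotients approximate it. -/
lemma LevyTriplet.second_order_eq (L : LevyTriplet d) (f : E d → ℝ) (x : E d) :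
    ∑ i, ∑ j, L.G i j * iteratedFDeriv ℝ 2 f x
      ![EuclideanSpace.single i (1 : ℝ), EuclideanSpace.single j (1 : ℝ)] =
      ∑ k, fderiv ℝ (fderiv ℝ f) x (L.factor k) (L.factor k) := by
  have hexp : ∀ v : E d, v = ∑ i, v i • EuclideanSpace.single i (1 : ℝ) := fun v => by
    ext j
    simp [Finset.sum_apply, Pi.single_apply]
  have hk : ∀ k, fderiv ℝ (fderiv ℝ f) x (L.factor k) (L.factor k) =
      ∑ i, ∑ j, L.factor k i * L.factor k j * fderiv ℝ (fderiv ℝ f) x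
        (EuclideanSpace.single i (1 : ℝ)) (EuclideanSpace.single j (1 : ℝ)) := by
    intro k
    conv_lhs => rw [hexp (L.factor k)]
    simp only [map_sum, map_smul, sum_apply, smul_apply, smul_eq_mul, Finset.mul_sum]
    rw [Finset.sum_comm]
    refine Finset.sum_congr rfl fun i _ => Finset.sum_congr rfl fun j _ => ?_
    ring
  simp_rw [hk, iteratedFDeriv_two_apply, L.G_apply, Finset.sum_mul]
  simp only [Matrix.cons_val_zero, Matrix.cons_val_one]
  rw [Finset.sum_comm' (t' := Finset.univ) (s' := fun _ => Finset.univ) (by simp)]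
  rw [Finset.sum_comm]
  conv_rhs => rw [Finset.sum_comm]
  refine Finset.sum_congr rfl fun i _ => ?_
  conv_rhs => rw [Finset.sum_comm]

/-- The jumps larger than `s`. -/
noncomputable def LevyTriplet.bigJumps (L : LevyTriplet d) (s : ℝ) : Measure (E d) :=
  L.ν.restrict {y | s < ‖y‖}

/-- The jumps of size between `s` and `1`. -/
noncomputable def LevyTriplet.midJumps (L : LevyTriplet d) (s : ℝ) : Measure (E d) :=
  L.ν.restrict {y | s < ‖y‖ ∧ ‖y‖ ≤ 1}

/-- A finite measure of jumps whose generator approximates `levyOp L` as `s → 0`: jumps `± s g k`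
replace the diffusion, the jump `s b` replaces the drift, jumps of `ν` smaller than `s` are
omitted, and jumps `-s y` with intensity `ν / s` compensate those with `s < |y| ≤ 1`. -/
noncomputable def LevyTriplet.jumps (L : LevyTriplet d) (s : ℝ) : Measure (E d) :=
  (ENNReal.ofReal (1 / (2 * s ^ 2)) • ∑ k, (Measure.dirac (s • L.factor k) +
    Measure.dirac (-(s • L.factor k))) + ENNReal.ofReal (1 / s) • Measure.dirac (s • L.b)) +
  (L.bigJumps s + ENNReal.ofReal (1 / s) • (L.midJumps s).map fun y => -(s • y))

/-- The generator with jump measure `L.jumps s`. -/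
noncomputable def approxOp (L : LevyTriplet d) (s : ℝ) (f : E d → ℝ) (x : E d) : ℝ :=
  ∫ y, (f (x + y) - f x) ∂(L.jumps s)

lemma LevyTriplet.ofReal_sq_mul_bigJumps_le (L : LevyTriplet d) {s : ℝ} (hs : 0 < s)
    (hs1 : s ≤ 1) : ENNReal.ofReal (s ^ 2) * L.bigJumps s univ ≤ L.weighted univ := by
  have hm : MeasurableSet {y : E d | s < ‖y‖} := measurableSet_lt measurable_const measurable_norm
  unfold LevyTriplet.bigJumps LevyTriplet.weighted
  rw [Measure.restrict_apply_univ, withDensity_apply _ MeasurableSet.univ, Measure.restrict_univ,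
    ← setLIntegral_const]
  refine (setLIntegral_mono' hm fun y hy => ?_).trans (setLIntegral_le_lintegral _ _)
  refine ENNReal.ofReal_le_ofReal (le_min (by nlinarith) ?_)
  have : s < ‖y‖ := hy
  nlinarith

lemma LevyTriplet.bigJumps_univ_lt_top (L : LevyTriplet d) {s : ℝ} (hs : 0 < s) (hs1 : s ≤ 1) :
    L.bigJumps s univ < ∞ := by
  have h := (L.ofReal_sq_mul_bigJumps_le hs hs1).trans_lt (measure_lt_top L.weighted univ)
  exact ENNReal.lt_top_of_mul_ne_top_right h.ne (by simpa using hs.ne')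

lemma LevyTriplet.bigJumps_real_le (L : LevyTriplet d) {s : ℝ} (hs : 0 < s) (hs1 : s ≤ 1) :
    (L.bigJumps s).real univ ≤ L.size / s ^ 2 := by
  have h := ENNReal.toReal_mono (measure_ne_top L.weighted univ)
    (L.ofReal_sq_mul_bigJumps_le hs hs1)
  rw [ENNReal.toReal_mul, ENNReal.toReal_ofReal (by positivity)] at h
  rw [le_div_iff₀ (by positivity)]
  have h2 : L.weighted.real univ ≤ L.size := by
    unfold LevyTriplet.size
    have := norm_nonneg L.b
    have := norm_nonneg (Matrix.toEuclideanCLM (n := Fin d) (𝕜 := ℝ) L.G)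
    linarith
  calc _ = s ^ 2 * (L.bigJumps s univ).toReal := mul_comm _ _
    _ ≤ _ := h.trans h2

lemma LevyTriplet.midJumps_le_bigJumps (L : LevyTriplet d) (s : ℝ) :
    L.midJumps s ≤ L.bigJumps s := Measure.restrict_mono (fun _ h => h.1) le_rfl

lemma LevyTriplet.isFiniteMeasure_bigJumps (L : LevyTriplet d) {s : ℝ} (hs : 0 < s) (hs1 : s ≤ 1) :
    IsFiniteMeasure (L.bigJumps s) := ⟨L.bigJumps_univ_lt_top hs hs1⟩

lemma LevyTriplet.isFiniteMeasure_midJumps (L : LevyTriplet d) {s : ℝ} (hs : 0 < s) (hs1 : s ≤ 1) :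
    IsFiniteMeasure (L.midJumps s) :=
  ⟨(L.midJumps_le_bigJumps s univ).trans_lt (L.bigJumps_univ_lt_top hs hs1)⟩

lemma LevyTriplet.measurable_neg_smul (s : ℝ) : Measurable fun y : E d => -(s • y) := by fun_prop

lemma LevyTriplet.isFiniteMeasure_jumps (L : LevyTriplet d) {s : ℝ} (hs : 0 < s) (hs1 : s ≤ 1) :
    IsFiniteMeasure (L.jumps s) := by
  have := L.isFiniteMeasure_bigJumps hs hs1
  have := L.isFiniteMeasure_midJumps hs hs1
  unfold LevyTriplet.jumps
  have h1 : IsFiniteMeasure (∑ k, (Measure.dirac (s • L.factor k) +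
    Measure.dirac (-(s • L.factor k)))) := inferInstance
  have h2 := Measure.smul_finite (∑ k, (Measure.dirac (s • L.factor k) +
    Measure.dirac (-(s • L.factor k)))) (ENNReal.ofReal_ne_top (r := 1 / (2 * s ^ 2)))
  have h3 := Measure.smul_finite (Measure.dirac (s • L.b)) (ENNReal.ofReal_ne_top (r := 1 / s))
  have h4 := Measure.smul_finite ((L.midJumps s).map fun y => -(s • y))
    (ENNReal.ofReal_ne_top (r := 1 / s))
  infer_instance

lemma LevyTriplet.integral_jumps (L : LevyTriplet d) {s : ℝ} (hs : 0 < s) (hs1 : s ≤ 1)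
    {h : E d → ℝ} (hc : Continuous h) {C : ℝ} (hb : ∀ x, |h x| ≤ C) :
    ∫ y, h y ∂(L.jumps s) = 1 / (2 * s ^ 2) * ∑ k, (h (s • L.factor k) + h (-(s • L.factor k))) +
      1 / s * h (s • L.b) + (∫ y, h y ∂(L.bigJumps s) +
        1 / s * ∫ y, h (-(s • y)) ∂(L.midJumps s)) := by
  have hint : ∀ (ρ : Measure (E d)) [IsFiniteMeasure ρ], Integrable h ρ := fun ρ _ =>
    Integrable.of_bound hc.aestronglyMeasurable C (ae_of_all _ fun x => by simpa using hb x)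
  have := L.isFiniteMeasure_bigJumps hs hs1
  have := L.isFiniteMeasure_midJumps hs hs1
  unfold LevyTriplet.jumps
  have h2 := Measure.smul_finite (∑ k, (Measure.dirac (s • L.factor k) +
    Measure.dirac (-(s • L.factor k)))) (ENNReal.ofReal_ne_top (r := 1 / (2 * s ^ 2)))
  have h3 := Measure.smul_finite (Measure.dirac (s • L.b)) (ENNReal.ofReal_ne_top (r := 1 / s))
  have h4 := Measure.smul_finite ((L.midJumps s).map fun y => -(s • y))
    (ENNReal.ofReal_ne_top (r := 1 / s))
  rw [integral_add_measure (hint _) (hint _), integral_add_measure (hint _) (hint _),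
    integral_add_measure (hint _) (hint _), integral_smul_measure, integral_smul_measure,
    integral_smul_measure, integral_finsetSum_measure (fun i _ => hint _), integral_dirac,
    integral_map (LevyTriplet.measurable_neg_smul s).aemeasurable hc.aestronglyMeasurable,
    ENNReal.toReal_ofReal (by positivity), ENNReal.toReal_ofReal (by positivity)]
  simp_rw [integral_add_measure (hint _) (hint _), integral_dirac, smul_eq_mul]

lemma LevyTriplet.jumps_real_le (L : LevyTriplet d) {s : ℝ} (hs : 0 < s) (hs1 : s ≤ 1) :
    (L.jumps s).real univ ≤ (d + 1 + 2 * L.size) / s ^ 3 := by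
  have := L.isFiniteMeasure_jumps hs hs1
  have hfb := L.isFiniteMeasure_bigJumps hs hs1
  have hfm := L.isFiniteMeasure_midJumps hs hs1
  have h := L.integral_jumps hs hs1 (h := fun _ => 1) continuous_const (C := 1) (by simp)
  simp only [integral_const, smul_eq_mul, mul_one, Finset.sum_const, Finset.card_univ,
    Fintype.card_fin, nsmul_eq_mul] at h
  rw [h]
  have hb := L.bigJumps_real_le hs hs1
  have hm : (L.midJumps s).real univ ≤ L.size / s ^ 2 := by
    refine le_trans ?_ hb
    exact ENNReal.toReal_mono (measure_ne_top _ _) (L.midJumps_le_bigJumps s univ)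
  have hK := L.size_nonneg
  have e1 : L.size / s ^ 2 ≤ L.size / s ^ 3 := by
    apply div_le_div_of_nonneg_left hK (by positivity)
    exact pow_le_pow_of_le_one hs.le hs1 (by norm_num)
  have e2 : 1 / s * (L.midJumps s).real univ ≤ L.size / s ^ 3 := by
    calc _ ≤ 1 / s * (L.size / s ^ 2) := by gcongr
      _ = _ := by field_simp
  have e3 : 1 / (2 * s ^ 2) * ((d : ℝ) * (1 + 1)) ≤ d / s ^ 3 := by
    have : 1 / (2 * s ^ 2) * ((d : ℝ) * (1 + 1)) = d / s ^ 2 := by field_simp; ring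
    rw [this]
    apply div_le_div_of_nonneg_left (by positivity) (by positivity)
    exact pow_le_pow_of_le_one hs.le hs1 (by norm_num)
  have e4 : 1 / s ≤ 1 / s ^ 3 := by
    apply div_le_div_of_nonneg_left (by positivity) (by positivity)
    calc s ^ 3 ≤ s ^ 1 := pow_le_pow_of_le_one hs.le hs1 (by norm_num)
      _ = s := pow_one s
  have e5 : (d + 1 + 2 * L.size) / s ^ 3 =
    d / s ^ 3 + 1 / s ^ 3 + (L.size / s ^ 3 + L.size / s ^ 3) := by ring
  rw [e5]
  linarith

lemma C2Bdd.approxOp_eq (hf : C2Bdd f M) (L : LevyTriplet d) {s : ℝ} (hs : 0 < s) (hs1 : s ≤ 1)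
    (x : E d) : approxOp L s f x =
      1 / (2 * s ^ 2) * ∑ k, (f (x + s • L.factor k) + f (x - s • L.factor k) - 2 * f x) +
      1 / s * (f (x + s • L.b) - f x) + (∫ y, (f (x + y) - f x) ∂(L.bigJumps s) +
        1 / s * ∫ y, (f (x - s • y) - f x) ∂(L.midJumps s)) := by
  unfold approxOp
  rw [L.integral_jumps hs hs1 (h := fun y => f (x + y) - f x) (C := 2 * M)]
  · simp only [sub_eq_add_neg]
    congr 4
    ext k
    ring
  · exact (hf.continuous.comp (continuous_const.add continuous_id)).sub continuous_const
  · intro y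
    refine (abs_sub _ _).trans ?_
    linarith [hf.abs_le (x + y), hf.abs_le x]

lemma LevyTriplet.integrable_jumpWeight (L : LevyTriplet d) : Integrable jumpWeight L.ν := by
  refine ⟨measurable_jumpWeight.aestronglyMeasurable, ?_⟩
  rw [hasFiniteIntegral_iff_ofReal (ae_of_all _ jumpWeight_nonneg)]
  exact lt_top_iff_ne_top.2 L.lintegral_ν_ne_top

lemma C2Bdd.integrable_jumpFun (hf : C2Bdd f M) (L : LevyTriplet d) (x : E d) :
    Integrable (jumpFun f x) L.ν :=
  (L.integrable_jumpWeight.const_mul (2 * M)).mono'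
    (measurable_jumpFun hf.continuous x).aestronglyMeasurable
    (ae_of_all _ fun y => by simpa using hf.abs_jumpFun_le x y)

lemma LevyTriplet.setIntegral_jumpWeight (L : LevyTriplet d) {S : Set (E d)}
    (hS : MeasurableSet S) : ∫ y in S, jumpWeight y ∂L.ν = L.weighted.real S := by
  rw [← integral_indicator_one hS, L.integral_weighted, ← integral_indicator hS]
  refine integral_congr_ae (ae_of_all _ fun y => ?_)
  by_cases hy : y ∈ S <;> simp [hy]

/-- Consistency of the jump part: replacing the compensator of the jumps with `s < |y| ≤ 1` by jumps
of size `s |y|` costs a Taylor remainder, and omitting the jumps smaller than `s` costs their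
weight. -/
lemma C2Bdd.jump_error_le (hf : C2Bdd f M) (L : LevyTriplet d) {s : ℝ} (hs : 0 < s) (hs1 : s ≤ 1)
    (x : E d) :
    |(∫ y, (f (x + y) - f x) ∂(L.bigJumps s) +
        1 / s * ∫ y, (f (x - s • y) - f x) ∂(L.midJumps s)) - ∫ y, jumpFun f x y ∂L.ν| ≤
      s * M * L.size + 2 * M * L.weighted.real (Metric.closedBall 0 s) := by
  have hM := hf.nonneg
  have := L.isFiniteMeasure_bigJumps hs hs1
  have := L.isFiniteMeasure_midJumps hs hs1
  have hmB : MeasurableSet {y : E d | s < ‖y‖} := measurableSet_lt measurable_const measurable_norm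
  have hm1 : MeasurableSet {y : E d | ‖y‖ ≤ 1} := measurableSet_le measurable_norm measurable_const
  have hmM : MeasurableSet {y : E d | s < ‖y‖ ∧ ‖y‖ ≤ 1} := hmB.inter hm1
  have hmS : MeasurableSet (Metric.closedBall (0 : E d) s) :=
    Metric.isClosed_closedBall.measurableSet
  have hcompl : {y : E d | s < ‖y‖}ᶜ = Metric.closedBall (0 : E d) s := by
    ext y; simp
  have hI := hf.integrable_jumpFun L x
  have hlin : Integrable (fun y => fderiv ℝ f x y) (L.midJumps s) := by
    refine Integrable.of_bound (fderiv ℝ f x).continuous.aestronglyMeasurable M ?_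
    refine (ae_restrict_iff' hmM).2 (ae_of_all _ fun y hy => ?_)
    refine ((fderiv ℝ f x).le_opNorm y).trans ?_
    calc _ ≤ M * 1 := mul_le_mul (hf.norm_fderiv_le x) hy.2 (norm_nonneg _) hM
      _ = M := mul_one M
  have hbd : ∀ (ρ : Measure (E d)) [IsFiniteMeasure ρ] (u : E d → E d), Measurable u →
      Integrable (fun y => f (x + u y) - f x) ρ := fun ρ _ u hu => by
    refine Integrable.of_bound (C := 2 * M) ?_ (ae_of_all _ fun y => ?_)
    · exact ((hf.continuous.measurable.comp (hu.const_add x)).sub_const _).aestronglyMeasurable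
    · refine (abs_sub _ _).trans ?_
      linarith [hf.abs_le (x + u y), hf.abs_le x]
  have e1 : ∫ y in {y : E d | s < ‖y‖}, jumpFun f x y ∂L.ν =
      ∫ y, (f (x + y) - f x) ∂(L.bigJumps s) - ∫ y, fderiv ℝ f x y ∂(L.midJumps s) := by
    have e2 : ∫ y, fderiv ℝ f x y ∂(L.midJumps s) = ∫ y, (Metric.closedBall (0 : E d) 1).indicator
        (fun z => fderiv ℝ f x z) y ∂(L.bigJumps s) := by
      have hset : {y : E d | s < ‖y‖ ∧ ‖y‖ ≤ 1} =
          Metric.closedBall (0 : E d) 1 ∩ {y | s < ‖y‖} := by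
        ext y; simp [and_comm]
      rw [integral_indicator Metric.isClosed_closedBall.measurableSet, LevyTriplet.midJumps,
        LevyTriplet.bigJumps, Measure.restrict_restrict Metric.isClosed_closedBall.measurableSet,
        hset]
    have h0 : Integrable (fun y => f (x + y) - f x) (L.bigJumps s) := hbd _ id measurable_id
    rw [e2, ← integral_sub h0]
    · rfl
    · rw [integrable_indicator_iff Metric.isClosed_closedBall.measurableSet]
      have hset : {y : E d | s < ‖y‖ ∧ ‖y‖ ≤ 1} =
          Metric.closedBall (0 : E d) 1 ∩ {y | s < ‖y‖} := by
        ext y; simp [and_comm]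
      rw [LevyTriplet.midJumps, hset] at hlin
      rw [LevyTriplet.bigJumps, IntegrableOn,
        Measure.restrict_restrict Metric.isClosed_closedBall.measurableSet]
      exact hlin
  have e3 : ∫ y, jumpFun f x y ∂L.ν = ∫ y in {y : E d | s < ‖y‖}, jumpFun f x y ∂L.ν +
      ∫ y in Metric.closedBall (0 : E d) s, jumpFun f x y ∂L.ν := by
    rw [← hcompl]
    exact (integral_add_compl hmB hI).symm
  have hneg := hbd (L.midJumps s) (fun y => -(s • y)) (LevyTriplet.measurable_neg_smul s)
  simp only [← sub_eq_add_neg] at hneg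
  have e4 : (∫ y, (f (x + y) - f x) ∂(L.bigJumps s) +
        1 / s * ∫ y, (f (x - s • y) - f x) ∂(L.midJumps s)) - ∫ y, jumpFun f x y ∂L.ν =
      ∫ y, (1 / s * (f (x - s • y) - f x) + fderiv ℝ f x y) ∂(L.midJumps s) -
        ∫ y in Metric.closedBall (0 : E d) s, jumpFun f x y ∂L.ν := by
    rw [e3, e1, integral_add (hneg.const_mul _) hlin, integral_const_mul]
    ring
  have hw : ∀ S : Set (E d), L.weighted.real S ≤ L.size := fun S => by
    have h1 : L.weighted.real S ≤ L.weighted.real univ := measureReal_mono (subset_univ _)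
    unfold LevyTriplet.size
    have := norm_nonneg L.b
    have := norm_nonneg (Matrix.toEuclideanCLM (n := Fin d) (𝕜 := ℝ) L.G)
    linarith
  have b1 : |∫ y, (1 / s * (f (x - s • y) - f x) + fderiv ℝ f x y) ∂(L.midJumps s)| ≤
      s * M * L.size := by
    have hle : ∀ᵐ y ∂(L.midJumps s),
        ‖1 / s * (f (x - s • y) - f x) + fderiv ℝ f x y‖ ≤ s * M * jumpWeight y := by
      refine (ae_restrict_iff' hmM).2 (ae_of_all _ fun y hy => ?_)
      have ht := hf.abs_taylor_le x (-(s • y))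
      rw [← sub_eq_add_neg, map_neg, map_smul, norm_neg, norm_smul, Real.norm_eq_abs,
        abs_of_pos hs, smul_eq_mul] at ht
      rw [jumpWeight_of_norm_le_one hy.2, Real.norm_eq_abs]
      have : 1 / s * (f (x - s • y) - f x) + fderiv ℝ f x y =
          1 / s * (f (x - s • y) - f x - -(s * fderiv ℝ f x y)) := by field_simp; ring
      rw [this, abs_mul, abs_of_pos (by positivity : 0 < 1 / s)]
      calc _ ≤ 1 / s * (M * (s * ‖y‖) ^ 2) := by gcongr
        _ = _ := by field_simp
    refine (norm_integral_le_of_norm_le (L.integrable_jumpWeight.restrict.const_mul _) hle).trans ?_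
    rw [integral_const_mul, L.setIntegral_jumpWeight hmM]
    exact mul_le_mul_of_nonneg_left (hw _) (by positivity)
  have b2 : |∫ y in Metric.closedBall (0 : E d) s, jumpFun f x y ∂L.ν| ≤
      2 * M * L.weighted.real (Metric.closedBall 0 s) := by
    have := norm_integral_le_of_norm_le (f := jumpFun f x)
      ((L.integrable_jumpWeight.restrict (s := Metric.closedBall 0 s)).const_mul (2 * M))
      (ae_of_all _ fun y => by simpa using hf.abs_jumpFun_le x y)
    rwa [integral_const_mul, L.setIntegral_jumpWeight hmS] at this
  rw [e4]
  exact (abs_sub _ _).trans (add_le_add b1 b2)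

/-- Quantitative consistency of the approximation. -/
lemma C2Bdd.abs_approxOp_sub_le (hf : C2Bdd f M) (L : LevyTriplet d) {s ω K : ℝ} (hs : 0 < s)
    (hs1 : s ≤ 1) (hK : L.size ≤ K)
    (hω : ∀ x z, ‖z‖ ≤ s * (1 + d * K) →
      ‖fderiv ℝ (fderiv ℝ f) (x + z) - fderiv ℝ (fderiv ℝ f) x‖ ≤ ω) (x : E d) :
    |approxOp L s f x - levyOp L f x| ≤
      ω * (d * K) + s * (M * K ^ 2 + M * K) +
        2 * M * L.weighted.real (Metric.closedBall 0 s) := by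
  have hM := hf.nonneg
  have hsz := L.size_nonneg
  have hω0 : 0 ≤ ω := (norm_nonneg (_ : E d →L[ℝ] E d →L[ℝ] ℝ)).trans
    (hω 0 0 (by rw [norm_zero]; have : 0 ≤ K := hsz.trans hK; positivity))
  have hop : levyOp L f x = (1 / 2 : ℝ) * ∑ k, fderiv ℝ (fderiv ℝ f) x (L.factor k) (L.factor k) +
      fderiv ℝ f x L.b + ∫ y, jumpFun f x y ∂L.ν := by
    rw [← L.second_order_eq]; rfl
  rw [hf.approxOp_eq L hs hs1, hop]
  have h1 : |1 / (2 * s ^ 2) * ∑ k, (f (x + s • L.factor k) + f (x - s • L.factor k) - 2 * f x) -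
      (1 / 2 : ℝ) * ∑ k, fderiv ℝ (fderiv ℝ f) x (L.factor k) (L.factor k)| ≤ ω * (d * K) := by
    have hk : ∀ k, |1 / (2 * s ^ 2) * (f (x + s • L.factor k) + f (x - s • L.factor k) - 2 * f x) -
        (1 / 2 : ℝ) * fderiv ℝ (fderiv ℝ f) x (L.factor k) (L.factor k)| ≤
        ω * ‖L.factor k‖ ^ 2 := by
      intro k
      have hn : ‖s • L.factor k‖ = s * ‖L.factor k‖ := by
        rw [norm_smul, Real.norm_eq_abs, abs_of_pos hs]
      have h := hf.abs_symm_diff_sub_le x (s • L.factor k) (ω := ω) fun z hz => hω x z (by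
        refine hz.trans ?_
        rw [hn]
        refine mul_le_mul_of_nonneg_left ((L.norm_factor_le k).trans ?_) hs.le
        gcongr)
      rw [hn] at h
      simp only [map_smul, smul_apply, smul_eq_mul] at h
      set D := fderiv ℝ (fderiv ℝ f) x (L.factor k) (L.factor k)
      have e : 1 / (2 * s ^ 2) * (f (x + s • L.factor k) + f (x - s • L.factor k) - 2 * f x) -
        (1 / 2 : ℝ) * D = 1 / (2 * s ^ 2) *
          (f (x + s • L.factor k) + f (x - s • L.factor k) - 2 * f x - s * (s * D)) := by
        field_simp
      rw [e, abs_mul, abs_of_pos (by positivity : (0 : ℝ) < 1 / (2 * s ^ 2))]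
      calc _ ≤ 1 / (2 * s ^ 2) * (2 * ω * (s * ‖L.factor k‖) ^ 2) := by gcongr
        _ = _ := by field_simp
    rw [Finset.mul_sum, Finset.mul_sum, ← Finset.sum_sub_distrib]
    refine (Finset.abs_sum_le_sum_abs _ _).trans ((Finset.sum_le_sum fun k _ => hk k).trans ?_)
    rw [← Finset.mul_sum]
    exact mul_le_mul_of_nonneg_left (L.sum_norm_factor_le.trans (by gcongr)) hω0
  have h2 : |1 / s * (f (x + s • L.b) - f x) - fderiv ℝ f x L.b| ≤ s * (M * K ^ 2) := by
    have h := hf.abs_taylor_le x (s • L.b)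
    rw [map_smul, norm_smul, Real.norm_eq_abs, abs_of_pos hs, smul_eq_mul] at h
    have e : 1 / s * (f (x + s • L.b) - f x) - fderiv ℝ f x L.b =
        1 / s * (f (x + s • L.b) - f x - s * fderiv ℝ f x L.b) := by field_simp
    have hb : ‖L.b‖ ≤ K := by
      refine le_trans ?_ hK
      unfold LevyTriplet.size
      have h1 : 0 ≤ L.weighted.real univ := measureReal_nonneg
      have := norm_nonneg (Matrix.toEuclideanCLM (n := Fin d) (𝕜 := ℝ) L.G)
      linarith
    rw [e, abs_mul, abs_of_pos (by positivity : 0 < 1 / s)]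
    calc _ ≤ 1 / s * (M * (s * K) ^ 2) := by
          refine mul_le_mul_of_nonneg_left (h.trans ?_) (by positivity)
          gcongr
      _ = _ := by field_simp
  have h3 := hf.jump_error_le L hs hs1 x
  have h4 : s * M * L.size ≤ s * M * K := by gcongr
  set A1 := 1 / (2 * s ^ 2) * ∑ k, (f (x + s • L.factor k) + f (x - s • L.factor k) - 2 * f x)
  set A2 := (1 / 2 : ℝ) * ∑ k, fderiv ℝ (fderiv ℝ f) x (L.factor k) (L.factor k)
  set B1 := 1 / s * (f (x + s • L.b) - f x)
  set C1 := ∫ y, (f (x + y) - f x) ∂(L.bigJumps s) +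
        1 / s * ∫ y, (f (x - s • y) - f x) ∂(L.midJumps s)
  have e : A1 + B1 + C1 - (A2 + fderiv ℝ f x L.b + ∫ y, jumpFun f x y ∂L.ν) =
    (A1 - A2) + (B1 - fderiv ℝ f x L.b) + (C1 - ∫ y, jumpFun f x y ∂L.ν) := by ring
  rw [e]
  refine (abs_add_three _ _ _).trans ?_
  linarith

end

/-! ### Riemann sums and products -/

section

variable {d : ℕ} {f g : E d → ℝ} {M N : ℝ}

/-- A Riemann sum is the integral of a step function. -/
lemma sum_range_eq_integral_floor {F : Type*} [NormedAddCommGroup F] [NormedSpace ℝ F]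
    [CompleteSpace F] [MeasurableSpace F] [BorelSpace F] [SecondCountableTopology F]
    (a : ℕ → F) {N : ℕ} (hN : 0 < N) (m : ℕ) :
    ∑ k ∈ Finset.range m, (1 / N : ℝ) • a k = ∫ u in (0 : ℝ)..(m / N : ℝ), a ⌊u * N⌋₊ := by
  have hN' : (0 : ℝ) < N := by exact_mod_cast hN
  have hcongr : ∀ k : ℕ, ∀ u ∈ Ioo ((k : ℝ) / N) (((k + 1 : ℕ) : ℝ) / N), a ⌊u * N⌋₊ = a k := by
    intro k u hu
    have h1 : (k : ℝ) < u * N := (div_lt_iff₀ hN').1 hu.1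
    have h2 : u * N < (k : ℝ) + 1 := by
      have := (lt_div_iff₀ hN').1 hu.2
      push_cast at this; exact this
    rw [(Nat.floor_eq_iff ((Nat.cast_nonneg k).trans h1.le)).2 ⟨h1.le, h2⟩]
  have hae : ∀ k : ℕ, ∀ᵐ u : ℝ ∂(volume.restrict (Ioc ((k : ℝ) / N) (((k + 1 : ℕ) : ℝ) / N))),
      a ⌊u * N⌋₊ = a k := by
    intro k
    rw [← restrict_Ioo_eq_restrict_Ioc]
    exact (ae_restrict_iff' measurableSet_Ioo).2 (ae_of_all _ fun u hu => hcongr k u hu)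
  have hle : ∀ k : ℕ, (k : ℝ) / N ≤ ((k + 1 : ℕ) : ℝ) / N := fun k => by
    gcongr; simp
  have h := intervalIntegral.sum_integral_adjacent_intervals (μ := volume)
    (f := fun u : ℝ => a ⌊u * N⌋₊) (a := fun k : ℕ => (k : ℝ) / N) (n := m) (fun k _ => by
      rw [intervalIntegrable_iff_integrableOn_Ioc_of_le (hle k)]
      exact (integrable_congr (hae k)).2 (integrable_const _))
  simp only [Nat.cast_zero, zero_div] at h
  rw [← h]
  refine Finset.sum_congr rfl fun k _ => ?_
  rw [intervalIntegral.integral_of_le (hle k), integral_congr_ae (hae k), setIntegral_const,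
    Real.volume_real_Ioc_of_le (hle k)]
  congr 1
  push_cast
  ring

/-- Riemann sums of step functions that converge pointwise. -/
lemma tendsto_sum_range_floor {F : Type*} [NormedAddCommGroup F] [NormedSpace ℝ F]
    [CompleteSpace F] [MeasurableSpace F] [BorelSpace F] [SecondCountableTopology F]
    {a : ℕ → ℕ → F} {N : ℕ → ℕ} (hN : ∀ n, 0 < N n) (hN' : Tendsto N atTop atTop) {B t : ℝ}
    (ht : 0 ≤ t) (hB : ∀ n k, ‖a n k‖ ≤ B) {g : ℝ → F}
    (hg : ∀ u : ℝ, 0 ≤ u → Tendsto (fun n => a n ⌊u * N n⌋₊) atTop (𝓝 (g u))) :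
    Tendsto (fun n => ∑ k ∈ Finset.range ⌊t * N n⌋₊, (1 / N n : ℝ) • a n k) atTop
      (𝓝 (∫ u in (0 : ℝ)..t, g u)) := by
  have hNr : ∀ n, (0 : ℝ) < N n := fun n => by exact_mod_cast hN n
  have hNt : Tendsto (fun n => (N n : ℝ)) atTop atTop := tendsto_natCast_atTop_atTop.comp hN'
  have hle : ∀ n, (⌊t * N n⌋₊ : ℝ) / N n ≤ t := fun n => by
    rw [div_le_iff₀ (hNr n)]
    exact Nat.floor_le (mul_nonneg ht (hNr n).le)
  have hmeas : ∀ n, Measurable fun u : ℝ => a n ⌊u * N n⌋₊ := fun n =>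
    (measurable_from_top (f := a n)).comp (Nat.measurable_floor.comp (measurable_id.mul_const _))
  have e : ∀ n, ∑ k ∈ Finset.range ⌊t * N n⌋₊, (1 / N n : ℝ) • a n k =
      ∫ u in Ioc (0 : ℝ) t, (Iic ((⌊t * N n⌋₊ : ℝ) / N n)).indicator
        (fun u => a n ⌊u * N n⌋₊) u := by
    intro n
    rw [sum_range_eq_integral_floor (a n) (hN n),
      intervalIntegral.integral_of_le (by positivity), setIntegral_indicator measurableSet_Iic,
      Ioc_inter_Iic, min_eq_right (hle n)]
  simp_rw [e]
  rw [intervalIntegral.integral_of_le ht, integral_Ioc_eq_integral_Ioo]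
  simp_rw [integral_Ioc_eq_integral_Ioo]
  refine tendsto_integral_of_dominated_convergence (fun _ => B)
    (fun n => ((hmeas n).indicator measurableSet_Iic).aestronglyMeasurable) (integrable_const _)
    (fun n => ae_of_all _ fun u => ?_) ((ae_restrict_iff' measurableSet_Ioo).2
      (ae_of_all _ fun u hu => ?_))
  · exact (norm_indicator_le_norm_self _ _).trans (hB _ _)
  · refine (hg u hu.1.le).congr' ?_
    filter_upwards [hNt.eventually_gt_atTop (1 / (t - u))] with n hn
    have htu : 0 < t - u := sub_pos.2 hu.2
    have hmem : u ∈ Iic ((⌊t * N n⌋₊ : ℝ) / N n) := by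
      rw [mem_Iic, le_div_iff₀ (hNr n)]
      have h1 := Nat.lt_floor_add_one (t * N n)
      have h2 := (div_lt_iff₀ htu).1 hn
      nlinarith
    rw [indicator_of_mem hmem]

/-- For small `z k` with `‖1 + z k‖ ≤ 1` the product of the `1 + z k` is close to the exponential of
the sum: the factors are replaced one at a time, each at a cost of `B ^ 2`, and all other factors
have norm at most `1`. -/
lemma norm_prod_one_add_sub_exp_le {z : ℕ → ℂ} {B : ℝ} (hz : ∀ k, ‖z k‖ ≤ B) (hB : B ≤ 1)
    (h1 : ∀ k, ‖1 + z k‖ ≤ 1) (m : ℕ) :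
    ‖∏ k ∈ Finset.range m, (1 + z k) - Complex.exp (∑ k ∈ Finset.range m, z k)‖ ≤ m * B ^ 2 := by
  have hre : ∀ k, (z k).re ≤ 0 := fun k => by
    have h := (Complex.re_le_norm (1 + z k)).trans (h1 k)
    simp only [Complex.add_re, Complex.one_re] at h
    linarith
  have hexp : ∀ k, ‖Complex.exp (z k)‖ ≤ 1 := fun k => by
    rw [Complex.norm_exp]
    exact Real.exp_le_one_iff.2 (hre k)
  have hprod : ∀ m, ‖∏ k ∈ Finset.range m, (1 + z k)‖ ≤ 1 := fun m => by
    rw [norm_prod]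
    exact Finset.prod_le_one (fun _ _ => norm_nonneg _) (fun k _ => h1 k)
  induction m with
  | zero => simp
  | succ m ih =>
    rw [Finset.prod_range_succ, Finset.sum_range_succ, Complex.exp_add]
    have e : (∏ k ∈ Finset.range m, (1 + z k)) * (1 + z m) -
        Complex.exp (∑ k ∈ Finset.range m, z k) * Complex.exp (z m) =
        (∏ k ∈ Finset.range m, (1 + z k)) * (-(Complex.exp (z m) - 1 - z m)) +
        (∏ k ∈ Finset.range m, (1 + z k) - Complex.exp (∑ k ∈ Finset.range m, z k)) *
          Complex.exp (z m) := by ring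
    rw [e]
    refine (norm_add_le _ _).trans ?_
    rw [norm_mul, norm_mul, norm_neg]
    have hz1 : ‖z m‖ ≤ 1 := (hz m).trans hB
    have b1 : ‖Complex.exp (z m) - 1 - z m‖ ≤ B ^ 2 :=
      (Complex.norm_exp_sub_one_sub_id_le hz1).trans
        (pow_le_pow_left₀ (norm_nonneg _) (hz m) 2)
    have b2 := mul_le_mul (hprod m) b1 (norm_nonneg _) zero_le_one
    have b3 := mul_le_mul ih (hexp m) (norm_nonneg _) (by positivity)
    push_cast
    linarith

/-! ### Curves of generators -/

/-- A curve of Lévy–Khintchine coefficients that is continuous and bounded for `tripletDist`. -/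
structure NiceCurve (Λ : ℝ → LevyTriplet d) (K : ℝ) : Prop where
  size_le : ∀ u, (Λ u).size ≤ K
  tendsto : ∀ u, Tendsto (fun v => tripletDist (Λ v) (Λ u)) (𝓝 u) (𝓝 0)

namespace NiceCurve

variable {Λ : ℝ → LevyTriplet d} {K : ℝ}

lemma nonneg (h : NiceCurve Λ K) : 0 ≤ K := (Λ 0).size_nonneg.trans (h.size_le 0)

lemma shift (h : NiceCurve Λ K) (r : ℝ) : NiceCurve (fun u => Λ (r + u)) K := by
  refine ⟨fun u => h.size_le _, fun u => (h.tendsto (r + u)).comp ?_⟩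
  exact (continuous_const.add continuous_id).tendsto u

lemma continuous_symbol_uncurry (h : NiceCurve Λ K) :
    Continuous fun p : E d × ℝ => symbol (Λ p.2) p.1 := by
  refine continuous_iff_continuousAt.2 fun ⟨ξ, u⟩ => ?_
  have h1 : Tendsto (fun p : E d × ℝ => symbol (Λ u) p.1) (𝓝 (ξ, u)) (𝓝 (symbol (Λ u) ξ)) :=
    ((continuous_symbol (Λ u)).comp continuous_fst).tendsto (ξ, u)
  have h2 : Tendsto (fun p : E d × ℝ => symbol (Λ p.2) p.1 - symbol (Λ u) p.1) (𝓝 (ξ, u))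
      (𝓝 0) := by
    rw [tendsto_zero_iff_norm_tendsto_zero]
    refine squeeze_zero (fun _ => norm_nonneg _) (fun p => norm_symbol_sub_le _ _ _) ?_
    have e : Tendsto (fun p : E d × ℝ => (1 + ‖p.1‖) ^ 2) (𝓝 (ξ, u)) (𝓝 ((1 + ‖ξ‖) ^ 2)) :=
      Continuous.tendsto (by fun_prop) (ξ, u)
    have := ((tendsto_const_nhds (x := opConst d)).mul e).mul
      ((h.tendsto u).comp (continuous_snd.tendsto (ξ, u)))
    simpa using this.const_mul 2
  have h3 := h2.add h1
  simp only [sub_add_cancel, zero_add] at h3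
  exact h3

lemma continuous_symbol_time (h : NiceCurve Λ K) (ξ : E d) :
    Continuous fun u => symbol (Λ u) ξ := by
  have h1 : Continuous fun u : ℝ => (ξ, u) := by fun_prop
  have h2 := h.continuous_symbol_uncurry.comp h1
  simpa only [Function.comp_def] using h2

/-- Along convergent times the weight of the jumps of vanishing size tends to zero: at the limit
time this holds because there are no jumps of size `0`, and the weights at the other times differ
from it by at most `tripletDist`. -/
lemma tendsto_weighted_closedBall (h : NiceCurve Λ K) {u : ℝ} {v s : ℕ → ℝ}
    (hv : Tendsto v atTop (𝓝 u)) (hs : Tendsto s atTop (𝓝 0)) :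
    Tendsto (fun n => (Λ (v n)).weighted.real (Metric.closedBall 0 (s n))) atTop (𝓝 0) := by
  have h0 : (Λ u).weighted {0} = 0 :=
    withDensity_absolutelyContinuous _ _ (Λ u).ν_zero
  have h1 : Tendsto (fun n => (Λ u).weighted.real (Metric.closedBall (0 : E d) (s n)))
      atTop (𝓝 0) := by
    have hc : Tendsto (fun r : ℝ => (Λ u).weighted (Metric.cthickening r {(0 : E d)})) (𝓝 0)
        (𝓝 ((Λ u).weighted {0})) :=
      tendsto_measure_cthickening_of_isClosed ⟨1, one_pos, measure_ne_top _ _⟩ isClosed_singleton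
    rw [h0] at hc
    have h2 := (ENNReal.tendsto_toReal ENNReal.zero_ne_top).comp (hc.comp hs)
    simp only [ENNReal.toReal_zero] at h2
    refine squeeze_zero (fun _ => measureReal_nonneg) (fun n => ?_) h2
    refine measureReal_mono (fun y hy => ?_)
    exact Metric.closedBall_subset_cthickening_singleton _ _ hy
  have h2 : Tendsto (fun n => tripletDist (Λ (v n)) (Λ u)) atTop (𝓝 0) := (h.tendsto u).comp hv
  refine squeeze_zero (fun _ => measureReal_nonneg) (fun n => ?_) (by simpa using h1.add h2)
  refine (weighted_real_le (Λ (v n)) (Λ u) Metric.isClosed_closedBall.measurableSet).trans ?_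
  gcongr
  unfold tripletDist
  have := norm_nonneg (Matrix.toEuclideanCLM (n := Fin d) (𝕜 := ℝ) ((Λ (v n)).G - (Λ u).G))
  have := norm_nonneg ((Λ (v n)).b - (Λ u).b)
  linarith

end NiceCurve

/-- A modulus of continuity of the second derivative along a null sequence of radii. -/
lemma C2Bdd.exists_modulus (hf : C2Bdd f M) (huc : UniformContinuous (fderiv ℝ (fderiv ℝ f)))
    {δ : ℕ → ℝ} (hδ : Tendsto δ atTop (𝓝 0)) :
    ∃ ω : ℕ → ℝ, Tendsto ω atTop (𝓝 0) ∧ (∀ n, 0 ≤ ω n) ∧ (∀ n, ω n ≤ 2 * M) ∧ ∀ n (x z : E d),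
      ‖z‖ ≤ δ n → ‖fderiv ℝ (fderiv ℝ f) (x + z) - fderiv ℝ (fderiv ℝ f) x‖ ≤ ω n := by
  have hM := hf.nonneg
  set S : ℕ → Set ℝ := fun n => {r | r = 0 ∨ ∃ x z : E d, ‖z‖ ≤ δ n ∧
    r = ‖fderiv ℝ (fderiv ℝ f) (x + z) - fderiv ℝ (fderiv ℝ f) x‖}
  have hb : ∀ n, ∀ r ∈ S n, r ≤ 2 * M := by
    rintro n r (rfl | ⟨x, z, -, rfl⟩)
    · positivity
    · refine (norm_sub_le (fderiv ℝ (fderiv ℝ f) (x + z)) _).trans ?_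
      linarith [hf.norm_fderiv_fderiv_le (x + z), hf.norm_fderiv_fderiv_le x]
  have hne : ∀ n, (S n).Nonempty := fun n => ⟨0, Or.inl rfl⟩
  have h0 : ∀ n, 0 ≤ sSup (S n) := fun n => le_csSup ⟨_, hb n⟩ (Or.inl rfl)
  refine ⟨fun n => sSup (S n), ?_, h0, fun n => csSup_le (hne n) (hb n),
    fun n x z hz => le_csSup ⟨_, hb n⟩ (Or.inr ⟨x, z, hz, rfl⟩)⟩
  refine tendsto_order.2 ⟨fun a ha => Eventually.of_forall fun n => ha.trans_le (h0 n),
    fun a ha => ?_⟩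
  obtain ⟨ρ, hρ, hρ'⟩ := (Metric.uniformContinuous_iff (α := E d)
    (β := E d →L[ℝ] E d →L[ℝ] ℝ)).1 huc (a / 2) (half_pos ha)
  filter_upwards [hδ.eventually (gt_mem_nhds hρ)] with n hn
  refine (csSup_le (hne n) ?_).trans_lt (half_lt_self ha)
  rintro r (rfl | ⟨x, z, hz, rfl⟩)
  · positivity
  · have := hρ' (a := x + z) (b := x) (by simpa [dist_eq_norm] using hz.trans_lt hn)
    exact (dist_eq_norm (fderiv ℝ (fderiv ℝ f) (x + z)) _).ge.trans this.le

/-- The mesh of jumps in the `n`-th approximation. -/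
noncomputable def jumpMesh (n : ℕ) : ℝ := 1 / ((n : ℝ) + 1)

lemma jumpMesh_pos (n : ℕ) : 0 < jumpMesh n := by unfold jumpMesh; positivity

lemma jumpMesh_le_one (n : ℕ) : jumpMesh n ≤ 1 := by
  unfold jumpMesh
  rw [div_le_one (by positivity)]
  linarith [(Nat.cast_nonneg n : (0 : ℝ) ≤ n)]

lemma tendsto_jumpMesh : Tendsto jumpMesh atTop (𝓝 0) := tendsto_one_div_add_atTop_nhds_zero_nat

/-- Consistency with an error that is uniform over all coefficients of bounded size, apart from the
weight of the small jumps. -/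
lemma C2Bdd.exists_consistency (hf : C2Bdd f M)
    (huc : UniformContinuous (fderiv ℝ (fderiv ℝ f))) {K : ℝ} (hK : 0 ≤ K) :
    ∃ ε : ℕ → ℝ, ∃ B, Tendsto ε atTop (𝓝 0) ∧ (∀ n, 0 ≤ ε n) ∧ (∀ n, ε n ≤ B) ∧
      ∀ n, ∀ L : LevyTriplet d, L.size ≤ K → ∀ x,
        |approxOp L (jumpMesh n) f x - levyOp L f x| ≤
          ε n + 2 * M * L.weighted.real (Metric.closedBall 0 (jumpMesh n)) := by
  have hM := hf.nonneg
  have hδ : Tendsto (fun n => jumpMesh n * (1 + d * K)) atTop (𝓝 0) := by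
    simpa using tendsto_jumpMesh.mul_const (1 + d * K)
  obtain ⟨ω, hω, hω0, hωM, hω'⟩ := hf.exists_modulus huc hδ
  refine ⟨fun n => ω n * (d * K) + jumpMesh n * (M * K ^ 2 + M * K),
    2 * M * (d * K) + 1 * (M * K ^ 2 + M * K), ?_, fun n => ?_, fun n => ?_, fun n L hL x => ?_⟩
  · simpa using (hω.mul_const (d * K)).add (tendsto_jumpMesh.mul_const (M * K ^ 2 + M * K))
  · have := hω0 n
    have := jumpMesh_pos n
    positivity
  · exact add_le_add (mul_le_mul_of_nonneg_right (hωM n) (by positivity))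
      (mul_le_mul_of_nonneg_right (jumpMesh_le_one n) (by positivity))
  · exact hf.abs_approxOp_sub_le L (jumpMesh_pos n) (jumpMesh_le_one n) hL (hω' n) x

end

/-! ### Euler chains and their limits -/

section

variable {d : ℕ} {f g : E d → ℝ} {M N : ℝ} {Λ Λ' : ℝ → LevyTriplet d} {K : ℝ}

/-- The number of steps of the `n`-th Euler chain per unit of time. It
is at least the total mass of the approximating jump measures, so that at most one jump is made in
each step. -/
noncomputable def stepCount (d : ℕ) (K : ℝ) (n : ℕ) : ℕ := ⌈(d : ℝ) + 1 + 2 * K⌉₊ * (n + 1) ^ 3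

lemma stepCount_pos (d : ℕ) {K : ℝ} (hK : 0 ≤ K) (n : ℕ) : 0 < stepCount d K n := by
  unfold stepCount
  have : 0 < ⌈(d : ℝ) + 1 + 2 * K⌉₊ := Nat.ceil_pos.2 (by positivity)
  positivity

lemma tendsto_stepCount (d : ℕ) {K : ℝ} (hK : 0 ≤ K) : Tendsto (stepCount d K) atTop atTop := by
  have h0 : 1 ≤ ⌈(d : ℝ) + 1 + 2 * K⌉₊ := Nat.ceil_pos.2 (by positivity)
  refine tendsto_atTop_mono (fun n => ?_) tendsto_id
  unfold stepCount
  calc n ≤ n + 1 := Nat.le_succ n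
    _ = (n + 1) ^ 1 := (pow_one _).symm
    _ ≤ (n + 1) ^ 3 := Nat.pow_le_pow_right (Nat.succ_pos n) (by norm_num)
    _ = 1 * (n + 1) ^ 3 := (one_mul _).symm
    _ ≤ _ := Nat.mul_le_mul_right _ h0

/-- With `h = 1 / stepCount` and `J` the approximating jump measure, the measure
`(1 - h |J|) δ₀ + h J` is a probability measure, because `stepCount` is at least the mass `|J|`. -/
lemma exists_stepLaw (L : LevyTriplet d) (hK : L.size ≤ K) (n : ℕ) :
    ∃ q : ProbabilityMeasure (E d), ∀ (g : E d → ℝ) (C : ℝ), Continuous g → (∀ x, |g x| ≤ C) →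
      ∫ y, g y ∂(q : Measure (E d)) =
        g 0 + 1 / stepCount d K n * ∫ y, (g y - g 0) ∂(L.jumps (jumpMesh n)) := by
  have hK0 : 0 ≤ K := L.size_nonneg.trans hK
  have hN : (0 : ℝ) < stepCount d K n := by exact_mod_cast stepCount_pos d hK0 n
  have := L.isFiniteMeasure_jumps (jumpMesh_pos n) (jumpMesh_le_one n)
  set J := L.jumps (jumpMesh n)
  have hJ : J.real univ ≤ stepCount d K n := by
    refine (L.jumps_real_le (jumpMesh_pos n) (jumpMesh_le_one n)).trans ?_
    have e : (d + 1 + 2 * L.size) / jumpMesh n ^ 3 = (d + 1 + 2 * L.size) * ((n : ℝ) + 1) ^ 3 := by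
      unfold jumpMesh; field_simp
    rw [e, stepCount]
    push_cast
    gcongr
    refine le_trans ?_ (Nat.le_ceil _)
    linarith
  have hp : 1 / (stepCount d K n : ℝ) * J.real univ ≤ 1 := by
    rw [one_div, inv_mul_le_iff₀ hN, mul_one]; exact hJ
  have hp0 : 0 ≤ 1 / (stepCount d K n : ℝ) * J.real univ := by positivity
  have hprob : IsProbabilityMeasure (ENNReal.ofReal (1 - 1 / (stepCount d K n : ℝ) * J.real univ) •
      Measure.dirac (0 : E d) + ENNReal.ofReal (1 / (stepCount d K n : ℝ)) • J) := by
    constructor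
    rw [Measure.add_apply, Measure.smul_apply, Measure.smul_apply, measure_univ, smul_eq_mul,
      smul_eq_mul, mul_one, ← ofReal_measureReal (μ := J) (measure_ne_top _ _),
      ← ENNReal.ofReal_mul (by positivity), ← ENNReal.ofReal_add (by linarith) hp0]
    simp
  refine ⟨⟨_, hprob⟩, fun g C hg hb => ?_⟩
  have hi : ∀ (ρ : Measure (E d)) [IsFiniteMeasure ρ], Integrable g ρ := fun ρ _ =>
    Integrable.of_bound hg.aestronglyMeasurable C (ae_of_all _ fun x => by simpa using hb x)
  simp only [ProbabilityMeasure.coe_mk]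
  rw [integral_add_measure ((hi _).smul_measure ENNReal.ofReal_ne_top)
      ((hi _).smul_measure ENNReal.ofReal_ne_top), integral_smul_measure, integral_smul_measure,
    integral_dirac, integral_sub (hi _) (integrable_const _), integral_const,
    ENNReal.toReal_ofReal (by linarith), ENNReal.toReal_ofReal (by positivity)]
  simp only [smul_eq_mul]
  ring

/-- The law of one step of the `n`-th Euler chain, as given by `exists_stepLaw`. For coefficients
of size larger than `K`, where no such law is available, it is `δ₀`. -/
noncomputable def stepLaw (K : ℝ) (n : ℕ) (L : LevyTriplet d) : ProbabilityMeasure (E d) :=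
  open Classical in
  if h : L.size ≤ K then (exists_stepLaw L h n).choose else diracProba 0

lemma integral_stepLaw {L : LevyTriplet d} (hK : L.size ≤ K) (n : ℕ) {C : ℝ} (hg : Continuous g)
    (hb : ∀ x, |g x| ≤ C) : ∫ y, g y ∂(stepLaw K n L : Measure (E d)) =
      g 0 + 1 / stepCount d K n * ∫ y, (g y - g 0) ∂(L.jumps (jumpMesh n)) := by
  unfold stepLaw
  rw [dif_pos hK]
  exact (exists_stepLaw L hK n).choose_spec g C hg hb

lemma C2Bdd.integral_stepLaw_add (hf : C2Bdd f M) {L : LevyTriplet d} (hK : L.size ≤ K) (n : ℕ)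
    (x : E d) : ∫ y, f (x + y) ∂(stepLaw K n L : Measure (E d)) =
      f x + 1 / stepCount d K n * approxOp L (jumpMesh n) f x := by
  rw [integral_stepLaw hK n (g := fun y => f (x + y)) (C := M)
    (hf.continuous.comp (continuous_const.add continuous_id)) (fun y => hf.abs_le _), add_zero]
  rfl

lemma C2Bdd.continuous_approxOp (hf : C2Bdd f M) (L : LevyTriplet d) {s : ℝ} (hs : 0 < s)
    (hs1 : s ≤ 1) : Continuous (approxOp L s f) := by
  have := L.isFiniteMeasure_jumps hs hs1
  unfold approxOp
  refine continuous_of_dominated (bound := fun _ => 2 * M) (fun x => ?_)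
    (fun x => ae_of_all _ fun y => ?_) (integrable_const _) (ae_of_all _ fun y => ?_)
  · exact ((hf.continuous.comp (continuous_const.add continuous_id)).sub
      continuous_const).aestronglyMeasurable
  · rw [Real.norm_eq_abs]
    refine (abs_sub _ _).trans ?_
    linarith [hf.abs_le (x + y), hf.abs_le x]
  · exact (hf.continuous.comp (continuous_id.add continuous_const)).sub hf.continuous

lemma LevyTriplet.weighted_real_le_size (L : LevyTriplet d) (S : Set (E d)) :
    L.weighted.real S ≤ L.size := by
  have h1 : L.weighted.real S ≤ L.weighted.real univ := measureReal_mono (subset_univ _)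
  unfold LevyTriplet.size
  have := norm_nonneg L.b
  have := norm_nonneg (Matrix.toEuclideanCLM (n := Fin d) (𝕜 := ℝ) L.G)
  linarith

/-- Errors of the approximating generators that vanish along convergent times. -/
lemma C2Bdd.exists_error (hf : C2Bdd f M) (huc : UniformContinuous (fderiv ℝ (fderiv ℝ f)))
    (hΛ : NiceCurve Λ K) : ∃ (e : ℕ → ℝ → ℝ) (B : ℝ), (∀ n v, 0 ≤ e n v) ∧ (∀ n v, e n v ≤ B) ∧
      (∀ (u : ℝ) (v : ℕ → ℝ), Tendsto v atTop (𝓝 u) →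
        Tendsto (fun n => e n (v n)) atTop (𝓝 0)) ∧
      ∀ n v x, |approxOp (Λ v) (jumpMesh n) f x - levyOp (Λ v) f x| ≤ e n v := by
  have hM := hf.nonneg
  obtain ⟨ε, B, hε, hε0, hεB, h⟩ := hf.exists_consistency huc hΛ.nonneg
  refine ⟨fun n v => ε n + 2 * M * (Λ v).weighted.real (Metric.closedBall 0 (jumpMesh n)),
    B + 2 * M * K, fun n v => ?_, fun n v => ?_, fun u v hv => ?_,
    fun n v x => h n (Λ v) (hΛ.size_le v) x⟩
  · have := hε0 n
    positivity
  · have := ((Λ v).weighted_real_le_size (Metric.closedBall 0 (jumpMesh n))).trans (hΛ.size_le v)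
    exact add_le_add (hεB n) (mul_le_mul_of_nonneg_left this (by positivity))
  · simpa using hε.add ((hΛ.tendsto_weighted_closedBall hv tendsto_jumpMesh).const_mul (2 * M))

lemma tendsto_grid (d : ℕ) (hK : 0 ≤ K) {u : ℝ} (hu : 0 ≤ u) :
    Tendsto (fun n => (⌊u * stepCount d K n⌋₊ : ℝ) / stepCount d K n) atTop (𝓝 u) :=
  (tendsto_nat_floor_mul_div_atTop hu).comp
    (tendsto_natCast_atTop_atTop.comp (tendsto_stepCount d hK))

lemma C2Bdd.exists_abs_approxOp_le (hf : C2Bdd f M)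
    (huc : UniformContinuous (fderiv ℝ (fderiv ℝ f))) (hΛ : NiceCurve Λ K) :
    ∃ B, ∀ n v x, |approxOp (Λ v) (jumpMesh n) f x| ≤ B := by
  obtain ⟨e, B, -, hB, -, h⟩ := hf.exists_error huc hΛ
  refine ⟨B + opConst d * M * K, fun n v x => ?_⟩
  have h1 := hf.abs_levyOp_le (Λ v) x
  have h2 := (h n v x).trans (hB n v)
  have h3 : opConst d * M * (Λ v).size ≤ opConst d * M * K :=
    mul_le_mul_of_nonneg_left (hΛ.size_le v) (mul_nonneg (opConst_pos d).le hf.nonneg)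
  calc _ = |(approxOp (Λ v) (jumpMesh n) f x - levyOp (Λ v) f x) + levyOp (Λ v) f x| := by
        rw [sub_add_cancel]
    _ ≤ _ := (abs_add_le _ _).trans (by linarith)

/-- The approximating generators converge uniformly along convergent times. -/
lemma C2Bdd.exists_tendsto_error (hf : C2Bdd f M)
    (huc : UniformContinuous (fderiv ℝ (fderiv ℝ f))) (hΛ : NiceCurve Λ K) {u : ℝ} {v : ℕ → ℝ}
    (hv : Tendsto v atTop (𝓝 u)) : ∃ e : ℕ → ℝ, Tendsto e atTop (𝓝 0) ∧
      ∀ n x, |approxOp (Λ (v n)) (jumpMesh n) f x - levyOp (Λ u) f x| ≤ e n := by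
  obtain ⟨e, -, -, -, he, h⟩ := hf.exists_error huc hΛ
  refine ⟨fun n => e n (v n) + opConst d * M * tripletDist (Λ (v n)) (Λ u), ?_, fun n x => ?_⟩
  · simpa using (he u v hv).add (((hΛ.tendsto u).comp hv).const_mul (opConst d * M))
  · calc _ = |(approxOp (Λ (v n)) (jumpMesh n) f x - levyOp (Λ (v n)) f x) +
          (levyOp (Λ (v n)) f x - levyOp (Λ u) f x)| := by rw [sub_add_sub_cancel]
      _ ≤ _ := (abs_add_le _ _).trans (add_le_add (h n _ x) (hf.abs_levyOp_sub_le _ _ x))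

/-- The `n`-th Euler chain for the curve `Λ` with initial law `m`. -/
noncomputable def eulerChain (Λ : ℝ → LevyTriplet d) (K : ℝ) (n : ℕ)
    (m : ProbabilityMeasure (E d)) : ℕ → ProbabilityMeasure (E d)
  | 0 => m
  | k + 1 => convP (eulerChain Λ K n m k) (stepLaw K n (Λ ((k : ℝ) / stepCount d K n)))

lemma convP_comm (μ ν : ProbabilityMeasure (E d)) : convP μ ν = convP ν μ :=
  probabilityMeasure_ext_charFun fun ξ => by rw [charFun_convP, charFun_convP, mul_comm]

lemma integral_eulerChain_succ (hΛ : NiceCurve Λ K) (n : ℕ) (m : ProbabilityMeasure (E d)) (k : ℕ)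
    (hf : C2Bdd f M) : ∫ x, f x ∂(eulerChain Λ K n m (k + 1) : Measure (E d)) =
      ∫ x, f x ∂(eulerChain Λ K n m k : Measure (E d)) + 1 / stepCount d K n *
        ∫ x, approxOp (Λ ((k : ℝ) / stepCount d K n)) (jumpMesh n) f x
          ∂(eulerChain Λ K n m k : Measure (E d)) := by
  have hJ := (Λ ((k : ℝ) / stepCount d K n)).isFiniteMeasure_jumps (jumpMesh_pos n)
    (jumpMesh_le_one n)
  rw [eulerChain, convP_comm, integral_convP _ _ hf.continuous hf.abs_le]
  have e : ∀ x, ∫ y, f (y + x) ∂(stepLaw K n (Λ ((k : ℝ) / stepCount d K n)) : Measure (E d)) =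
      f x + 1 / stepCount d K n *
        approxOp (Λ ((k : ℝ) / stepCount d K n)) (jumpMesh n) f x := fun x => by
    rw [← hf.integral_stepLaw_add (hΛ.size_le _) n x]
    simp only [add_comm]
  simp_rw [e]
  rw [integral_add (hf.integrable _), integral_const_mul]
  refine Integrable.const_mul (Integrable.of_bound
    (hf.continuous_approxOp _ (jumpMesh_pos n) (jumpMesh_le_one n)).aestronglyMeasurable
    (2 * M * ((Λ ((k : ℝ) / stepCount d K n)).jumps (jumpMesh n)).real univ)
    (ae_of_all _ fun x => ?_)) _
  refine norm_integral_le_of_norm_le_const (ae_of_all _ fun y => ?_)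
  rw [Real.norm_eq_abs]
  refine (abs_sub _ _).trans ?_
  linarith [hf.abs_le (x + y), hf.abs_le x]

/-- Dynkin's formula for the Euler chain, which holds without an error term for the approximating
generators. -/
lemma integral_eulerChain (hΛ : NiceCurve Λ K) (n : ℕ) (m : ProbabilityMeasure (E d)) (k : ℕ)
    (hf : C2Bdd f M) : ∫ x, f x ∂(eulerChain Λ K n m k : Measure (E d)) =
      ∫ x, f x ∂(m : Measure (E d)) + ∑ j ∈ Finset.range k, (1 / stepCount d K n : ℝ) •
        ∫ x, approxOp (Λ ((j : ℝ) / stepCount d K n)) (jumpMesh n) f x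
          ∂(eulerChain Λ K n m j : Measure (E d)) := by
  induction k with
  | zero => simp [eulerChain]
  | succ k ih =>
    rw [integral_eulerChain_succ hΛ n m k hf, ih, Finset.sum_range_succ, smul_eq_mul]
    ring

/-- The symbol of the approximating generator. -/
noncomputable def approxSymbol (L : LevyTriplet d) (s : ℝ) (ξ : E d) : ℂ :=
  approxOp L s (wave ξ 0) 0 + approxOp L s (wave ξ (-(Real.pi / 2))) 0 * Complex.I

lemma charFun_stepLaw {L : LevyTriplet d} (hK : L.size ≤ K) (n : ℕ) (ξ : E d) :
    charFun (stepLaw K n L : Measure (E d)) ξ =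
      1 + (1 / stepCount d K n : ℝ) • approxSymbol L (jumpMesh n) ξ := by
  have h := fun θ => (c2Bdd_wave ξ θ).integral_stepLaw_add hK n 0
  simp only [zero_add] at h
  rw [charFun_eq_wave, h, h, approxSymbol]
  have h0 : wave ξ 0 (0 : E d) = 1 := by simp [wave]
  have h1 : wave ξ (-(Real.pi / 2)) (0 : E d) = 0 := by simp [wave]
  rw [h0, h1, Complex.real_smul]
  push_cast
  ring

lemma charFun_eulerChain (hΛ : NiceCurve Λ K) (n : ℕ) (m : ProbabilityMeasure (E d)) (k : ℕ)
    (ξ : E d) : charFun (eulerChain Λ K n m k : Measure (E d)) ξ =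
      charFun (m : Measure (E d)) ξ * ∏ j ∈ Finset.range k, (1 + (1 / stepCount d K n : ℝ) •
        approxSymbol (Λ ((j : ℝ) / stepCount d K n)) (jumpMesh n) ξ) := by
  induction k with
  | zero => simp [eulerChain]
  | succ k ih =>
    rw [eulerChain, charFun_convP, ih, charFun_stepLaw (hΛ.size_le _), Finset.prod_range_succ,
      mul_assoc]

/-- The characteristic functions of the Euler chains are products of factors `1 + h ψ` with `ψ` the
symbol of the approximating generator, hence converge to the exponential of the integrated
symbol. -/
lemma tendsto_charFun_eulerChain (hΛ : NiceCurve Λ K) (m : ProbabilityMeasure (E d)) {t : ℝ}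
    (ht : 0 ≤ t) (ξ : E d) :
    Tendsto (fun n => charFun (eulerChain Λ K n m ⌊t * stepCount d K n⌋₊ : Measure (E d)) ξ) atTop
      (𝓝 (charFun (m : Measure (E d)) ξ *
        Complex.exp (∫ u in (0 : ℝ)..t, symbol (Λ u) ξ))) := by
  have hK := hΛ.nonneg
  have hNr : ∀ n, (0 : ℝ) < stepCount d K n := fun n => by exact_mod_cast stepCount_pos d hK n
  have hw := c2Bdd_wave ξ
  have huc := uniformContinuous_fderiv_fderiv_wave ξ
  obtain ⟨B₀, hB₀⟩ := (hw 0).exists_abs_approxOp_le (huc 0) hΛ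
  obtain ⟨B₁, hB₁⟩ := (hw (-(Real.pi / 2))).exists_abs_approxOp_le (huc _) hΛ
  have hB : ∀ n v, ‖approxSymbol (Λ v) (jumpMesh n) ξ‖ ≤ B₀ + B₁ := fun n v =>
    (norm_add_mul_I_le _ _).trans (add_le_add (hB₀ n v 0) (hB₁ n v 0))
  have hB0 : 0 ≤ B₀ + B₁ := (norm_nonneg _).trans (hB 0 0)
  have hsum : Tendsto (fun n => ∑ k ∈ Finset.range ⌊t * stepCount d K n⌋₊,
      (1 / stepCount d K n : ℝ) • approxSymbol (Λ ((k : ℝ) / stepCount d K n)) (jumpMesh n) ξ)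
      atTop (𝓝 (∫ u in (0 : ℝ)..t, symbol (Λ u) ξ)) := by
    refine tendsto_sum_range_floor
      (a := fun n k => approxSymbol (Λ ((k : ℝ) / stepCount d K n)) (jumpMesh n) ξ)
      (fun n => stepCount_pos d hK n) (tendsto_stepCount d hK) ht (fun n k => hB n _)
      (fun u hu => ?_)
    have hθ : ∀ θ, Tendsto (fun n => approxOp (Λ ((⌊u * stepCount d K n⌋₊ : ℝ) / stepCount d K n))
        (jumpMesh n) (wave ξ θ) 0) atTop (𝓝 (levyOp (Λ u) (wave ξ θ) 0)) := fun θ => by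
      obtain ⟨e, he, h⟩ := (hw θ).exists_tendsto_error (huc θ) hΛ (tendsto_grid d hK hu)
      rw [tendsto_iff_norm_sub_tendsto_zero]
      exact squeeze_zero (fun _ => norm_nonneg _) (fun n => h n 0) he
    exact ((Complex.continuous_ofReal.tendsto _).comp (hθ 0)).add
      (((Complex.continuous_ofReal.tendsto _).comp (hθ _)).mul_const _)
  have hexp := (Complex.continuous_exp.tendsto _).comp hsum
  simp_rw [charFun_eulerChain hΛ]
  refine Tendsto.const_mul _ ?_
  have hdiff : Tendsto (fun n => ∏ j ∈ Finset.range ⌊t * stepCount d K n⌋₊,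
      (1 + (1 / stepCount d K n : ℝ) •
        approxSymbol (Λ ((j : ℝ) / stepCount d K n)) (jumpMesh n) ξ) -
      Complex.exp (∑ k ∈ Finset.range ⌊t * stepCount d K n⌋₊,
      (1 / stepCount d K n : ℝ) • approxSymbol (Λ ((k : ℝ) / stepCount d K n)) (jumpMesh n) ξ))
      atTop (𝓝 0) := by
    rw [tendsto_zero_iff_norm_tendsto_zero]
    have hNt : Tendsto (fun n => (stepCount d K n : ℝ)) atTop atTop :=
      tendsto_natCast_atTop_atTop.comp (tendsto_stepCount d hK)
    have hz : Tendsto (fun n => t * (B₀ + B₁) ^ 2 / (stepCount d K n : ℝ)) atTop (𝓝 0) :=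
      hNt.const_div_atTop _
    refine squeeze_zero' (Eventually.of_forall fun _ => norm_nonneg _) ?_ hz
    filter_upwards [hNt.eventually_ge_atTop (B₀ + B₁)] with n hn
    have hle : (B₀ + B₁) / stepCount d K n ≤ 1 := (div_le_one (hNr n)).2 hn
    refine (norm_prod_one_add_sub_exp_le (B := (B₀ + B₁) / stepCount d K n) (fun k => ?_) hle
      (fun k => ?_) _).trans ?_
    · rw [norm_smul, Real.norm_eq_abs, abs_of_pos (by have := hNr n; positivity), one_div,
        div_eq_inv_mul (B₀ + B₁)]
      exact mul_le_mul_of_nonneg_left (hB n _) (inv_nonneg.2 (hNr n).le)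
    · rw [← charFun_stepLaw (hΛ.size_le _)]
      exact norm_charFun_le_one ξ
    · have hfl : (⌊t * stepCount d K n⌋₊ : ℝ) ≤ t * stepCount d K n :=
        Nat.floor_le (mul_nonneg ht (hNr n).le)
      calc _ ≤ t * stepCount d K n * ((B₀ + B₁) / stepCount d K n) ^ 2 := by gcongr
        _ = _ := by have := (hNr n).ne'; field_simp
  simpa using hdiff.add hexp

/-- The limit of the characteristic functions of the Euler chains is continuous, so by Lévy's
continuity theorem it is a characteristic function. -/
lemma exists_flow (hΛ : NiceCurve Λ K) {t : ℝ} (ht : 0 ≤ t) :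
    ∃ P : ProbabilityMeasure (E d), ∀ ξ, charFun (P : Measure (E d)) ξ =
      Complex.exp (∫ u in (0 : ℝ)..t, symbol (Λ u) ξ) := by
  have hc : Continuous fun ξ : E d => Complex.exp (∫ u in (0 : ℝ)..t, symbol (Λ u) ξ) := by
    refine Complex.continuous_exp.comp ?_
    exact intervalIntegral.continuous_parametric_intervalIntegral_of_continuous'
      (f := fun ξ u => symbol (Λ u) ξ) hΛ.continuous_symbol_uncurry 0 t
  obtain ⟨P, hP, -⟩ := exists_tendsto_of_tendsto_charFun hc.continuousAt
    (μ := fun n => eulerChain Λ K n (diracProba 0) ⌊t * stepCount d K n⌋₊)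
    (fun ξ => by
      have h := tendsto_charFun_eulerChain hΛ (diracProba 0) ht ξ
      simpa [charFun_dirac, diracProba] using h)
  exact ⟨P, hP⟩

/-- The law at time `t` of the additive process with generators `levyOp (Λ u)` started at the
origin at time `0`, where it exists. -/
noncomputable def flow (Λ : ℝ → LevyTriplet d) (t : ℝ) : ProbabilityMeasure (E d) :=
  open Classical in
  if h : ∃ P : ProbabilityMeasure (E d), ∀ ξ, charFun (P : Measure (E d)) ξ =
    Complex.exp (∫ u in (0 : ℝ)..t, symbol (Λ u) ξ) then h.choose
  else diracProba 0

lemma charFun_flow (hΛ : NiceCurve Λ K) {t : ℝ} (ht : 0 ≤ t) (ξ : E d) :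
    charFun (flow Λ t : Measure (E d)) ξ =
      Complex.exp (∫ u in (0 : ℝ)..t, symbol (Λ u) ξ) := by
  unfold flow
  rw [dif_pos (exists_flow hΛ ht)]
  exact (exists_flow hΛ ht).choose_spec ξ

lemma tendsto_eulerChain (hΛ : NiceCurve Λ K) (m : ProbabilityMeasure (E d)) {t : ℝ}
    (ht : 0 ≤ t) : Tendsto (fun n => eulerChain Λ K n m ⌊t * stepCount d K n⌋₊) atTop
      (𝓝 (convP m (flow Λ t))) := by
  refine ProbabilityMeasure.tendsto_of_tendsto_charFun fun ξ => ?_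
  rw [charFun_convP, charFun_flow hΛ ht]
  exact tendsto_charFun_eulerChain hΛ m ht ξ

/-- Dynkin's formula for the additive process. -/
lemma integral_convP_flow (hΛ : NiceCurve Λ K) (m : ProbabilityMeasure (E d)) (hf : C2Bdd f M)
    (huc : UniformContinuous (fderiv ℝ (fderiv ℝ f))) {t : ℝ} (ht : 0 ≤ t) :
    ∫ x, f x ∂(convP m (flow Λ t) : Measure (E d)) = ∫ x, f x ∂(m : Measure (E d)) +
      ∫ u in (0 : ℝ)..t, ∫ x, levyOp (Λ u) f x ∂(convP m (flow Λ u) : Measure (E d)) := by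
  have hK := hΛ.nonneg
  obtain ⟨B, hB⟩ := hf.exists_abs_approxOp_le huc hΛ
  have h1 := tendsto_integral_of_tendsto (tendsto_eulerChain hΛ m ht) hf.continuous hf.abs_le
  refine tendsto_nhds_unique h1 ?_
  simp_rw [integral_eulerChain hΛ _ m _ hf]
  refine Tendsto.const_add _ (tendsto_sum_range_floor (B := B)
      (a := fun n k => ∫ x, approxOp (Λ ((k : ℝ) / stepCount d K n)) (jumpMesh n) f x
          ∂(eulerChain Λ K n m k : Measure (E d)))
      (fun n => stepCount_pos d hK n) (tendsto_stepCount d hK) ht (fun n k => ?_)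
      (fun u hu => ?_))
  · have := norm_integral_le_of_norm_le_const (μ := (eulerChain Λ K n m k : Measure (E d)))
      (f := approxOp (Λ ((k : ℝ) / stepCount d K n)) (jumpMesh n) f) (C := B)
      (ae_of_all _ fun x => hB n _ x)
    simpa using this
  · obtain ⟨e, he, h⟩ := hf.exists_tendsto_error huc hΛ (tendsto_grid d hK hu)
    have h2 := tendsto_integral_of_tendsto (tendsto_eulerChain hΛ m hu)
      (hf.continuous_levyOp (Λ u)) (hf.abs_levyOp_le (Λ u))
    refine h2.congr_dist (squeeze_zero (fun _ => dist_nonneg) (fun n => ?_) he)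
    have hJ : ∀ x, ‖levyOp (Λ u) f x -
        approxOp (Λ ((⌊u * stepCount d K n⌋₊ : ℝ) / stepCount d K n)) (jumpMesh n) f x‖ ≤ e n :=
      fun x => by rw [norm_sub_rev]; exact h n x
    rw [dist_eq_norm, ← integral_sub]
    · have := norm_integral_le_of_norm_le_const
        (μ := (eulerChain Λ K n m ⌊u * stepCount d K n⌋₊ : Measure (E d)))
        (ae_of_all _ hJ)
      simpa using this
    · exact Integrable.of_bound (hf.continuous_levyOp (Λ u)).aestronglyMeasurable _
        (ae_of_all _ fun x => hf.abs_levyOp_le (Λ u) x)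
    · exact Integrable.of_bound (hf.continuous_approxOp _ (jumpMesh_pos n)
        (jumpMesh_le_one n)).aestronglyMeasurable B (ae_of_all _ fun x => hB n _ x)

end

/-! ### Stability of the additive process -/

section

variable {d : ℕ} {f g : E d → ℝ} {M N : ℝ} {Λ Λ' : ℝ → LevyTriplet d} {K : ℝ}

lemma IsC2Infty.uniformContinuous_fderiv_fderiv (hf : IsC2Infty f) :
    UniformContinuous (fderiv ℝ (fderiv ℝ f)) := by
  have hb := C2Bdd.of_isC2Infty hf
  refine (hb.contDiff_fderiv.continuous_fderiv
    (by norm_num)).uniformContinuous_of_tendsto_cocompact (x := 0) ?_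
  have h := (hf.2 2 le_rfl).norm
  rw [norm_zero] at h
  refine (tendsto_zero_iff_norm_tendsto_zero (E := E d →L[ℝ] E d →L[ℝ] ℝ)).2
    (h.congr fun x => ?_)
  rw [← norm_iteratedFDeriv_fderiv, norm_iteratedFDeriv_one]

lemma fderiv_fderiv_comp_add_right (f : E d → ℝ) (a x : E d) :
    fderiv ℝ (fderiv ℝ fun z => f (z + a)) x = fderiv ℝ (fderiv ℝ f) (x + a) := by
  have h : (fderiv ℝ fun z => f (z + a)) = fun z => fderiv ℝ f (z + a) :=
    funext fun z => fderiv_comp_add_right a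
  rw [h, fderiv_comp_add_right]

lemma approxOp_comp_add_right (L : LevyTriplet d) (s : ℝ) (f : E d → ℝ) (a x : E d) :
    approxOp L s (fun z => f (z + a)) x = approxOp L s f (x + a) := by
  unfold approxOp
  refine integral_congr_ae (ae_of_all _ fun y => ?_)
  simp only [add_right_comm]

lemma C2Bdd.integrable_approxOp (hf : C2Bdd f M) (huc : UniformContinuous (fderiv ℝ (fderiv ℝ f)))
    (hΛ : NiceCurve Λ K) (n : ℕ) (v : ℝ) (ρ : Measure (E d)) [IsFiniteMeasure ρ] :
    Integrable (approxOp (Λ v) (jumpMesh n) f) ρ := by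
  obtain ⟨B, hB⟩ := hf.exists_abs_approxOp_le huc hΛ
  exact Integrable.of_bound (hf.continuous_approxOp _ (jumpMesh_pos n)
        (jumpMesh_le_one n)).aestronglyMeasurable B (ae_of_all _ fun x => hB n _ x)

/-- The error made by replacing the steps of one Euler chain by those of another one. The test
function is translated by `y` so that the induction over the number of steps can absorb a last
step common to both chains. -/
lemma C2Bdd.abs_integral_eulerChain_sub_le (hf : C2Bdd f M)
    (huc : UniformContinuous (fderiv ℝ (fderiv ℝ f)))
    (hΛ : NiceCurve Λ K) (hΛ' : NiceCurve Λ' K) (n : ℕ) {a : ℕ → ℝ}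
    (ha : ∀ (k : ℕ) x, |approxOp (Λ ((k : ℝ) / stepCount d K n)) (jumpMesh n) f x -
      approxOp (Λ' ((k : ℝ) / stepCount d K n)) (jumpMesh n) f x| ≤ a k)
    (m : ProbabilityMeasure (E d)) (k : ℕ) (y : E d) :
    |∫ x, f (x + y) ∂(eulerChain Λ K n m k : Measure (E d)) -
      ∫ x, f (x + y) ∂(eulerChain Λ' K n m k : Measure (E d))| ≤
      ∑ j ∈ Finset.range k, (1 / stepCount d K n : ℝ) • a j := by
  have hN : (0 : ℝ) < stepCount d K n := by exact_mod_cast stepCount_pos d hΛ.nonneg n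
  induction k generalizing y with
  | zero => simp [eulerChain]
  | succ k ih =>
    have hfy := hf.comp_add_right y
    have hucy : UniformContinuous (fderiv ℝ (fderiv ℝ fun x => f (x + y))) := by
      have : fderiv ℝ (fderiv ℝ fun x => f (x + y)) =
          fun x => fderiv ℝ (fderiv ℝ f) (x + y) := funext fun x =>
        fderiv_fderiv_comp_add_right f y x
      rw [this]
      exact huc.comp (uniformContinuous_id.add uniformContinuous_const)
    set v := (k : ℝ) / stepCount d K n
    set q := eulerChain Λ K n m k
    set q' := eulerChain Λ' K n m k
    -- the hybrid chain makes `k` steps of the first kind and a last one of the second kind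
    have h1 : ∫ x, f (x + y) ∂(eulerChain Λ K n m (k + 1) : Measure (E d)) =
        ∫ x, f (x + y) ∂(convP q (stepLaw K n (Λ' v)) : Measure (E d)) +
        1 / stepCount d K n * ∫ x, (approxOp (Λ v) (jumpMesh n) (fun x => f (x + y)) x -
          approxOp (Λ' v) (jumpMesh n) (fun x => f (x + y)) x) ∂(q : Measure (E d)) := by
      have hq : ∫ x, f (x + y) ∂(convP q (stepLaw K n (Λ' v)) : Measure (E d)) =
          ∫ x, f (x + y) ∂(q : Measure (E d)) + 1 / stepCount d K n *
            ∫ x, approxOp (Λ' v) (jumpMesh n) (fun x => f (x + y)) x ∂(q : Measure (E d)) := by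
        rw [convP_comm, integral_convP _ _ hfy.continuous hfy.abs_le]
        have e : ∀ x, ∫ z, f (z + x + y) ∂(stepLaw K n (Λ' v) : Measure (E d)) =
            f (x + y) + 1 / stepCount d K n *
              approxOp (Λ' v) (jumpMesh n) (fun x => f (x + y)) x := fun x => by
          rw [← hfy.integral_stepLaw_add (hΛ'.size_le _) n x]
          simp only [add_comm x]
        simp_rw [e]
        rw [integral_add (hfy.integrable _)
          ((hfy.integrable_approxOp hucy hΛ' n v _).const_mul _), integral_const_mul]
      rw [integral_eulerChain_succ hΛ n m k hfy, hq,
        integral_sub (hfy.integrable_approxOp hucy hΛ n v _)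
          (hfy.integrable_approxOp hucy hΛ' n v _)]
      ring
    have hint : ∀ ρ : ProbabilityMeasure (E d), Integrable
        (fun z => ∫ x, f (x + z + y) ∂(ρ : Measure (E d)))
        (stepLaw K n (Λ' v) : Measure (E d)) := fun ρ => by
      refine Integrable.of_bound (C := M) ?_ (ae_of_all _ fun z => ?_)
      · have hc : Continuous (Function.uncurry fun z x : E d => f (x + z + y)) :=
          hf.continuous.comp ((continuous_snd.add continuous_fst).add continuous_const)
        exact hc.stronglyMeasurable.integral_prod_right.aestronglyMeasurable
      · exact (hfy.comp_add_right z).abs_integral_le _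
    have h2 : |∫ x, f (x + y) ∂(convP q (stepLaw K n (Λ' v)) : Measure (E d)) -
        ∫ x, f (x + y) ∂(eulerChain Λ' K n m (k + 1) : Measure (E d))| ≤
        ∑ j ∈ Finset.range k, (1 / stepCount d K n : ℝ) • a j := by
      rw [eulerChain, integral_convP _ _ hfy.continuous hfy.abs_le,
        integral_convP _ _ hfy.continuous hfy.abs_le, ← integral_sub (hint q) (hint q')]
      have := norm_integral_le_of_norm_le_const (μ := (stepLaw K n (Λ' v) : Measure (E d)))
        (f := fun z => ∫ x, f (x + z + y) ∂(q : Measure (E d)) -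
          ∫ x, f (x + z + y) ∂(q' : Measure (E d))) (ae_of_all _ fun z => by
            have := ih (z + y)
            simp only [← add_assoc] at this
            exact this)
      simpa using this
    have h3 : |∫ x, (approxOp (Λ v) (jumpMesh n) (fun x => f (x + y)) x -
          approxOp (Λ' v) (jumpMesh n) (fun x => f (x + y)) x) ∂(q : Measure (E d))| ≤ a k := by
      have := norm_integral_le_of_norm_le_const (μ := (q : Measure (E d)))
        (f := fun x => approxOp (Λ v) (jumpMesh n) (fun x => f (x + y)) x -
          approxOp (Λ' v) (jumpMesh n) (fun x => f (x + y)) x) (ae_of_all _ fun x => by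
            rw [approxOp_comp_add_right, approxOp_comp_add_right]
            exact ha k (x + y))
      simpa using this
    rw [h1, Finset.sum_range_succ, smul_eq_mul, add_sub_right_comm]
    refine (abs_add_le _ _).trans (add_le_add h2 ?_)
    rw [abs_mul, abs_of_pos (by positivity)]
    gcongr

/-- The laws of two additive processes differ by at most the integrated distance of their
generators. -/
lemma C2Bdd.abs_integral_convP_flow_sub_le (hf : C2Bdd f M)
    (huc : UniformContinuous (fderiv ℝ (fderiv ℝ f)))
    (hΛ : NiceCurve Λ K) (hΛ' : NiceCurve Λ' K) {δ : ℝ → ℝ} (hδ : Continuous δ) {B : ℝ}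
    (hδB : ∀ u, |δ u| ≤ B) (hle : ∀ u, 0 ≤ u → tripletDist (Λ u) (Λ' u) ≤ δ u)
    (m : ProbabilityMeasure (E d)) {t : ℝ} (ht : 0 ≤ t) :
    |∫ x, f x ∂(convP m (flow Λ t) : Measure (E d)) -
      ∫ x, f x ∂(convP m (flow Λ' t) : Measure (E d))| ≤
      ∫ u in (0 : ℝ)..t, opConst d * M * δ u := by
  have hK := hΛ.nonneg
  have hM := hf.nonneg
  have hC := (opConst_pos d).le
  obtain ⟨e, C, he0, heC, he, h⟩ := hf.exists_error huc hΛ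
  obtain ⟨e', C', he0', heC', he', h'⟩ := hf.exists_error huc hΛ'
  have h1 := (tendsto_integral_of_tendsto (tendsto_eulerChain hΛ m ht) hf.continuous hf.abs_le).sub
    (tendsto_integral_of_tendsto (tendsto_eulerChain hΛ' m ht) hf.continuous hf.abs_le)
  set a : ℕ → ℕ → ℝ := fun n k => e n ((k : ℝ) / stepCount d K n) +
    e' n ((k : ℝ) / stepCount d K n) + opConst d * M * δ ((k : ℝ) / stepCount d K n) with ha
  have h2 : Tendsto (fun n => ∑ k ∈ Finset.range ⌊t * stepCount d K n⌋₊,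
      (1 / stepCount d K n : ℝ) • a n k) atTop (𝓝 (∫ u in (0 : ℝ)..t, opConst d * M * δ u)) := by
    refine tendsto_sum_range_floor (B := C + C' + opConst d * M * B)
      (fun n => stepCount_pos d hK n) (tendsto_stepCount d hK) ht (fun n k => ?_)
      (fun u hu => ?_)
    · rw [Real.norm_eq_abs]
      refine (abs_add_three _ _ _).trans (add_le_add (add_le_add ?_ ?_) ?_)
      · rw [abs_of_nonneg (he0 _ _)]; exact heC _ _
      · rw [abs_of_nonneg (he0' _ _)]; exact heC' _ _
      · rw [abs_mul, abs_of_nonneg (mul_nonneg hC hM)]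
        exact mul_le_mul_of_nonneg_left (hδB _) (mul_nonneg hC hM)
    · have hg := tendsto_grid d hK hu
      simpa using ((he u _ hg).add (he' u _ hg)).add
        (((hδ.tendsto u).comp hg).const_mul (opConst d * M))
  refine le_of_tendsto_of_tendsto' h1.abs h2 fun n => ?_
  have hN : (0 : ℝ) < stepCount d K n := by exact_mod_cast stepCount_pos d hK n
  have := hf.abs_integral_eulerChain_sub_le huc hΛ hΛ' n (a := a n) (fun k x => ?_) m
    ⌊t * stepCount d K n⌋₊ 0
  · simpa only [add_zero] using this
  · set v := (k : ℝ) / stepCount d K n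
    have hv : 0 ≤ v := by positivity
    have b1 := h n v x
    have b2 := h' n v x
    have b3 := (hf.abs_levyOp_sub_le (Λ v) (Λ' v) x).trans
      (mul_le_mul_of_nonneg_left (hle v hv) (mul_nonneg hC hM))
    have e1 : approxOp (Λ v) (jumpMesh n) f x - approxOp (Λ' v) (jumpMesh n) f x =
      (approxOp (Λ v) (jumpMesh n) f x - levyOp (Λ v) f x) +
      -(approxOp (Λ' v) (jumpMesh n) f x - levyOp (Λ' v) f x) +
      (levyOp (Λ v) f x - levyOp (Λ' v) f x) := by ring
    rw [e1]
    refine (abs_add_three _ _ _).trans ?_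
    rw [abs_neg]
    simp only [ha]
    linarith

/-! ### Transition laws of the additive process -/

lemma continuous_of_continuous_charFun {X : Type*} [TopologicalSpace X] [SequentialSpace X]
    {ρ : X → ProbabilityMeasure (E d)}
    (h : ∀ ξ, Continuous fun x => charFun (ρ x : Measure (E d)) ξ) : Continuous ρ := by
  refine continuous_iff_seqContinuous.2 fun x x₀ hx => ?_
  exact ProbabilityMeasure.tendsto_of_tendsto_charFun fun ξ => ((h ξ).tendsto x₀).comp hx

/-- The law of the increment over `[r, t]` of the additive process with generators
`levyOp (Λ u)`. For `t ≤ r` it is the point mass at the origin. -/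
noncomputable def transLaw (Λ : ℝ → LevyTriplet d) (r t : ℝ) : ProbabilityMeasure (E d) :=
  flow (fun u => Λ (r + u)) (max r t - r)

lemma charFun_transLaw (hΛ : NiceCurve Λ K) (r t : ℝ) (ξ : E d) :
    charFun (transLaw Λ r t : Measure (E d)) ξ =
      Complex.exp (∫ u in r..max r t, symbol (Λ u) ξ) := by
  unfold transLaw
  rw [charFun_flow (hΛ.shift r) (sub_nonneg.2 (le_max_left r t)),
    intervalIntegral.integral_comp_add_left (fun u => symbol (Λ u) ξ)]
  simp

lemma charFun_transLaw_of_le (hΛ : NiceCurve Λ K) {r t : ℝ} (h : r ≤ t) (ξ : E d) :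
    charFun (transLaw Λ r t : Measure (E d)) ξ =
      Complex.exp (∫ u in r..t, symbol (Λ u) ξ) := by
  rw [charFun_transLaw hΛ, max_eq_right h]

lemma transLaw_self (hΛ : NiceCurve Λ K) (r : ℝ) : transLaw Λ r r = diracProba 0 :=
  probabilityMeasure_ext_charFun fun ξ => by
    rw [charFun_transLaw_of_le hΛ le_rfl]
    simp [diracProba, charFun_dirac]

lemma convP_transLaw (hΛ : NiceCurve Λ K) {r s t : ℝ} (hrs : r ≤ s) (hst : s ≤ t) :
    convP (transLaw Λ r s) (transLaw Λ s t) = transLaw Λ r t :=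
  probabilityMeasure_ext_charFun fun ξ => by
    rw [charFun_convP, charFun_transLaw_of_le hΛ hrs, charFun_transLaw_of_le hΛ hst,
      charFun_transLaw_of_le hΛ (hrs.trans hst), ← Complex.exp_add,
      intervalIntegral.integral_add_adjacent_intervals
        ((hΛ.continuous_symbol_time ξ).intervalIntegrable _ _)
        ((hΛ.continuous_symbol_time ξ).intervalIntegrable _ _)]

lemma convP_assoc (μ ν ρ : ProbabilityMeasure (E d)) :
    convP (convP μ ν) ρ = convP μ (convP ν ρ) :=
  probabilityMeasure_ext_charFun fun ξ => by simp only [charFun_convP, mul_assoc]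

lemma convP_diracProba_zero (μ : ProbabilityMeasure (E d)) : convP μ (diracProba 0) = μ :=
  probabilityMeasure_ext_charFun fun ξ => by
    rw [charFun_convP]
    simp [diracProba, charFun_dirac]

lemma continuous_transLaw (hΛ : NiceCurve Λ K) :
    Continuous fun p : ℝ × ℝ => transLaw Λ p.1 p.2 := by
  refine continuous_of_continuous_charFun fun ξ => ?_
  simp_rw [charFun_transLaw hΛ]
  have hi := fun a b => (hΛ.continuous_symbol_time ξ).intervalIntegrable (μ := volume) a b
  have e : ∀ p : ℝ × ℝ, ∫ u in p.1..max p.1 p.2, symbol (Λ u) ξ =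
      (∫ u in (0 : ℝ)..max p.1 p.2, symbol (Λ u) ξ) - ∫ u in (0 : ℝ)..p.1, symbol (Λ u) ξ :=
    fun p => (intervalIntegral.integral_interval_sub_left (hi _ _) (hi _ _)).symm
  simp_rw [e]
  have hp : Continuous fun t : ℝ => ∫ u in (0 : ℝ)..t, symbol (Λ u) ξ :=
    intervalIntegral.continuous_primitive hi 0
  exact Complex.continuous_exp.comp
    ((hp.comp (continuous_fst.max continuous_snd)).sub (hp.comp continuous_fst))

lemma continuous_convP_left (m : ProbabilityMeasure (E d)) {X : Type*} [TopologicalSpace X]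
    [SequentialSpace X] {ρ : X → ProbabilityMeasure (E d)} (hρ : Continuous ρ) :
    Continuous fun x => convP m (ρ x) := by
  refine continuous_of_continuous_charFun fun ξ => ?_
  simp_rw [charFun_convP]
  refine continuous_const.mul (continuous_iff_seqContinuous.2 fun x x₀ hx => ?_)
  exact ProbabilityMeasure.tendsto_iff_tendsto_charFun.1 ((hρ.tendsto x₀).comp hx) ξ

lemma C2Bdd.continuous_integral_levyOp (hf : C2Bdd f M) (hΛ : NiceCurve Λ K)
    {ρ : ℝ → ProbabilityMeasure (E d)} (hρ : Continuous ρ) :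
    Continuous fun u => ∫ x, levyOp (Λ u) f x ∂(ρ u : Measure (E d)) := by
  refine continuous_iff_continuousAt.2 fun u => ?_
  have hi : ∀ v w, Integrable (levyOp (Λ v) f) (ρ w : Measure (E d)) := fun v w =>
    Integrable.of_bound (hf.continuous_levyOp _).aestronglyMeasurable _
      (ae_of_all _ fun x => hf.abs_levyOp_le (Λ v) x)
  have h1 : Tendsto (fun v => ∫ x, levyOp (Λ u) f x ∂(ρ v : Measure (E d))) (𝓝 u)
      (𝓝 (∫ x, levyOp (Λ u) f x ∂(ρ u : Measure (E d)))) :=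
    tendsto_integral_of_tendsto (hρ.tendsto u) (hf.continuous_levyOp _) (hf.abs_levyOp_le (Λ u))
  have h2 : Tendsto (fun v => opConst d * M * tripletDist (Λ v) (Λ u)) (𝓝 u) (𝓝 0) := by
    simpa using (hΛ.tendsto u).const_mul (opConst d * M)
  refine h1.congr_dist (squeeze_zero (fun _ => dist_nonneg) (fun v => ?_) h2)
  rw [dist_comm, dist_eq_norm, ← integral_sub (hi _ _) (hi _ _)]
  have := norm_integral_le_of_norm_le_const (μ := (ρ v : Measure (E d)))
    (f := fun x => levyOp (Λ v) f x - levyOp (Λ u) f x)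
    (ae_of_all _ fun x => hf.abs_levyOp_sub_le (Λ v) (Λ u) x)
  simpa using this

lemma integral_convP_transLaw (hΛ : NiceCurve Λ K) (m : ProbabilityMeasure (E d)) (hf : C2Bdd f M)
    (huc : UniformContinuous (fderiv ℝ (fderiv ℝ f))) {r t : ℝ} (hrt : r ≤ t) :
    ∫ x, f x ∂(convP m (transLaw Λ r t) : Measure (E d)) = ∫ x, f x ∂(m : Measure (E d)) +
      ∫ u in r..t, ∫ x, levyOp (Λ u) f x ∂(convP m (transLaw Λ r u) : Measure (E d)) := by
  have h := integral_convP_flow (hΛ.shift r) m hf huc (sub_nonneg.2 hrt)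
  have e : ∀ u, r ≤ u → transLaw Λ r u = flow (fun u => Λ (r + u)) (u - r) := fun u hu => by
    unfold transLaw
    rw [max_eq_right hu]
  have h2 : ∫ u in r..t, ∫ x, levyOp (Λ u) f x ∂(convP m (transLaw Λ r u) : Measure (E d)) =
      ∫ u in (0 : ℝ)..(t - r), ∫ x, levyOp (Λ (r + u)) f x
        ∂(convP m (transLaw Λ r (r + u)) : Measure (E d)) := by
    rw [intervalIntegral.integral_comp_add_left
      (fun u => ∫ x, levyOp (Λ u) f x ∂(convP m (transLaw Λ r u) : Measure (E d)))]
    simp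
  rw [e t hrt, h, h2]
  congr 1
  refine intervalIntegral.integral_congr fun u hu => ?_
  rw [uIcc_of_le (sub_nonneg.2 hrt)] at hu
  simp only [e (r + u) (by linarith [hu.1]), add_sub_cancel_left]

/-- The transition laws solve the Kolmogorov forward equation. -/
lemma hasDerivWithinAt_integral_convP_transLaw (hΛ : NiceCurve Λ K) (m : ProbabilityMeasure (E d))
    (hf : IsC2Infty f) {r t : ℝ} (hrt : r ≤ t) :
    HasDerivWithinAt (fun s => ∫ x, f x ∂(convP m (transLaw Λ r s) : Measure (E d)))
      (∫ x, levyOp (Λ t) f x ∂(convP m (transLaw Λ r t) : Measure (E d))) (Ici r) t := by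
  have hb := C2Bdd.of_isC2Infty hf
  have hρ : Continuous fun u => convP m (transLaw Λ r u) := by
    have h1 : Continuous fun u : ℝ => (r, u) := by fun_prop
    have h2 := (continuous_transLaw hΛ).comp h1
    simp only [Function.comp_def] at h2
    exact continuous_convP_left m h2
  have hcont := hb.continuous_integral_levyOp hΛ hρ
  have h := ((hcont.integral_hasStrictDerivAt r t).hasDerivAt.const_add
    (∫ x, f x ∂(m : Measure (E d)))).hasDerivWithinAt (s := Ici r)
  exact h.congr (fun s hs => integral_convP_transLaw hΛ m hb hf.uniformContinuous_fderiv_fderiv hs)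
    (integral_convP_transLaw hΛ m hb hf.uniformContinuous_fderiv_fderiv hrt)

end

/-! ### Uniqueness of weak solutions with given generators -/

section

variable {d : ℕ} {f g : E d → ℝ} {M N : ℝ} {Λ Λ' : ℝ → LevyTriplet d} {K : ℝ}

lemma tendsto_iff_tendsto_c2DualDist {ι : Type*} {l : Filter ι} [l.IsCountablyGenerated]
    {ρ : ι → ProbabilityMeasure (E d)} {μ : ProbabilityMeasure (E d)} :
    Tendsto ρ l (𝓝 μ) ↔ Tendsto (fun i => c2DualDist (ρ i) μ) l (𝓝 0) := by
  refine ⟨fun h => (tendsto_c2DualDist_nhds μ).comp h, fun h => ?_⟩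
  exact tendsto_of_seq_tendsto fun x hx => tendsto_of_tendsto_c2DualDist (h.comp hx)

/-- `ρ` is a weak solution of the forward equation on `[r, ∞)`. -/
def SolvesForward (Λ : ℝ → LevyTriplet d) (r : ℝ) (ρ : ℝ → ProbabilityMeasure (E d)) : Prop :=
  ∀ f : E d → ℝ, IsC2Infty f → ∀ t, r ≤ t →
    HasDerivWithinAt (fun s => ∫ x, f x ∂(ρ s : Measure (E d)))
      (∫ x, levyOp (Λ t) f x ∂(ρ t : Measure (E d))) (Ici r) t

lemma C2Bdd.abs_integral_levyOp_le (hf : C2Bdd f M) {L : LevyTriplet d} (hL : L.size ≤ K)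
    (ρ : Measure (E d)) [IsProbabilityMeasure ρ] : |∫ x, levyOp L f x ∂ρ| ≤ opConst d * M * K := by
  have h : opConst d * M * L.size ≤ opConst d * M * K :=
    mul_le_mul_of_nonneg_left hL (mul_nonneg (opConst_pos d).le hf.nonneg)
  have := norm_integral_le_of_norm_le_const (μ := ρ) (f := levyOp L f)
    (ae_of_all _ fun x => (hf.abs_levyOp_le L x).trans h)
  simpa using this

/-- Weak solutions are Lipschitz continuous in time for the dual distance, because the generators
are bounded on the unit ball of `C²_∞`. -/
lemma SolvesForward.c2DualDist_le {r : ℝ} {ρ : ℝ → ProbabilityMeasure (E d)}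
    (h : SolvesForward Λ r ρ) (hK : ∀ t, (Λ t).size ≤ K) {s t : ℝ} (hs : r ≤ s) (ht : r ≤ t) :
    c2DualDist (ρ s) (ρ t) ≤ opConst d * K * |s - t| := by
  refine NonlinearLevy.c2DualDist_le fun f hf hb => ?_
  have := (convex_Ici r).norm_image_sub_le_of_norm_hasDerivWithin_le
    (f := fun s => ∫ x, f x ∂(ρ s : Measure (E d))) (C := opConst d * K)
    (fun u hu => h f hf u hu)
    (fun u hu => by
      have := hb.abs_integral_levyOp_le (hK u) (ρ u : Measure (E d))
      rwa [mul_one] at this) (mem_Ici.2 ht) (mem_Ici.2 hs)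
  exact this

/-- The curve is frozen before time `r`, where a weak solution carries no information. -/
lemma SolvesForward.continuous_comp_max {r : ℝ} {ρ : ℝ → ProbabilityMeasure (E d)}
    (h : SolvesForward Λ r ρ) (hK : ∀ t, (Λ t).size ≤ K) : Continuous fun t => ρ (max r t) := by
  refine continuous_iff_continuousAt.2 fun t => ?_
  refine tendsto_iff_tendsto_c2DualDist.2 (squeeze_zero (fun _ => c2DualDist_nonneg _ _)
    (fun s => h.c2DualDist_le hK (le_max_left r s) (le_max_left r t)) ?_)
  have : Continuous fun s : ℝ => opConst d * K * |max r s - max r t| := by fun_prop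
  simpa using this.tendsto t

lemma SolvesForward.integral_sub_eq_of_isC2Infty {r : ℝ} {ρ : ℝ → ProbabilityMeasure (E d)}
    (h : SolvesForward Λ r ρ) (hΛ : NiceCurve Λ K) (hf : IsC2Infty f) {t : ℝ} (ht : r ≤ t) :
    ∫ x, f x ∂(ρ t : Measure (E d)) - ∫ x, f x ∂(ρ r : Measure (E d)) =
      ∫ u in r..t, ∫ x, levyOp (Λ u) f x ∂(ρ (max r u) : Measure (E d)) := by
  have hc := (C2Bdd.of_isC2Infty hf).continuous_integral_levyOp hΛ
    (h.continuous_comp_max hΛ.size_le)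
  refine (intervalIntegral.integral_eq_sub_of_hasDeriv_right_of_le
    (f := fun s => ∫ x, f x ∂(ρ s : Measure (E d))) ht (fun s hs => ?_) (fun s hs => ?_)
    (hc.intervalIntegrable _ _)).symm
  · exact (h f hf s hs.1).continuousWithinAt.mono fun _ h => h.1
  · rw [max_eq_right hs.1.le]
    exact (h f hf s hs.1.le).mono fun u hu => hs.1.le.trans (le_of_lt hu)

/-- By cutoffs, the integrated forward equation extends from `C²_∞` to functions with bounded
derivatives, in particular to plane waves. -/
lemma SolvesForward.integral_sub_eq {r : ℝ} {ρ : ℝ → ProbabilityMeasure (E d)}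
    (h : SolvesForward Λ r ρ) (hΛ : NiceCurve Λ K) (hf : C2Bdd f M) {t : ℝ} (ht : r ≤ t) :
    ∫ x, f x ∂(ρ t : Measure (E d)) - ∫ x, f x ∂(ρ r : Measure (E d)) =
      ∫ u in r..t, ∫ x, levyOp (Λ u) f x ∂(ρ (max r u) : Measure (E d)) := by
  obtain ⟨C, -, hC⟩ := exists_approx d
  obtain ⟨F, hF1, hF2, hF3⟩ := hC f M hf
  have h1 : ∀ s, Tendsto (fun n => ∫ x, F n x ∂(ρ s : Measure (E d))) atTop
      (𝓝 (∫ x, f x ∂(ρ s : Measure (E d)))) := fun s =>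
    tendsto_integral_of_dominated_convergence (fun _ => C * M)
      (fun n => (hF2 n).continuous.aestronglyMeasurable) (integrable_const _)
      (fun n => ae_of_all _ fun x => (hF2 n).abs_le x) (ae_of_all _ fun x =>
        tendsto_const_nhds.congr' ((hF3 x).mono fun n hn => hn.self_of_nhds.symm))
  have h2 : ∀ u x, Tendsto (fun n => levyOp (Λ u) (F n) x) atTop (𝓝 (levyOp (Λ u) f x)) := by
    intro u x
    refine tendsto_levyOp (M := C * M) (Λ u) (Eventually.of_forall hF2) (fun y => ?_) (fun v => ?_)
      (fun m => ?_)
    · exact tendsto_const_nhds.congr' ((hF3 _).mono fun n hn => hn.self_of_nhds.symm)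
    · exact tendsto_const_nhds.congr' ((hF3 x).mono fun n hn => by
        simp only [hn.fderiv_eq])
    · refine tendsto_const_nhds.congr' ((hF3 x).mono fun n hn => ?_)
      have e := (hn.iteratedFDeriv ℝ 2).self_of_nhds
      simp only [e]
  have h3 : ∀ u, Tendsto (fun n => ∫ x, levyOp (Λ u) (F n) x ∂(ρ (max r u) : Measure (E d))) atTop
      (𝓝 (∫ x, levyOp (Λ u) f x ∂(ρ (max r u) : Measure (E d)))) := fun u =>
    tendsto_integral_of_dominated_convergence (fun _ => opConst d * (C * M) * (Λ u).size)
      (fun n => ((hF2 n).continuous_levyOp _).aestronglyMeasurable) (integrable_const _)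
      (fun n => ae_of_all _ fun x => (hF2 n).abs_levyOp_le _ x) (ae_of_all _ fun x => h2 u x)
  have h4 : Tendsto (fun n => ∫ u in r..t,
      ∫ x, levyOp (Λ u) (F n) x ∂(ρ (max r u) : Measure (E d))) atTop
      (𝓝 (∫ u in r..t, ∫ x, levyOp (Λ u) f x ∂(ρ (max r u) : Measure (E d)))) := by
    refine intervalIntegral.tendsto_integral_filter_of_dominated_convergence
      (fun _ => opConst d * (C * M) * K) (Eventually.of_forall fun n => ?_)
      (Eventually.of_forall fun n => ae_of_all _ fun u _ => ?_) intervalIntegrable_const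
      (ae_of_all _ fun u _ => h3 u)
    · exact ((hF2 n).continuous_integral_levyOp hΛ
        (h.continuous_comp_max hΛ.size_le)).aestronglyMeasurable
    · exact (hF2 n).abs_integral_levyOp_le (hΛ.size_le u) _
  refine tendsto_nhds_unique ((h1 t).sub (h1 r)) (h4.congr fun n => ?_)
  exact (h.integral_sub_eq_of_isC2Infty hΛ (hF1 n) ht).symm

/-- Plane waves are eigenfunctions of the generators, so the characteristic function of a weak
solution solves a linear equation for each frequency separately. -/
lemma SolvesForward.charFun_eq {r : ℝ} {ρ : ℝ → ProbabilityMeasure (E d)}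
    (h : SolvesForward Λ r ρ) (hΛ : NiceCurve Λ K) {t : ℝ} (ht : r ≤ t) (ξ : E d) :
    charFun (ρ t : Measure (E d)) ξ = charFun (ρ r : Measure (E d)) ξ +
      ∫ u in r..t, symbol (Λ u) ξ * charFun (ρ (max r u) : Measure (E d)) ξ := by
  have hc := fun θ => (c2Bdd_wave ξ θ).continuous_integral_levyOp hΛ
    (h.continuous_comp_max hΛ.size_le)
  have h0 := h.integral_sub_eq hΛ (c2Bdd_wave ξ 0) ht
  have h1 := h.integral_sub_eq hΛ (c2Bdd_wave ξ (-(Real.pi / 2))) ht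
  simp_rw [← integral_levyOp_wave]
  rw [intervalIntegral.integral_add, intervalIntegral.integral_mul_const,
    intervalIntegral.integral_ofReal, intervalIntegral.integral_ofReal, ← h0, ← h1,
    charFun_eq_wave (ρ t : Measure (E d)), charFun_eq_wave (ρ r : Measure (E d))]
  · push_cast
    ring
  · exact (Complex.continuous_ofReal.comp (hc 0)).intervalIntegrable _ _
  · exact ((Complex.continuous_ofReal.comp (hc _)).mul continuous_const).intervalIntegrable _ _

/-- Weak solutions of the forward equation are unique: they are given by the transition laws. -/
lemma SolvesForward.eq_convP {r : ℝ} {ρ : ℝ → ProbabilityMeasure (E d)}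
    (h : SolvesForward Λ r ρ) (hΛ : NiceCurve Λ K) {t : ℝ} (ht : r ≤ t) :
    ρ t = convP (ρ r) (transLaw Λ r t) := by
  refine probabilityMeasure_ext_charFun fun ξ => ?_
  rw [charFun_convP, charFun_transLaw_of_le hΛ ht]
  have hψ := hΛ.continuous_symbol_time ξ
  have hφ : Continuous fun u => charFun (ρ (max r u) : Measure (E d)) ξ :=
    continuous_iff_continuousAt.2 fun u => by
      refine tendsto_of_seq_tendsto fun x hx => ?_
      exact ProbabilityMeasure.tendsto_iff_tendsto_charFun.1
        (((h.continuous_comp_max hΛ.size_le).tendsto u).comp hx) ξ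
  -- the quotient by the candidate solution has derivative zero
  set F : ℝ → ℂ := fun s => charFun (ρ r : Measure (E d)) ξ +
    ∫ u in r..s, symbol (Λ u) ξ * charFun (ρ (max r u) : Measure (E d)) ξ
  have hF : ∀ s, HasDerivAt F (symbol (Λ s) ξ * charFun (ρ (max r s) : Measure (E d)) ξ) s :=
    fun s => ((hψ.mul hφ).integral_hasStrictDerivAt r s).hasDerivAt.const_add _
  have hFeq : ∀ s, r ≤ s → F s = charFun (ρ s : Measure (E d)) ξ := fun s hs =>
    (h.charFun_eq hΛ hs ξ).symm
  set G : ℝ → ℂ := fun s => Complex.exp (-∫ u in r..s, symbol (Λ u) ξ)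
  have hG : ∀ s, HasDerivAt G (G s * -symbol (Λ s) ξ) s := fun s =>
    ((hψ.integral_hasStrictDerivAt r s).hasDerivAt.neg).cexp
  have hFG : ∀ s ∈ Icc r t, (F * G) s = (F * G) r := by
    refine constant_of_has_deriv_right_zero (fun s _ =>
      ((hF s).mul (hG s)).continuousAt.continuousWithinAt) (fun s hs => ?_)
    have := ((hF s).mul (hG s)).hasDerivWithinAt (s := Ici s)
    convert this using 1
    rw [max_eq_right hs.1, hFeq s hs.1]
    ring
  have h1 := hFG t (right_mem_Icc.2 ht)
  simp only [Pi.mul_apply] at h1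
  rw [hFeq t ht, hFeq r le_rfl] at h1
  have hGr : G r = 1 := by simp [G]
  have hGt : G t * Complex.exp (∫ u in r..t, symbol (Λ u) ξ) = 1 := by
    simp only [G]
    rw [← Complex.exp_add]
    simp
  rw [hGr, mul_one] at h1
  rw [← h1, mul_assoc, hGt, mul_one]

/-- Stability of the transition laws in the dual norm. -/
lemma c2DualDist_convP_transLaw_le (hΛ : NiceCurve Λ K) (hΛ' : NiceCurve Λ' K) {δ : ℝ → ℝ}
    (hδ : Continuous δ) {B : ℝ} (hδB : ∀ u, |δ u| ≤ B)
    (hle : ∀ u, 0 ≤ u → tripletDist (Λ u) (Λ' u) ≤ δ u) (m : ProbabilityMeasure (E d)) (t : ℝ) :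
    c2DualDist (convP m (transLaw Λ 0 t)) (convP m (transLaw Λ' 0 t)) ≤
      ∫ u in (0 : ℝ)..max 0 t, opConst d * δ u := by
  refine c2DualDist_le fun f hf hb => ?_
  have := hb.abs_integral_convP_flow_sub_le hf.uniformContinuous_fderiv_fderiv hΛ hΛ' hδ hδB hle m
    (le_max_left 0 t)
  unfold transLaw
  simpa only [zero_add, sub_zero, mul_one] using this

end

/-! ### The nonlinear equation -/

section

variable {d : ℕ} {L : ProbabilityMeasure (E d) → LevyTriplet d} {κ : ℝ}

/-- Lipschitz dependence of the coefficients on the measure. -/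
def IsLipschitzFamily (L : ProbabilityMeasure (E d) → LevyTriplet d) (κ : ℝ) : Prop :=
  ∀ μ η, tripletDist (L μ) (L η) ≤ κ * c2DualDist μ η

/-- A bound for the size of all coefficients of a Lipschitz family. -/
noncomputable def sizeBound (L : ProbabilityMeasure (E d) → LevyTriplet d) (κ : ℝ) : ℝ :=
  (L (diracProba 0)).size + |κ| * 2

/-- The Lipschitz constant of the nonlinear generator on functions with `C²` norm one. -/
noncomputable def lipConst (d : ℕ) (κ : ℝ) : ℝ := opConst d * (|κ| + 1)

lemma lipConst_pos (d : ℕ) (κ : ℝ) : 0 < lipConst d κ :=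
  mul_pos (opConst_pos d) (by positivity)

namespace IsLipschitzFamily

lemma tripletDist_le (hL : IsLipschitzFamily L κ) (μ η : ProbabilityMeasure (E d)) :
    tripletDist (L μ) (L η) ≤ (|κ| + 1) * c2DualDist μ η := by
  have h0 := c2DualDist_nonneg μ η
  refine (hL μ η).trans (mul_le_mul_of_nonneg_right ?_ h0)
  linarith [le_abs_self κ]

lemma size_le (hL : IsLipschitzFamily L κ) (μ : ProbabilityMeasure (E d)) :
    (L μ).size ≤ sizeBound L κ := by
  refine ((L μ).size_le (L (diracProba 0))).trans ?_
  unfold sizeBound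
  have h1 : κ * c2DualDist μ (diracProba 0) ≤ |κ| * c2DualDist μ (diracProba 0) :=
    mul_le_mul_of_nonneg_right (le_abs_self κ) (c2DualDist_nonneg _ _)
  have h2 : |κ| * c2DualDist μ (diracProba 0) ≤ |κ| * 2 :=
    mul_le_mul_of_nonneg_left (c2DualDist_le_two _ _) (abs_nonneg κ)
  linarith [hL μ (diracProba 0)]

lemma niceCurve (hL : IsLipschitzFamily L κ) {ρ : ℝ → ProbabilityMeasure (E d)}
    (hρ : Continuous ρ) : NiceCurve (fun u => L (ρ u)) (sizeBound L κ) := by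
  refine ⟨fun u => hL.size_le _, fun u => squeeze_zero (fun _ => tripletDist_nonneg _ _)
    (fun v => hL (ρ v) (ρ u)) ?_⟩
  simpa using (tendsto_iff_tendsto_c2DualDist.1 (hρ.tendsto u)).const_mul κ

end IsLipschitzFamily

lemma continuous_c2DualDist {ρ ρ' : ℝ → ProbabilityMeasure (E d)} (hρ : Continuous ρ)
    (hρ' : Continuous ρ') : Continuous fun u => c2DualDist (ρ u) (ρ' u) := by
  refine continuous_iff_continuousAt.2 fun u => ?_
  rw [ContinuousAt, tendsto_iff_dist_tendsto_zero]
  refine squeeze_zero (fun _ => dist_nonneg) (fun v => abs_c2DualDist_sub_le _ _ _ _) ?_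
  simpa using (tendsto_iff_tendsto_c2DualDist.1 (hρ.tendsto u)).add
    (tendsto_iff_tendsto_c2DualDist.1 (hρ'.tendsto u))

/-- `ρ` is a continuous curve that is a fixed point, on `[0, ∞)`, of the map sending a curve `ρ` to
the curve of laws of the additive process with generators `levyOp (L (ρ t))` and initial
law `μ`. -/
structure IsMild (L : ProbabilityMeasure (E d) → LevyTriplet d) (μ : ProbabilityMeasure (E d))
    (ρ : ℝ → ProbabilityMeasure (E d)) : Prop where
  continuous : Continuous ρ
  eq : ∀ t, 0 ≤ t → ρ t = convP μ (transLaw (fun u => L (ρ u)) 0 t)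

lemma IsLipschitzFamily.c2DualDist_transLaw_le (hL : IsLipschitzFamily L κ)
    {ρ ρ' : ℝ → ProbabilityMeasure (E d)} (hρ : Continuous ρ) (hρ' : Continuous ρ')
    (μ : ProbabilityMeasure (E d)) (t : ℝ) :
    c2DualDist (convP μ (transLaw (fun u => L (ρ u)) 0 t))
      (convP μ (transLaw (fun u => L (ρ' u)) 0 t)) ≤
      ∫ u in (0 : ℝ)..max 0 t, lipConst d κ * c2DualDist (ρ u) (ρ' u) := by
  have h := c2DualDist_convP_transLaw_le (hL.niceCurve hρ) (hL.niceCurve hρ')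
    (δ := fun u => (|κ| + 1) * c2DualDist (ρ u) (ρ' u)) (B := (|κ| + 1) * 2)
    (continuous_const.mul (continuous_c2DualDist hρ hρ')) (fun u => ?_)
    (fun u _ => hL.tripletDist_le _ _) μ t
  · simpa only [lipConst, mul_assoc] using h
  · have h0 := c2DualDist_nonneg (ρ u) (ρ' u)
    rw [abs_of_nonneg (by positivity)]
    exact mul_le_mul_of_nonneg_left (c2DualDist_le_two _ _) (by positivity)

/-- Continuous dependence on the initial law, by Gronwall's inequality. -/
lemma IsMild.c2DualDist_le (hL : IsLipschitzFamily L κ) {μ η : ProbabilityMeasure (E d)}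
    {ρ ρ' : ℝ → ProbabilityMeasure (E d)} (h : IsMild L μ ρ) (h' : IsMild L η ρ') {t : ℝ}
    (ht : 0 ≤ t) : c2DualDist (ρ t) (ρ' t) ≤ c2DualDist μ η * Real.exp (lipConst d κ * t) := by
  have hC := (lipConst_pos d κ).le
  have hc := continuous_c2DualDist h.continuous h'.continuous
  set w : ℝ → ℝ := fun t => c2DualDist μ η +
    ∫ u in (0 : ℝ)..t, lipConst d κ * c2DualDist (ρ u) (ρ' u)
  have hw : ∀ s, 0 ≤ s → c2DualDist (ρ s) (ρ' s) ≤ w s := by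
    intro s hs
    rw [h.eq s hs, h'.eq s hs]
    refine (c2DualDist_triangle _ (convP η (transLaw (fun u => L (ρ u)) 0 s)) _).trans
      (add_le_add (c2DualDist_convP_le _ _ _) ?_)
    have := hL.c2DualDist_transLaw_le h.continuous h'.continuous η s
    rwa [max_eq_right hs] at this
  have hderiv : ∀ s, HasDerivAt w (lipConst d κ * c2DualDist (ρ s) (ρ' s)) s := fun s =>
    ((hc.const_mul _).integral_hasStrictDerivAt 0 s).hasDerivAt.const_add _
  have hw0 : ∀ s, 0 ≤ s → 0 ≤ w s := fun s hs => (c2DualDist_nonneg _ _).trans (hw s hs)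
  have := norm_le_gronwallBound_of_norm_deriv_right_le (f := w) (δ := c2DualDist μ η)
    (K := lipConst d κ) (ε := 0) (a := 0) (b := t)
    (fun s _ => (hderiv s).continuousAt.continuousWithinAt)
    (fun s _ => (hderiv s).hasDerivWithinAt) (by
      rw [Real.norm_eq_abs, abs_of_nonneg (hw0 0 le_rfl)]
      simp [w])
    (fun s hs => by
      rw [Real.norm_eq_abs, Real.norm_eq_abs, abs_of_nonneg (hw0 s hs.1),
        abs_of_nonneg (mul_nonneg hC (c2DualDist_nonneg _ _)), add_zero]
      exact mul_le_mul_of_nonneg_left (hw s hs.1) hC) t (right_mem_Icc.2 ht)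
  rw [gronwallBound_ε0, sub_zero, Real.norm_eq_abs, abs_of_nonneg (hw0 t ht)] at this
  exact (hw t ht).trans this

/-- The Picard iterates. -/
noncomputable def picard (L : ProbabilityMeasure (E d) → LevyTriplet d)
    (μ : ProbabilityMeasure (E d)) : ℕ → ℝ → ProbabilityMeasure (E d)
  | 0 => fun _ => μ
  | n + 1 => fun t => convP μ (transLaw (fun u => L (picard L μ n u)) 0 t)

lemma continuous_convP_transLaw {Λ : ℝ → LevyTriplet d} {K : ℝ} (hΛ : NiceCurve Λ K)
    (μ : ProbabilityMeasure (E d)) (r : ℝ) : Continuous fun t => convP μ (transLaw Λ r t) := by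
  have h1 : Continuous fun u : ℝ => (r, u) := by fun_prop
  have h2 := (continuous_transLaw hΛ).comp h1
  simp only [Function.comp_def] at h2
  exact continuous_convP_left μ h2

lemma continuous_picard (hL : IsLipschitzFamily L κ) (μ : ProbabilityMeasure (E d)) (n : ℕ) :
    Continuous (picard L μ n) := by
  induction n with
  | zero => exact continuous_const
  | succ n ih => exact continuous_convP_transLaw (hL.niceCurve ih) μ 0

lemma integral_exp_le {C T : ℝ} (hT : 0 ≤ T) {a : ℝ} (ha : 0 ≤ a) :
    ∫ u in (0 : ℝ)..T, C * (a * Real.exp (2 * C * max 0 u)) ≤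
      a / 2 * Real.exp (2 * C * T) := by
  have h1 : ∫ u in (0 : ℝ)..T, C * (a * Real.exp (2 * C * max 0 u)) =
      ∫ u in (0 : ℝ)..T, C * (a * Real.exp (2 * C * u)) := by
    refine intervalIntegral.integral_congr fun u hu => ?_
    rw [uIcc_of_le hT] at hu
    rw [max_eq_right hu.1]
  have h2 : ∀ u, HasDerivAt (fun u => a / 2 * Real.exp (2 * C * u))
      (C * (a * Real.exp (2 * C * u))) u := fun u => by
    have h3 : HasDerivAt (fun u => 2 * C * u) (2 * C) u := by
      simpa using (hasDerivAt_id u).const_mul (2 * C)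
    exact (h3.exp.const_mul (a / 2)).congr_deriv (by ring)
  rw [h1, intervalIntegral.integral_eq_sub_of_hasDerivAt (fun u _ => h2 u)
    ((by fun_prop : Continuous fun u => C * (a * Real.exp (2 * C * u))).intervalIntegrable _ _)]
  have : 0 ≤ a / 2 * Real.exp (2 * C * 0) := by positivity
  linarith

/-- The Picard map is a contraction for the weight `exp (2 C t)`. -/
lemma IsLipschitzFamily.c2DualDist_transLaw_le_of_le (hL : IsLipschitzFamily L κ)
    {ρ ρ' : ℝ → ProbabilityMeasure (E d)} (hρ : Continuous ρ) (hρ' : Continuous ρ')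
    (μ : ProbabilityMeasure (E d)) {a : ℝ} (ha : 0 ≤ a)
    (h : ∀ u, c2DualDist (ρ u) (ρ' u) ≤ a * Real.exp (2 * lipConst d κ * max 0 u)) (t : ℝ) :
    c2DualDist (convP μ (transLaw (fun u => L (ρ u)) 0 t))
      (convP μ (transLaw (fun u => L (ρ' u)) 0 t)) ≤
      a / 2 * Real.exp (2 * lipConst d κ * max 0 t) := by
  have hC := lipConst_pos d κ
  refine (hL.c2DualDist_transLaw_le hρ hρ' μ t).trans
    (le_trans ?_ (integral_exp_le (le_max_left 0 t) ha))
  refine intervalIntegral.integral_mono_on (le_max_left 0 t) ?_ ?_ fun u _ =>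
    mul_le_mul_of_nonneg_left (h u) hC.le
  · exact ((continuous_c2DualDist hρ hρ').const_mul _).intervalIntegrable _ _
  · exact (by fun_prop : Continuous fun u =>
      lipConst d κ * (a * Real.exp (2 * lipConst d κ * max 0 u))).intervalIntegrable _ _

lemma c2DualDist_picard_succ_le (hL : IsLipschitzFamily L κ) (μ : ProbabilityMeasure (E d)) (n : ℕ)
    (t : ℝ) : c2DualDist (picard L μ n t) (picard L μ (n + 1) t) ≤
      2 * (1 / 2) ^ n * Real.exp (2 * lipConst d κ * max 0 t) := by
  have hC := (lipConst_pos d κ).le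
  induction n generalizing t with
  | zero =>
    refine (c2DualDist_le_two _ _).trans ?_
    have : 1 ≤ Real.exp (2 * lipConst d κ * max 0 t) :=
      Real.one_le_exp (mul_nonneg (by positivity) (le_max_left 0 t))
    simpa using this
  | succ n ih =>
    refine (hL.c2DualDist_transLaw_le_of_le (continuous_picard hL μ n)
      (continuous_picard hL μ (n + 1)) μ (by positivity) ih t).trans_eq ?_
    rw [pow_succ]
    ring

lemma c2DualDist_picard_le (hL : IsLipschitzFamily L κ) (μ : ProbabilityMeasure (E d)) (n k : ℕ)
    (t : ℝ) : c2DualDist (picard L μ n t) (picard L μ (n + k) t) ≤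
      4 * ((1 / 2) ^ n - (1 / 2) ^ (n + k)) * Real.exp (2 * lipConst d κ * max 0 t) := by
  induction k with
  | zero => simp [c2DualDist_self]
  | succ k ih =>
    refine (c2DualDist_triangle _ (picard L μ (n + k) t) _).trans
      ((add_le_add ih (c2DualDist_picard_succ_le hL μ (n + k) t)).trans_eq ?_)
    rw [← add_assoc, pow_succ _ (n + k)]
    ring

lemma c2DualDist_picard_le' (hL : IsLipschitzFamily L κ) (μ : ProbabilityMeasure (E d)) {n m : ℕ}
    (hnm : n ≤ m) (t : ℝ) : c2DualDist (picard L μ n t) (picard L μ m t) ≤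
      4 * (1 / 2) ^ n * Real.exp (2 * lipConst d κ * max 0 t) := by
  obtain ⟨k, rfl⟩ := Nat.exists_eq_add_of_le hnm
  refine (c2DualDist_picard_le hL μ n k t).trans ?_
  refine mul_le_mul_of_nonneg_right ?_ (Real.exp_pos _).le
  have : (0 : ℝ) ≤ (1 / 2) ^ (n + k) := by positivity
  linarith

lemma tendsto_const_mul_half_pow_mul (a b : ℝ) :
    Tendsto (fun n : ℕ => a * (1 / 2) ^ n * b) atTop (𝓝 0) := by
  simpa using ((tendsto_pow_atTop_nhds_zero_of_lt_one (r := (1 / 2 : ℝ)) (by norm_num)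
    (by norm_num)).const_mul a).mul_const b

/-- Existence of solutions, by Picard iteration. -/
lemma exists_isMild (hL : IsLipschitzFamily L κ) (μ : ProbabilityMeasure (E d)) :
    ∃ ρ, IsMild L μ ρ := by
  have hex : ∀ t, ∃ ρ, Tendsto (fun n => c2DualDist (picard L μ n t) ρ) atTop (𝓝 0) := by
    intro t
    refine exists_tendsto_of_cauchy fun ε hε => ?_
    obtain ⟨N, hN⟩ := ((tendsto_const_mul_half_pow_mul 4
      (Real.exp (2 * lipConst d κ * max 0 t))).eventually (gt_mem_nhds hε)).exists_forall_of_atTop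
    refine ⟨N, fun m hm n hn => ?_⟩
    rcases le_total m n with h | h
    · exact (c2DualDist_picard_le' hL μ h t).trans (hN m hm).le
    · rw [c2DualDist_comm]
      exact (c2DualDist_picard_le' hL μ h t).trans (hN n hn).le
  choose ρ hρ using hex
  have hdist : ∀ n t, c2DualDist (picard L μ n t) (ρ t) ≤
      4 * (1 / 2) ^ n * Real.exp (2 * lipConst d κ * max 0 t) := by
    intro n t
    have h1 : Tendsto (fun m => 4 * (1 / 2) ^ n * Real.exp (2 * lipConst d κ * max 0 t) +
        c2DualDist (picard L μ m t) (ρ t)) atTop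
        (𝓝 (4 * (1 / 2) ^ n * Real.exp (2 * lipConst d κ * max 0 t) + 0)) := (hρ t).const_add _
    rw [add_zero] at h1
    refine ge_of_tendsto h1 ?_
    filter_upwards [eventually_ge_atTop n] with m hm
    exact (c2DualDist_triangle _ (picard L μ m t) _).trans
      (add_le_add_left (c2DualDist_picard_le' hL μ hm t) _)
  -- the iterates converge locally uniformly in time
  have hcont : Continuous ρ := by
    refine continuous_iff_continuousAt.2 fun t => tendsto_iff_tendsto_c2DualDist.2 ?_
    refine tendsto_order.2 ⟨fun a ha => Eventually.of_forall fun s =>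
      ha.trans_le (c2DualDist_nonneg _ _), fun ε hε => ?_⟩
    have hlim := tendsto_const_mul_half_pow_mul 4 (Real.exp (2 * lipConst d κ * (|t| + 1)))
    obtain ⟨n, hn⟩ := (hlim.eventually (gt_mem_nhds (by positivity : 0 < ε / 3))).exists
    have hp := (tendsto_iff_tendsto_c2DualDist.1 ((continuous_picard hL μ n).tendsto t)).eventually
      (gt_mem_nhds (by positivity : 0 < ε / 3))
    have hball : ∀ᶠ s in 𝓝 t, |s| < |t| + 1 :=
      (continuous_abs.tendsto t).eventually (gt_mem_nhds (by linarith))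
    filter_upwards [hp, hball] with s hs hst
    have hle : ∀ s, |s| ≤ |t| + 1 → c2DualDist (picard L μ n s) (ρ s) < ε / 3 := fun s hs => by
      refine ((hdist n s).trans ?_).trans_lt hn
      have hC := (lipConst_pos d κ).le
      have hm : max 0 s ≤ |t| + 1 := max_le (by positivity) ((le_abs_self s).trans hs)
      gcongr
    have h1 := c2DualDist_triangle (ρ s) (picard L μ n s) (ρ t)
    have h2 := c2DualDist_triangle (picard L μ n s) (picard L μ n t) (ρ t)
    rw [c2DualDist_comm (ρ s) (picard L μ n s)] at h1
    have h3 := hle s hst.le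
    have h4 := hle t (by linarith)
    linarith
  refine ⟨ρ, hcont, fun t _ => ?_⟩
  -- the Picard map is continuous, so that the limit is a fixed point
  have hfix : ∀ n, c2DualDist (ρ t) (convP μ (transLaw (fun u => L (ρ u)) 0 t)) ≤
      6 * (1 / 2) ^ n * Real.exp (2 * lipConst d κ * max 0 t) := by
    intro n
    have h1 := hL.c2DualDist_transLaw_le_of_le (continuous_picard hL μ n) hcont μ
      (by positivity) (hdist n) t
    have h2 := c2DualDist_triangle (ρ t) (picard L μ (n + 1) t)
      (convP μ (transLaw (fun u => L (ρ u)) 0 t))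
    have h3 := hdist (n + 1) t
    rw [c2DualDist_comm] at h3
    have h4 : c2DualDist (picard L μ (n + 1) t) (convP μ (transLaw (fun u => L (ρ u)) 0 t)) ≤
        4 * (1 / 2) ^ n / 2 * Real.exp (2 * lipConst d κ * max 0 t) := h1
    rw [pow_succ] at h3
    have h5 : 0 ≤ (1 / 2 : ℝ) ^ n * Real.exp (2 * lipConst d κ * max 0 t) := by positivity
    linarith
  exact eq_of_c2DualDist_eq_zero (le_antisymm (ge_of_tendsto'
    (tendsto_const_mul_half_pow_mul 6 _) hfix) (c2DualDist_nonneg _ _))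

/-! ### The nonlinear semigroup -/

lemma IsMild.zero (hL : IsLipschitzFamily L κ) {μ : ProbabilityMeasure (E d)}
    {ρ : ℝ → ProbabilityMeasure (E d)} (h : IsMild L μ ρ) : ρ 0 = μ := by
  rw [h.eq 0 le_rfl, transLaw_self (hL.niceCurve h.continuous), convP_diracProba_zero]

lemma IsMild.unique (hL : IsLipschitzFamily L κ) {μ : ProbabilityMeasure (E d)}
    {ρ ρ' : ℝ → ProbabilityMeasure (E d)} (h : IsMild L μ ρ) (h' : IsMild L μ ρ') {t : ℝ}
    (ht : 0 ≤ t) : ρ t = ρ' t := by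
  refine eq_of_c2DualDist_eq_zero (le_antisymm ?_ (c2DualDist_nonneg _ _))
  have := h.c2DualDist_le hL h' ht
  rwa [c2DualDist_self, zero_mul] at this

lemma transLaw_shift (Λ : ℝ → LevyTriplet d) (s r t : ℝ) :
    transLaw (fun u => Λ (s + u)) r t = transLaw Λ (s + r) (s + t) := by
  unfold transLaw
  rw [← add_max, add_sub_add_left_eq_sub]
  simp only [add_assoc]

/-- A mild solution restarted at time `s` is a mild solution; with uniqueness this is the semigroup
property. -/
lemma IsMild.shift (hL : IsLipschitzFamily L κ) {μ : ProbabilityMeasure (E d)}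
    {ρ : ℝ → ProbabilityMeasure (E d)} (h : IsMild L μ ρ) {s : ℝ} (hs : 0 ≤ s) :
    IsMild L (ρ s) fun t => ρ (s + t) := by
  refine ⟨h.continuous.comp (continuous_const.add continuous_id), fun t ht => ?_⟩
  rw [transLaw_shift (fun u => L (ρ u)), add_zero, h.eq (s + t) (by linarith),
    ← convP_transLaw (hL.niceCurve h.continuous) hs (by linarith : s ≤ s + t), ← convP_assoc,
    ← h.eq s hs]

/-- With the solution inserted into the coefficients, a mild solution solves a linear forward
equation. -/
lemma IsMild.solvesNonlinear (hL : IsLipschitzFamily L κ) {μ : ProbabilityMeasure (E d)}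
    {ρ : ℝ → ProbabilityMeasure (E d)} (h : IsMild L μ ρ) :
    SolvesNonlinear L μ fun t : ℝ≥0 => ρ t := by
  refine ⟨h.zero hL, fun f hf t _ => ?_⟩
  have h1 := hasDerivWithinAt_integral_convP_transLaw (hL.niceCurve h.continuous) μ hf t.2
  have e : ∀ s : ℝ, 0 ≤ s → convP μ (transLaw (fun u => L (ρ u)) 0 s) = ρ s := fun s hs =>
    (h.eq s hs).symm
  simp only [NNReal.val_eq_coe] at h1
  rw [e t t.2] at h1
  simp only [NNReal.coe_zero]
  refine h1.congr (fun s hs => ?_) ?_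
  · rw [Real.coe_toNNReal s hs, e s hs]
  · rw [Real.toNNReal_coe, e t t.2]

lemma solvesForward_of_solvesWeakly {Λ : ℝ≥0 → LevyTriplet d} {r : ℝ≥0}
    {m : ℝ≥0 → ProbabilityMeasure (E d)}
    (h : SolvesWeakly (fun t => levyOp (Λ t)) r fun t => (m t : Measure (E d))) :
    SolvesForward (fun u => Λ u.toNNReal) r fun u => m u.toNNReal := by
  intro f hf t ht
  have ht0 : 0 ≤ t := r.2.trans ht
  have := h f hf t.toNNReal (NNReal.le_toNNReal_of_coe_le ht)
  rwa [Real.coe_toNNReal t ht0] at this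

/-- A solution of the nonlinear equation solves the linear forward equation with its own
coefficients, whose only solution is given by the transition laws. -/
lemma SolvesNonlinear.isMild (hL : IsLipschitzFamily L κ) {μ : ProbabilityMeasure (E d)}
    {m : ℝ≥0 → ProbabilityMeasure (E d)} (h : SolvesNonlinear L μ m) :
    IsMild L μ fun u => m u.toNNReal := by
  have hf := solvesForward_of_solvesWeakly (Λ := fun t => L (m t)) h.2
  simp only [NNReal.coe_zero] at hf
  have hc : Continuous fun u : ℝ => m u.toNNReal := by
    have := hf.continuous_comp_max fun t => hL.size_le _
    have e : ∀ u : ℝ, (max 0 u).toNNReal = u.toNNReal := fun u => by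
      rcases le_total 0 u with h | h
      · rw [max_eq_right h]
      · rw [max_eq_left h, Real.toNNReal_of_nonpos h, Real.toNNReal_zero]
    simpa only [e] using this
  refine ⟨hc, fun t ht => ?_⟩
  have h1 := hf.eq_convP (hL.niceCurve hc) ht
  simp only [Real.toNNReal_zero] at h1
  rw [h.1] at h1
  exact h1

/-- The solution of the nonlinear equation with initial law `μ`. -/
noncomputable def mildSol (hL : IsLipschitzFamily L κ) (μ : ProbabilityMeasure (E d)) :
    ℝ → ProbabilityMeasure (E d) := (exists_isMild hL μ).choose

lemma isMild_mildSol (hL : IsLipschitzFamily L κ) (μ : ProbabilityMeasure (E d)) :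
    IsMild L μ (mildSol hL μ) := (exists_isMild hL μ).choose_spec

lemma SolvesNonlinear.eq_mildSol (hL : IsLipschitzFamily L κ) {μ : ProbabilityMeasure (E d)}
    {m : ℝ≥0 → ProbabilityMeasure (E d)} (h : SolvesNonlinear L μ m) (t : ℝ≥0) :
    m t = mildSol hL μ t := by
  have := (h.isMild hL).unique hL (isMild_mildSol hL μ) t.2
  simpa using this

lemma isNonlinearLevySemigroup_mildSol (hL : IsLipschitzFamily L κ) :
    IsNonlinearLevySemigroup L fun (t : ℝ≥0) μ => mildSol hL μ t where
  zero μ := (isMild_mildSol hL μ).zero hL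
  add s t μ := by
    have h := (isMild_mildSol hL μ).shift hL t.2
    have := h.unique hL (isMild_mildSol hL _) s.2
    rw [add_comm, NNReal.coe_add]
    exact this
  continuous_time μ := (isMild_mildSol hL μ).continuous.comp NNReal.continuous_coe
  continuous_initial t := by
    refine continuous_iff_continuousAt.2 fun μ => tendsto_iff_tendsto_c2DualDist.2 ?_
    refine squeeze_zero (fun _ => c2DualDist_nonneg _ _) (fun η =>
      (isMild_mildSol hL η).c2DualDist_le hL (isMild_mildSol hL μ) t.2) ?_
    simpa using (tendsto_c2DualDist_nhds μ).mul_const _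
  solves μ := (isMild_mildSol hL μ).solvesNonlinear hL

lemma IsNonlinearLevySemigroup.eq_mildSol (hL : IsLipschitzFamily L κ)
    {T : ℝ≥0 → ProbabilityMeasure (E d) → ProbabilityMeasure (E d)}
    (hT : IsNonlinearLevySemigroup L T) : T = fun (t : ℝ≥0) μ => mildSol hL μ t :=
  funext fun t => funext fun μ => (hT.solves μ).eq_mildSol hL t

end

/-! ### Transition kernels -/

section

variable {d : ℕ} {Λ : ℝ → LevyTriplet d} {K : ℝ}

/-- The kernel `x ↦ δ_x ∗ P`. -/
noncomputable def shiftKernel (P : ProbabilityMeasure (E d)) : Kernel (E d) (E d) :=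
  (Kernel.id ×ₖ Kernel.const (E d) (P : Measure (E d))).map fun p => p.1 + p.2

instance (P : ProbabilityMeasure (E d)) : IsMarkovKernel (shiftKernel P) :=
  Kernel.IsMarkovKernel.map _ (by fun_prop)

lemma shiftKernel_apply (P : ProbabilityMeasure (E d)) (x : E d) :
    shiftKernel P x = (P : Measure (E d)).map fun y => x + y := by
  unfold shiftKernel
  rw [Kernel.map_apply _ (by fun_prop), Kernel.prod_apply, Kernel.id_apply, Kernel.const_apply,
    Measure.dirac_prod, Measure.map_map (by fun_prop) (by fun_prop)]
  rfl

lemma shiftKernel_apply' (P : ProbabilityMeasure (E d)) (x : E d) {B : Set (E d)}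
    (hB : MeasurableSet B) : shiftKernel P x B = (P : Measure (E d)) ((fun y => x + y) ⁻¹' B) := by
  rw [shiftKernel_apply, Measure.map_apply (by fun_prop) hB]

lemma shiftKernel_comp (P η : ProbabilityMeasure (E d)) :
    shiftKernel P ∘ₘ (η : Measure (E d)) = (convP η P : Measure (E d)) := by
  ext B hB
  rw [Measure.bind_apply hB (shiftKernel P).aemeasurable, coe_convP, Measure.conv,
    Measure.map_apply (by fun_prop) hB, Measure.prod_apply (hB.preimage (by fun_prop))]
  refine lintegral_congr fun x => ?_
  rw [shiftKernel_apply' P x hB]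
  rfl

lemma shiftKernel_eq_convP (P : ProbabilityMeasure (E d)) (x : E d) :
    shiftKernel P x = (convP (diracProba x) P : Measure (E d)) := by
  rw [← shiftKernel_comp]
  exact (Measure.dirac_bind (shiftKernel P).measurable x).symm

/-- The transition kernels of the additive process with generators `levyOp (Λ t)`. -/
noncomputable def transKernel (Λ : ℝ → LevyTriplet d) (r t : ℝ≥0) : Kernel (E d) (E d) :=
  shiftKernel (transLaw Λ r t)

/-- Convolution with the transition laws is a transition family generated by `levyOp (Λ t)`. -/
lemma isTransitionFamily_transKernel (hΛ : NiceCurve Λ K) :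
    IsTransitionFamily (fun t : ℝ≥0 => levyOp (Λ t)) (transKernel Λ) where
  isMarkovKernel r t _ := by unfold transKernel; infer_instance
  refl r := by
    ext1 x
    unfold transKernel
    rw [transLaw_self hΛ, shiftKernel_eq_convP, convP_diracProba_zero, Kernel.id_apply]
    rfl
  chapmanKolmogorov r s t hrs hst := by
    ext1 x
    unfold transKernel
    rw [Kernel.comp_apply, shiftKernel_eq_convP, shiftKernel_eq_convP, shiftKernel_comp,
      convP_assoc, convP_transLaw hΛ (by exact_mod_cast hrs) (by exact_mod_cast hst)]
  solves r η f hf t ht := by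
    have hrt : (r : ℝ) ≤ t := by exact_mod_cast ht
    have h := hasDerivWithinAt_integral_convP_transLaw hΛ η hf hrt
    simp only [transKernel, shiftKernel_comp]
    refine h.congr (fun s hs => ?_) ?_
    · rw [Real.coe_toNNReal s (r.2.trans hs)]
    · rw [Real.toNNReal_coe]

/-- The transition probabilities generated by `levyOp (Λ t)` are unique. -/
lemma IsTransitionFamily.eq_transKernel (hΛ : NiceCurve Λ K)
    {p : ℝ≥0 → ℝ≥0 → Kernel (E d) (E d)}
    (hp : IsTransitionFamily (fun t : ℝ≥0 => levyOp (Λ t)) p) {r t : ℝ≥0} (hrt : r ≤ t) :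
    p r t = transKernel Λ r t := by
  classical
  ext1 x
  have hprob : ∀ s, r ≤ s → IsProbabilityMeasure (p r s x) := fun s hs =>
    (hp.isMarkovKernel r s hs).isProbabilityMeasure x
  set ρ : ℝ → ProbabilityMeasure (E d) := fun u =>
    if h : r ≤ u.toNNReal then ⟨p r u.toNNReal x, hprob _ h⟩ else diracProba x with hρdef
  have hρ : ∀ u : ℝ, (r : ℝ) ≤ u → (ρ u : Measure (E d)) = p r u.toNNReal x := fun u hu => by
    have h : r ≤ u.toNNReal := NNReal.le_toNNReal_of_coe_le hu
    have e : ρ u = ⟨p r u.toNNReal x, hprob _ h⟩ := dif_pos h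
    rw [e]
    rfl
  have hdirac : ∀ s, p r s ∘ₘ (diracProba x : Measure (E d)) = p r s x := fun s =>
    Measure.dirac_bind (p r s).measurable x
  have hsol : SolvesForward Λ r ρ := by
    intro f hf u hu
    have hu0 : 0 ≤ u := r.2.trans hu
    have h := hp.solves r (diracProba x) f hf u.toNNReal (NNReal.le_toNNReal_of_coe_le hu)
    simp only [hdirac] at h
    rw [Real.coe_toNNReal u hu0] at h
    rw [hρ u hu]
    exact h.congr (fun s hs => by rw [hρ s hs]) (by rw [hρ u hu])
  have h := hsol.eq_convP hΛ (t := t) (by exact_mod_cast hrt)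
  have h0 : ρ r = diracProba x := by
    refine Subtype.ext ?_
    change (ρ r : Measure (E d)) = _
    rw [hρ r le_rfl, Real.toNNReal_coe, hp.refl, Kernel.id_apply]
    rfl
  have h1 := hρ t (by exact_mod_cast hrt)
  rw [Real.toNNReal_coe] at h1
  rw [← h1, h, h0, transKernel, shiftKernel_eq_convP]

/-! ### Kolmogorov's extension theorem -/

variable {ι : Type*} {P : ∀ I : Finset ι, Measure (I → E d)}

/-- Continuity at the empty set of the content defined by a projective family. -/
lemma tendsto_projectiveFamilyContent_zero [∀ I, IsProbabilityMeasure (P I)]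
    (hP : IsProjectiveMeasureFamily (α := fun _ : ι => E d) P) {A : ℕ → Set (ι → E d)}
    (hA : ∀ n, A n ∈ measurableCylinders fun _ : ι => E d) (hanti : Antitone A)
    (hinter : ⋂ n, A n = ∅) :
    Tendsto (fun n => projectiveFamilyContent hP (A n)) atTop (𝓝 0) := by
  classical
  have hmono : Antitone fun n => projectiveFamilyContent hP (A n) := fun m n hmn =>
    projectiveFamilyContent_mono hP (hA n) (hA m) (hanti hmn)
  by_contra hcon
  have hinf : ⨅ n, projectiveFamilyContent hP (A n) ≠ 0 := fun h0 =>
    hcon (h0 ▸ tendsto_atTop_iInf hmono)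
  set ε := ⨅ n, projectiveFamilyContent hP (A n)
  have hcyl : ∀ n, ∃ I S, MeasurableSet S ∧ A n = cylinder I S := fun n =>
    (mem_measurableCylinders _).1 (hA n)
  choose I S hS hAS using hcyl
  obtain ⟨δ, hδ, hδsum⟩ := ENNReal.exists_pos_sum_of_countable hinf ℕ
  have hK : ∀ n, ∃ C ⊆ S n, IsCompact C ∧ P (I n) (S n \ C) < δ n := fun n =>
    (hS n).exists_isCompact_sdiff_lt (measure_ne_top _ _) (by simpa using (hδ n).ne')
  choose C hCS hC hCδ using hK
  have hCcyl : ∀ n, cylinder (I n) (C n) ∈ measurableCylinders fun _ : ι => E d := fun n =>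
    cylinder_mem_measurableCylinders _ _ (hC n).measurableSet
  -- finitely many of the compact cylinders always have a common point
  have hne : ∀ n, ∃ x : ι → E d, ∀ k ≤ n, x ∈ cylinder (I k) (C k) := by
    intro n
    by_contra hno
    push Not at hno
    have hsub : A n ⊆ ⋃ k ≤ n, cylinder (I k) (S k \ C k) := by
      intro x hx
      obtain ⟨k, hk, hxk⟩ := hno x
      refine mem_iUnion₂.2 ⟨k, hk, ?_⟩
      have h1 : x ∈ A k := hanti hk hx
      rw [hAS k] at h1
      exact ⟨h1, hxk⟩
    have hmem : ∀ k, cylinder (I k) (S k \ C k) ∈ measurableCylinders fun _ : ι => E d := fun k =>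
      cylinder_mem_measurableCylinders _ _ ((hS k).diff (hC k).measurableSet)
    have hUmem : (⋃ k ≤ n, cylinder (I k) (S k \ C k)) ∈ measurableCylinders fun _ : ι => E d := by
      have := isSetRing_measurableCylinders.biUnion_mem (Finset.range (n + 1)) (fun k _ => hmem k)
      simpa only [Finset.mem_range_succ_iff] using this
    have h1 : ε ≤ ∑ k ∈ Finset.range (n + 1), (δ k : ℝ≥0∞) := by
      refine (iInf_le _ n).trans ((projectiveFamilyContent_mono hP (hA n) hUmem hsub).trans
        ((projectiveFamilyContent_iUnion_le hP hmem n).trans (Finset.sum_le_sum fun k _ => ?_)))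
      rw [projectiveFamilyContent_cylinder hP ((hS k).diff (hC k).measurableSet)]
      exact (hCδ k).le
    exact absurd (h1.trans (ENNReal.sum_le_tsum _)) (not_le.2 hδsum)
  choose x hx using hne
  -- a cluster point of the common points lies in all cylinders
  set y : ℕ → ι → E d := fun m i => if ∃ n, i ∈ I n then x m i else 0 with hy
  have hyx : ∀ m n, (I n).restrict (y m) = (I n).restrict (x m) := fun m n => by
    ext1 i
    simp only [Finset.restrict, hy, if_pos (⟨n, i.2⟩ : ∃ n, (i : ι) ∈ I n)]
  have hQ : ∀ i, ∃ Q : Set (E d), IsCompact Q ∧ ∀ m, y m i ∈ Q := by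
    intro i
    by_cases hi : ∃ n, i ∈ I n
    · obtain ⟨n, hn⟩ := hi
      refine ⟨(fun z : I n → E d => z ⟨i, hn⟩) '' C n ∪ (fun m => y m i) '' Iio n,
        ((hC n).image (continuous_apply _)).union ((finite_Iio n).image _).isCompact, fun m => ?_⟩
      rcases lt_or_ge m n with h | h
      · exact Or.inr ⟨m, h, rfl⟩
      · refine Or.inl ⟨(I n).restrict (x m), hx m n h, ?_⟩
        rw [← hyx m n]
        rfl
    · exact ⟨{0}, isCompact_singleton, fun m => by simp [hy, hi]⟩
  choose Q hQc hQy using hQ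
  obtain ⟨z, -, hz⟩ := (isCompact_univ_pi hQc).exists_mapClusterPt
    (f := atTop) (u := y)
    (tendsto_principal.2 (Eventually.of_forall fun m i _ => hQy i m))
  have hzC : ∀ n, z ∈ cylinder (I n) (C n) := by
    intro n
    have hcl : IsClosed (cylinder (α := fun _ : ι => E d) (I n) (C n)) :=
      (hC n).isClosed.preimage (f := (I n).restrict (π := fun _ : ι => E d))
        (continuous_pi fun i => continuous_apply (i : ι))
    refine hcl.mem_of_mapClusterPt hz ?_
    filter_upwards [eventually_ge_atTop n] with m hm
    change (I n).restrict (y m) ∈ C n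
    rw [hyx]
    exact hx m n hm
  have : z ∈ ⋂ n, A n := mem_iInter.2 fun n => by
    rw [hAS n]
    exact hCS n (hzC n)
  rw [hinter] at this
  exact this

/-- A projective family of probability measures on the finite products of `ℝᵈ` has a
projective limit. -/
theorem exists_isProjectiveLimit [∀ I, IsProbabilityMeasure (P I)]
    (hP : IsProjectiveMeasureFamily (α := fun _ : ι => E d) P) :
    ∃ μ : Measure (ι → E d), IsProbabilityMeasure μ ∧ IsProjectiveLimit μ P := by
  have hsub : (projectiveFamilyContent hP).IsSigmaSubadditive := by
    refine isSigmaSubadditive_of_addContent_iUnion_eq_tsum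
      isSetRing_measurableCylinders (fun f hf hf_Union hf' => ?_)
    exact addContent_iUnion_eq_sum_of_tendsto_zero isSetRing_measurableCylinders
      (projectiveFamilyContent hP) (fun s hs => projectiveFamilyContent_ne_top _)
      (fun _ => tendsto_projectiveFamilyContent_zero hP) hf hf_Union hf'
  set μ := (projectiveFamilyContent hP).measure isSetSemiring_measurableCylinders
    generateFrom_measurableCylinders.ge hsub with hμ
  have hlim : IsProjectiveLimit μ P := by
    intro I
    ext s hs
    rw [Measure.map_apply (by fun_prop) hs, hμ, AddContent.measure_eq]
    · exact projectiveFamilyContent_cylinder hP hs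
    · exact generateFrom_measurableCylinders.symm
    · exact cylinder_mem_measurableCylinders _ _ hs
  refine ⟨μ, ⟨?_⟩, hlim⟩
  have := hlim ∅
  rw [← measure_univ (μ := P ∅), ← this, Measure.map_apply (by fun_prop) MeasurableSet.univ,
    preimage_univ]

end

/-! ### Additive processes -/

section

variable {d : ℕ} {q : ℝ≥0 → ℝ≥0 → ProbabilityMeasure (E d)} {μ : ProbabilityMeasure (E d)}
  {Ω : Type*} {mΩ : MeasurableSpace Ω} {P : Measure Ω} {X : ℝ≥0 → Ω → E d} {J : Set ℝ≥0}

/-- The σ-algebra generated by the `X s`, `s ∈ J`, `s ≤ r`. -/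
abbrev pastOn (X : ℝ≥0 → Ω → E d) (J : Set ℝ≥0) (r : ℝ≥0) : MeasurableSpace Ω :=
  ⨆ s ∈ J ∩ Iic r, MeasurableSpace.comap (X s) inferInstance

/-- Under `P`, the process `X` observed at the times of `J` has initial distribution `μ`, and its
increment over `[r, t]` has the distribution `q r t` and is independent of the past of `r`. -/
structure IsAdditiveOn (q : ℝ≥0 → ℝ≥0 → ProbabilityMeasure (E d)) (μ : ProbabilityMeasure (E d))
    (J : Set ℝ≥0) (X : ℝ≥0 → Ω → E d) (P : Measure Ω) : Prop where
  measurable : ∀ t, Measurable (X t)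
  map_zero : P.map (X 0) = (μ : Measure (E d))
  increment : ∀ r ∈ J, ∀ t ∈ J, r ≤ t → ∀ A, MeasurableSet[pastOn X J r] A →
    ∀ B, MeasurableSet B →
      P (A ∩ (fun ω => X t ω - X r ω) ⁻¹' B) = P A * (q r t : Measure (E d)) B

lemma pastOn_le (hX : ∀ t, Measurable (X t)) (J : Set ℝ≥0) (r : ℝ≥0) : pastOn X J r ≤ mΩ :=
  iSup₂_le fun s _ => (hX s).comap_le

lemma pastOn_mono {J J' : Set ℝ≥0} {r r' : ℝ≥0} (hJ : J ⊆ J') (hr : r ≤ r') :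
    pastOn X J r ≤ pastOn X J' r' :=
  biSup_mono fun _ hs => ⟨hJ hs.1, hs.2.trans hr⟩

lemma measurable_pastOn {r s : ℝ≥0} (hs : s ∈ J) (hsr : s ≤ r) :
    Measurable[pastOn X J r] (X s) :=
  Measurable.of_comap_le (le_iSup₂_of_le (f := fun s (_ : s ∈ J ∩ Iic r) =>
    MeasurableSpace.comap (X s) inferInstance) s ⟨hs, hsr⟩ le_rfl)

lemma IsAdditiveOn.mono {J' : Set ℝ≥0} (h : IsAdditiveOn q μ J' X P) (hJ : J ⊆ J') :
    IsAdditiveOn q μ J X P where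
  measurable := h.measurable
  map_zero := h.map_zero
  increment r hr t ht hrt A hA B hB :=
    h.increment r (hJ hr) t (hJ ht) hrt A (pastOn_mono hJ le_rfl _ hA) B hB

/-- On an event of the past of `r`, the increment over `[r, t]` is independent of every random
variable that depends on the past of `r`. -/
lemma IsAdditiveOn.map_restrict_prodMk [IsProbabilityMeasure P] (h : IsAdditiveOn q μ J X P)
    {r t : ℝ≥0} (hr : r ∈ J) (ht : t ∈ J) (hrt : r ≤ t) {A : Set Ω}
    (hA : MeasurableSet[pastOn X J r] A) {F : Type*} [MeasurableSpace F] {Z : Ω → F}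
    (hZ : Measurable[pastOn X J r] Z) :
    (P.restrict A).map (fun ω => (Z ω, X t ω - X r ω)) =
      ((P.restrict A).map Z).prod (q r t : Measure (E d)) := by
  have hle := pastOn_le h.measurable J r
  have hZ' : Measurable Z := hZ.mono hle le_rfl
  have hA' : MeasurableSet A := hle _ hA
  have hD : Measurable fun ω => X t ω - X r ω := (h.measurable t).sub (h.measurable r)
  symm
  refine Measure.prod_eq fun S B hS hB => ?_
  rw [Measure.map_apply (hZ'.prodMk hD) (hS.prod hB), Measure.map_apply hZ' hS,
    Measure.restrict_apply ((hZ'.prodMk hD) (hS.prod hB)), Measure.restrict_apply (hZ' hS),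
    ← h.increment r hr t ht hrt _ ((hZ hS).inter hA) B hB]
  congr 1
  ext ω
  simp only [mem_inter_iff, mem_preimage, mem_prod]
  tauto

lemma IsAdditiveOn.map_prodMk [IsProbabilityMeasure P] (h : IsAdditiveOn q μ J X P)
    {r t : ℝ≥0} (hr : r ∈ J) (ht : t ∈ J) (hrt : r ≤ t) {F : Type*} [MeasurableSpace F] {Z : Ω → F}
    (hZ : Measurable[pastOn X J r] Z) :
    P.map (fun ω => (Z ω, X t ω - X r ω)) = (P.map Z).prod (q r t : Measure (E d)) := by
  simpa using h.map_restrict_prodMk hr ht hrt MeasurableSet.univ hZ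

lemma IsAdditiveOn.map_sub [IsProbabilityMeasure P] (h : IsAdditiveOn q μ J X P)
    {r t : ℝ≥0} (hr : r ∈ J) (ht : t ∈ J) (hrt : r ≤ t) :
    P.map (fun ω => X t ω - X r ω) = (q r t : Measure (E d)) := by
  ext B hB
  have := h.increment r hr t ht hrt univ MeasurableSet.univ B hB
  have hD : Measurable fun ω => X t ω - X r ω := (h.measurable t).sub (h.measurable r)
  rw [Measure.map_apply hD hB]
  simpa using this

open scoped Classical in
/-- Extend a configuration on `J` to the time `t` by adding an increment to its value at `s`. -/
noncomputable def extendConfig (J : Finset ℝ≥0) (s : J) (t : ℝ≥0) (p : (J → E d) × E d) :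
    ↥(insert t J : Finset ℝ≥0) → E d := fun i =>
  if h : (i : ℝ≥0) ∈ J then p.1 ⟨i, h⟩ else p.1 s + p.2

lemma measurable_extendConfig (J : Finset ℝ≥0) (s : J) (t : ℝ≥0) :
    Measurable (extendConfig (d := d) J s t) := by
  classical
  refine measurable_pi_lambda _ fun i => ?_
  by_cases h : (i : ℝ≥0) ∈ J
  · simp only [extendConfig, dif_pos h]
    fun_prop
  · simp only [extendConfig, dif_neg h]
    fun_prop

lemma IsAdditiveOn.map_restrict_singleton (h : IsAdditiveOn q μ J X P) :
    P.map (fun ω (i : ({0} : Finset ℝ≥0)) => X i ω) = (μ : Measure (E d)).map fun x _ => x := by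
  rw [← h.map_zero, Measure.map_map (by fun_prop) (h.measurable 0)]
  congr 1
  ext1 ω
  ext1 i
  simp [Finset.mem_singleton.1 i.2]

open scoped Classical in
lemma IsAdditiveOn.map_restrict_insert [IsProbabilityMeasure P] {J : Finset ℝ≥0} (s : J) {t : ℝ≥0}
    (hs : ∀ u ∈ J, u ≤ s) (ht : ∀ u ∈ J, u < t)
    (h : IsAdditiveOn q μ ((insert t J : Finset ℝ≥0) : Set ℝ≥0) X P) :
    P.map (fun ω (i : (insert t J : Finset ℝ≥0)) => X i ω) =
      ((P.map fun ω (i : J) => X i ω).prod (q s t : Measure (E d))).map (extendConfig J s t) := by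
  have hm := h.measurable
  have hZ : Measurable[pastOn X ((insert t J : Finset ℝ≥0) : Set ℝ≥0) s]
      (fun ω (i : J) => X i ω) :=
    @measurable_pi_lambda _ _ _ (_) _ _ fun i =>
      measurable_pastOn (Finset.mem_coe.2 (Finset.mem_insert_of_mem i.2)) (hs i i.2)
  rw [← h.map_prodMk (Finset.mem_coe.2 (Finset.mem_insert_of_mem s.2))
    (Finset.mem_coe.2 (Finset.mem_insert_self t J)) (ht s s.2).le hZ,
    Measure.map_map (measurable_extendConfig J s t) (by fun_prop)]
  congr 1
  ext1 ω
  ext1 i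
  by_cases hi : (i : ℝ≥0) ∈ J
  · simp [extendConfig, hi]
  · have : (i : ℝ≥0) = t := (Finset.mem_insert.1 i.2).resolve_right hi
    simp only [Function.comp_apply, extendConfig, dif_neg hi]
    simp only [this, add_sub_cancel]

lemma zero_mem_of_zero_mem_insert {t : ℝ≥0} {J : Finset ℝ≥0} (h0 : 0 ∈ insert t J)
    (ht : ∀ u ∈ J, u < t) (hne : J.Nonempty) : 0 ∈ J := by
  obtain ⟨x, hx⟩ := hne
  exact (Finset.mem_insert.1 h0).resolve_left fun h => absurd (ht x hx) (h ▸ not_lt_zero)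

/-- The finite-dimensional distributions of an additive process are determined by its initial
distribution and the distributions of its increments. -/
lemma IsAdditiveOn.map_restrict_eq [IsProbabilityMeasure P] {Ω' : Type*} {mΩ' : MeasurableSpace Ω'}
    {P' : Measure Ω'} [IsProbabilityMeasure P'] {X' : ℝ≥0 → Ω' → E d} {J : Finset ℝ≥0}
    (h0 : 0 ∈ J) (h : IsAdditiveOn q μ (J : Set ℝ≥0) X P)
    (h' : IsAdditiveOn q μ (J : Set ℝ≥0) X' P') :
    P.map (fun ω (i : J) => X i ω) = P'.map (fun ω (i : J) => X' i ω) := by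
  classical
  induction J using Finset.induction_on_max with
  | empty => simp at h0
  | insert t J ht ih =>
    rcases J.eq_empty_or_nonempty with rfl | hne
    · obtain rfl : 0 = t := by simpa using h0
      exact h.map_restrict_singleton.trans h'.map_restrict_singleton.symm
    · have hsub : (J : Set ℝ≥0) ⊆ ((insert t J : Finset ℝ≥0) : Set ℝ≥0) := by simp
      have hs : ∀ u ∈ J, u ≤ (⟨J.max' hne, J.max'_mem hne⟩ : J) := fun u hu => J.le_max' u hu
      rw [h.map_restrict_insert _ hs ht, h'.map_restrict_insert _ hs ht,
        ih (zero_mem_of_zero_mem_insert h0 ht hne) (h.mono hsub) (h'.mono hsub)]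

/-- The distribution of an additive process at finitely many times, whether or not `0` is among
them. -/
lemma IsAdditiveOn.map_restrict_eq_of_subset [IsProbabilityMeasure P] {Ω' : Type*}
    {mΩ' : MeasurableSpace Ω'} {P' : Measure Ω'} [IsProbabilityMeasure P'] {X' : ℝ≥0 → Ω' → E d}
    {J' : Set ℝ≥0} {I : Finset ℝ≥0} (h : IsAdditiveOn q μ J X P) (h' : IsAdditiveOn q μ J' X' P')
    (hI : (insert 0 I : Set ℝ≥0) ⊆ J) (hI' : (insert 0 I : Set ℝ≥0) ⊆ J') :
    P.map (fun ω (i : I) => X i ω) = P'.map (fun ω (i : I) => X' i ω) := by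
  classical
  have hc : ((insert 0 I : Finset ℝ≥0) : Set ℝ≥0) = insert 0 (I : Set ℝ≥0) := by simp
  have key := (h.mono (hc ▸ hI)).map_restrict_eq (Finset.mem_insert_self 0 I) (h'.mono (hc ▸ hI'))
  have hm := h.measurable
  have hm' := h'.measurable
  have hr : Measurable (Finset.restrict₂ (π := fun _ => E d) (Finset.subset_insert 0 I)) :=
    Finset.measurable_restrict₂ _
  have := congrArg (Measure.map (Finset.restrict₂ (π := fun _ => E d) (Finset.subset_insert 0 I)))
    key
  rwa [Measure.map_map hr (by fun_prop), Measure.map_map hr (by fun_prop)] at this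

/-- Increments over degenerate intervals vanish, so a constant process is additive on `{0}`. -/
lemma isAdditiveOn_const (hq : ∀ t, q t t = diracProba 0) (μ : ProbabilityMeasure (E d)) :
    IsAdditiveOn q μ {0} (fun _ x => x) (μ : Measure (E d)) where
  measurable _ := measurable_id
  map_zero := Measure.map_id
  increment r hr t ht hrt A hA B hB := by
    obtain rfl : r = 0 := hr
    obtain rfl : t = 0 := ht
    rw [hq]
    by_cases h : (0 : E d) ∈ B <;> simp [diracProba, hB, h]

/-- An additive process on `J` extends to a later time `t`: an independent increment is added to
the value at the last time `s` of `J`. -/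
lemma IsAdditiveOn.extend [IsProbabilityMeasure P] (hq : ∀ t, q t t = diracProba 0)
    (hconv : ∀ r s t, r ≤ s → s ≤ t → convP (q r s) (q s t) = q r t)
    (h : IsAdditiveOn q μ J X P) {s t : ℝ≥0} (h0 : 0 ∈ J) (hsJ : s ∈ J) (hs : ∀ u ∈ J, u ≤ s)
    (hst : s < t) :
    IsAdditiveOn q μ (insert t J)
      (fun u ω => if u = t then X s ω.1 + ω.2 else X u ω.1)
      (P.prod (q s t : Measure (E d))) where
  measurable u := by
    have hm := h.measurable
    by_cases hu : u = t
    · simp only [if_pos hu]; fun_prop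
    · simp only [if_neg hu]; fun_prop
  map_zero := by
    have hm := h.measurable
    have h0t : (0 : ℝ≥0) ≠ t := ((hs 0 h0).trans_lt hst).ne
    simp only [if_neg h0t]
    rw [← h.map_zero]
    change Measure.map (X 0 ∘ Prod.fst) _ = _
    rw [← Measure.map_map (by fun_prop) (by fun_prop)]
    simp
  increment := by
    have hm := h.measurable
    set X' : ℝ≥0 → Ω × E d → E d := fun u ω => if u = t then X s ω.1 + ω.2 else X u ω.1 with hX'
    have hne : ∀ u ∈ J, u ≠ t := fun u hu => ((hs u hu).trans_lt hst).ne
    have hX'J : ∀ u ∈ J, X' u = X u ∘ Prod.fst := fun u hu => by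
      ext1 ω
      simp [hX', hne u hu]
    -- the past of `r ∈ J` depends on the first component only
    have hpast : ∀ r ∈ J, ∀ A, MeasurableSet[pastOn X' (insert t J) r] A →
        ∃ A₀, MeasurableSet[pastOn X J r] A₀ ∧ A = Prod.fst ⁻¹' A₀ := by
      intro r hr A hA
      have hle : pastOn X' (insert t J) r ≤ (pastOn X J r).comap Prod.fst := by
        refine iSup₂_le fun u hu => ?_
        have huJ : u ∈ J := (mem_insert_iff.1 hu.1).resolve_left fun hut =>
          absurd (hut ▸ hu.2 : t ≤ r) (not_le.2 ((hs r hr).trans_lt hst))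
        rw [hX'J u huJ, ← MeasurableSpace.comap_comp]
        exact MeasurableSpace.comap_mono (measurable_pastOn huJ hu.2).comap_le
      obtain ⟨A₀, hA₀, rfl⟩ := hle _ hA
      exact ⟨A₀, hA₀, rfl⟩
    intro r hr u hu hru A hA B hB
    by_cases hrt : r = t
    · obtain rfl : u = t := by
        rcases mem_insert_iff.1 hu with h1 | h1
        · exact h1
        · exact absurd ((hs u h1).trans_lt hst) (not_lt.2 (hrt ▸ hru))
      subst hrt
      rw [hq]
      by_cases h : (0 : E d) ∈ B <;> simp [diracProba, hB, h]
    have hrJ : r ∈ J := (mem_insert_iff.1 hr).resolve_left hrt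
    obtain ⟨A₀, hA₀, rfl⟩ := hpast r hrJ A hA
    have hA₀' : MeasurableSet A₀ := pastOn_le hm _ _ _ hA₀
    have hfst : (P.prod (q s t : Measure (E d))) (Prod.fst ⁻¹' A₀) = P A₀ := by
      rw [← Measure.map_apply measurable_fst hA₀', Measure.map_fst_prod]
      simp
    rw [hfst]
    rcases mem_insert_iff.1 hu with rfl | huJ
    · -- the increment over `[r, t]` is the sum of the ones over `[r, s]` and `[s, t]`
      have hrs := hs r hrJ
      have hmap : (P.restrict A₀).map (fun ω => X s ω - X r ω) =
          P A₀ • (q r s : Measure (E d)) := by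
        ext C hC
        have hD : Measurable fun ω => X s ω - X r ω := (hm s).sub (hm r)
        rw [Measure.map_apply hD hC, Measure.restrict_apply (hD hC), inter_comm,
          h.increment r hrJ s hsJ hrs A₀ hA₀ C hC, Measure.smul_apply, smul_eq_mul]
      rw [← hconv r s u hrs hst.le, coe_convP, Measure.conv,
        Measure.map_apply (by fun_prop) hB, ← smul_eq_mul, ← Measure.smul_apply,
        ← Measure.prod_smul_left, ← hmap]
      have hD : Measurable fun ω => X s ω - X r ω := (hm s).sub (hm r)
      have e := Measure.map_prod_map (P.restrict A₀) (q s u : Measure (E d)) hD measurable_id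
      rw [Measure.map_id] at e
      rw [e, Measure.map_apply (by fun_prop) (hB.preimage (by fun_prop))]
      have e2 : (P.restrict A₀).prod (q s u : Measure (E d)) =
          (P.prod (q s u : Measure (E d))).restrict (A₀ ×ˢ univ) := by
        rw [← Measure.prod_restrict, Measure.restrict_univ]
      have hmeas : Measurable fun p : Ω × E d => X s p.1 - X r p.1 + p.2 := by fun_prop
      rw [e2, Measure.restrict_apply (by exact hmeas hB)]
      congr 1
      ext ω
      simp only [mem_inter_iff, mem_preimage, mem_prod, mem_univ, and_true, Prod.map_fst,
        Prod.map_snd, id_eq, if_true, if_neg hrt]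
      rw [and_comm, sub_add_eq_add_sub]
    · rw [← h.increment r hrJ u huJ hru A₀ hA₀ B hB]
      have hD : Measurable fun ω => X u ω - X r ω := (hm u).sub (hm r)
      have : (Prod.fst ⁻¹' A₀ ∩ (fun ω => X' u ω - X' r ω) ⁻¹' B : Set (Ω × E d)) =
          Prod.fst ⁻¹' (A₀ ∩ (fun ω => X u ω - X r ω) ⁻¹' B) := by
        ext ω
        simp [hX'J u huJ, hX'J r hrJ]
      rw [this, ← Measure.map_apply measurable_fst (hA₀'.inter (hD hB)), Measure.map_fst_prod]
      simp

/-- Additive processes exist on every finite set of times. -/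
lemma exists_isAdditiveOn_finset (hq : ∀ t, q t t = diracProba 0)
    (hconv : ∀ r s t, r ≤ s → s ≤ t → convP (q r s) (q s t) = q r t)
    (μ : ProbabilityMeasure (E d)) {J : Finset ℝ≥0} (h0 : 0 ∈ J) :
    ∃ (Ω : Type) (_ : MeasurableSpace Ω) (P : Measure Ω) (X : ℝ≥0 → Ω → E d),
      IsProbabilityMeasure P ∧ IsAdditiveOn q μ (J : Set ℝ≥0) X P := by
  classical
  induction J using Finset.induction_on_max with
  | empty => simp at h0
  | insert t J ht ih =>
    rcases J.eq_empty_or_nonempty with rfl | hne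
    · obtain rfl : 0 = t := by simpa using h0
      exact ⟨E d, inferInstance, μ, fun _ x => x, inferInstance,
        by simpa using isAdditiveOn_const hq μ⟩
    · have h0J := zero_mem_of_zero_mem_insert h0 ht hne
      obtain ⟨Ω, mΩ, P, X, hP, h⟩ := ih h0J
      have h' := h.extend hq hconv h0J (J.max'_mem hne) (fun u hu => J.le_max' u hu)
        (ht _ (J.max'_mem hne))
      rw [← Finset.coe_insert] at h'
      exact ⟨Ω × E d, inferInstance, _, _, inferInstance, h'⟩

/-- Additive processes exist, realized by the coordinates of the path space. -/
theorem exists_isAdditiveOn_univ (hq : ∀ t, q t t = diracProba 0)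
    (hconv : ∀ r s t, r ≤ s → s ≤ t → convP (q r s) (q s t) = q r t)
    (μ : ProbabilityMeasure (E d)) :
    ∃ P : Measure (ℝ≥0 → E d), IsProbabilityMeasure P ∧
      IsAdditiveOn q μ univ (fun t ω => ω t) P := by
  classical
  choose Ω mΩ R X hR hX using fun I : Finset ℝ≥0 =>
    exists_isAdditiveOn_finset hq hconv μ (Finset.mem_insert_self 0 I)
  have hm := fun I => (hX I).measurable
  have hprob : ∀ I : Finset ℝ≥0, IsProbabilityMeasure ((R I).map fun ω (i : I) => X I i ω) :=
    fun I => Measure.isProbabilityMeasure_map (by have := hm I; fun_prop)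
  have hproj : IsProjectiveMeasureFamily (α := fun _ : ℝ≥0 => E d)
      fun I : Finset ℝ≥0 => (R I).map fun ω (i : I) => X I i ω := by
    intro I J hJI
    have h1 := hm I
    have h2 := hm J
    have hXI : Measurable fun ω (i : I) => X I i ω := by fun_prop
    refine Eq.trans ?_ (Measure.map_map (Finset.measurable_restrict₂ (X := fun _ => E d) hJI)
      hXI).symm
    refine (hX J).map_restrict_eq_of_subset (hX I) ?_ ?_
    · simp
    · rw [Finset.coe_insert]
      exact insert_subset_insert hJI
  obtain ⟨P, hP, hlim⟩ := exists_isProjectiveLimit hproj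
  refine ⟨P, hP, fun t => by fun_prop, ?_, ?_⟩
  · have h1 := hm {0}
    have h := congrArg (Measure.map fun x : ({0} : Finset ℝ≥0) → E d => x ⟨0, by simp⟩) (hlim {0})
    rw [Measure.map_map (by fun_prop) (by fun_prop), Measure.map_map (by fun_prop) (by fun_prop)]
      at h
    rw [← (hX {0}).map_zero]
    exact h
  · intro r _ t _ hrt A hA B hB
    have hD : Measurable fun ω : ℝ≥0 → E d => ω t - ω r := by fun_prop
    -- both sides are finite measures in `A`, and agree on a generating π-system
    set m : ℝ≥0 → MeasurableSpace (ℝ≥0 → E d) := fun s =>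
      MeasurableSpace.comap (fun ω => ω s) inferInstance
    have hmle : ∀ s, m s ≤ MeasurableSpace.pi := fun s => (measurable_pi_apply s).comap_le
    have hgen := generateFrom_piiUnionInter_measurableSet m (univ ∩ Iic r)
    have hpi := isPiSystem_piiUnionInter (fun n => {s | MeasurableSet[m n] s})
      (fun n => @MeasurableSpace.isPiSystem_measurableSet _ (m n)) (univ ∩ Iic r)
    have key : ∀ A ∈ piiUnionInter (fun n => {s | MeasurableSet[m n] s}) (univ ∩ Iic r),
        P (A ∩ (fun ω => ω t - ω r) ⁻¹' B) = P A * (q r t : Measure (E d)) B := by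
      rintro A ⟨S, hS, f, hf, rfl⟩
      have hf' : ∀ s, ∃ C : Set (E d), MeasurableSet C ∧ (s ∈ S → f s = (fun ω => ω s) ⁻¹' C) := by
        intro s
        by_cases hs : s ∈ S
        · obtain ⟨C, hC, e⟩ := hf s hs
          exact ⟨C, hC, fun _ => e.symm⟩
        · exact ⟨∅, MeasurableSet.empty, fun h => absurd h hs⟩
      choose C hC hfC using hf'
      set I : Finset ℝ≥0 := insert r (insert t S)
      have hrI : r ∈ I := by simp [I]
      have htI : t ∈ I := by simp [I]
      have hSI : ∀ s ∈ S, s ∈ I := fun s hs => by simp [I, hs]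
      have hmI := hm I
      have htransfer : ∀ T : Set (I → E d), MeasurableSet T →
          P {ω | (fun i : I => ω i) ∈ T} = R I {ω | (fun i : I => X I i ω) ∈ T} := by
        intro T hT
        have h1 := congrFun (congrArg DFunLike.coe (hlim I)) T
        rwa [Measure.map_apply (by fun_prop) hT, Measure.map_apply (by fun_prop) hT] at h1
      set T : Set (I → E d) := ⋂ s : S, {x | x ⟨s, hSI s s.2⟩ ∈ C s} with hT
      have hTm : MeasurableSet T := MeasurableSet.iInter fun s =>
        (measurable_pi_apply (⟨s, hSI s s.2⟩ : I)) (hC s)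
      have hBm : MeasurableSet {x : I → E d | x ⟨t, htI⟩ - x ⟨r, hrI⟩ ∈ B} := by
        have : Measurable fun x : I → E d => x ⟨t, htI⟩ - x ⟨r, hrI⟩ := by fun_prop
        exact this hB
      have hA : ⋂ s ∈ S, f s = {ω | (fun i : I => ω i) ∈ T} := by
        ext ω
        simp only [hT, mem_iInter, mem_ofPred_eq, Subtype.forall]
        exact forall₂_congr fun s hs => by rw [hfC s hs]; rfl
      have hpast : MeasurableSet[pastOn (X I) ((insert 0 I : Finset ℝ≥0) : Set ℝ≥0) r]
          {ω | (fun i : I => X I i ω) ∈ T} := by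
        have : {ω | (fun i : I => X I i ω) ∈ T} = ⋂ s : S, X I s ⁻¹' C s := by
          ext ω
          simp [hT]
        rw [this]
        exact MeasurableSet.iInter fun s => measurable_pastOn
          (Finset.mem_coe.2 (Finset.mem_insert_of_mem (hSI s s.2))) (hS s.2).2 (hC s)
      rw [hA, htransfer T hTm, ← (hX I).increment r (Finset.mem_insert_of_mem hrI) t
        (Finset.mem_insert_of_mem htI) hrt _ hpast B hB]
      exact htransfer (T ∩ {x | x ⟨t, htI⟩ - x ⟨r, hrI⟩ ∈ B}) (hTm.inter hBm)
    have hle := pastOn_le (X := fun (s : ℝ≥0) (ω : ℝ≥0 → E d) => ω s)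
      (fun s => measurable_pi_apply s) univ r
    refine MeasurableSpace.induction_on_inter
      (C := fun A _ => P (A ∩ (fun ω => ω t - ω r) ⁻¹' B) = P A * (q r t : Measure (E d)) B)
      hgen.symm hpi (by simp) (fun A hA => key A hA) ?_ ?_ A hA
    · intro A hA ih
      have hA' : MeasurableSet A := hle A hA
      have huniv := key univ ⟨∅, by simp, fun _ => univ, by simp, by simp⟩
      rw [univ_inter, measure_univ, one_mul] at huniv
      have e : P (A ∩ (fun ω => ω t - ω r) ⁻¹' B) + P (Aᶜ ∩ (fun ω => ω t - ω r) ⁻¹' B) =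
          P ((fun ω => ω t - ω r) ⁻¹' B) := by
        rw [inter_comm A, inter_comm Aᶜ, ← Set.sdiff_eq]
        exact measure_inter_add_sdiff _ hA'
      refine (ENNReal.add_right_inj (measure_ne_top P (A ∩ (fun ω => ω t - ω r) ⁻¹' B))).1 ?_
      rw [e, huniv, ih, ← add_mul, measure_add_measure_compl hA', measure_univ, one_mul]
    · intro f hdisj hf ih
      have hf' : ∀ i, MeasurableSet (f i) := fun i => hle _ (hf i)
      rw [iUnion_inter, measure_iUnion (fun i j hij => (hdisj hij).mono inter_subset_left
        inter_subset_left) (fun i => (hf' i).inter (hD hB)), measure_iUnion hdisj hf',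
        ← ENNReal.tsum_mul_right]
      exact tsum_congr ih

end

/-! ### Markov processes with independent increments -/

section

variable {d : ℕ} {q : ℝ≥0 → ℝ≥0 → ProbabilityMeasure (E d)} {μ : ProbabilityMeasure (E d)}
  {Ω : Type*} {mΩ : MeasurableSpace Ω} {P : Measure Ω} {X : ℝ≥0 → Ω → E d}
  {p : ℝ≥0 → ℝ≥0 → Kernel (E d) (E d)}

lemma pastOn_univ (X : ℝ≥0 → Ω → E d) (r : ℝ≥0) :
    pastOn X univ r = ⨆ s : Iic r, MeasurableSpace.comap (X s) inferInstance := by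
  rw [pastOn, univ_inter, iSup_subtype']

/-- The Markov property integrated over an event of the past. -/
lemma IsMarkovProcess.measure_inter [IsProbabilityMeasure P] (h : IsMarkovProcess p X P)
    {r t : ℝ≥0} [IsMarkovKernel (p r t)] (hrt : r ≤ t) {A : Set Ω}
    (hA : MeasurableSet[pastOn X univ r] A) {B : Set (E d)} (hB : MeasurableSet B) :
    P (A ∩ X t ⁻¹' B) = ∫⁻ ω in A, p r t (X r ω) B ∂P := by
  have hle := pastOn_le h.measurable univ r
  have hm := h.measurable
  have hS : MeasurableSet (X t ⁻¹' B) := hm t hB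
  have hmark := h.markov r t hrt B hB
  rw [← pastOn_univ] at hmark
  have h1 := setIntegral_condExp hle (f := (X t ⁻¹' B).indicator fun _ => (1 : ℝ))
    ((integrable_const (1 : ℝ)).indicator hS) (μ := P) hA
  rw [setIntegral_congr_ae (g := fun ω => (p r t (X r ω)).real B) (hle _ hA)
    (hmark.mono fun ω hω _ => hω), setIntegral_indicator hS, setIntegral_const, smul_eq_mul,
    mul_one] at h1
  have hmeas : Measurable fun ω => p r t (X r ω) B :=
    ((p r t).measurable_coe hB).comp (hm r)
  simp only [measureReal_def] at h1
  rw [integral_toReal hmeas.aemeasurable (Eventually.of_forall fun ω => measure_lt_top _ _)] at h1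
  refine ((ENNReal.toReal_eq_toReal_iff' ?_ (measure_ne_top _ _)).1 h1).symm
  refine ((lintegral_mono fun ω => prob_le_one).trans_lt ?_).ne
  simp

/-- A Markov process whose transition kernels are convolutions is additive. -/
lemma IsMarkovProcess.isAdditiveOn [IsProbabilityMeasure P] (h : IsMarkovProcess p X P)
    (hp : ∀ r t, r ≤ t → p r t = shiftKernel (q r t)) (h0 : P.map (X 0) = (μ : Measure (E d))) :
    IsAdditiveOn q μ univ X P where
  measurable := h.measurable
  map_zero := h0
  increment r _ t _ hrt A hA B hB := by
    have hm := h.measurable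
    have hle := pastOn_le h.measurable univ r
    have hA' : MeasurableSet A := hle _ hA
    have : IsMarkovKernel (p r t) := by rw [hp r t hrt]; infer_instance
    -- on an event of the past, the law of `(X r, X t)` is that of a start followed by a transition
    have hjoint : (P.restrict A).map (fun ω => (X r ω, X t ω)) =
        ((P.restrict A).map (X r)) ⊗ₘ (p r t) := by
      have : IsFiniteMeasure ((P.restrict A).map (X r)) := inferInstance
      refine Measure.ext_prod fun {C D} hC hD => ?_
      have hXC : MeasurableSet[pastOn X univ r] (X r ⁻¹' C) :=
        measurable_pastOn (mem_univ r) le_rfl hC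
      rw [Measure.compProd_apply_prod hC hD, Measure.map_apply (by fun_prop) (hC.prod hD),
        Measure.restrict_apply (((hm r).prodMk (hm t)) (hC.prod hD)),
        setLIntegral_map hC ((p r t).measurable_coe hD) (hm r),
        Measure.restrict_restrict (hm r hC), ← h.measure_inter hrt (hXC.inter hA) hD]
      congr 1
      ext ω
      simp only [mem_inter_iff, mem_preimage, mem_prod]
      tauto
    have hT : MeasurableSet {z : E d × E d | z.2 - z.1 ∈ B} := by
      have : Measurable fun z : E d × E d => z.2 - z.1 := by fun_prop
      exact this hB
    have h1 := congrArg (fun ν => ν {z : E d × E d | z.2 - z.1 ∈ B}) hjoint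
    have hXX : Measurable fun ω => (X r ω, X t ω) := (hm r).prodMk (hm t)
    simp only [Measure.map_apply hXX hT, Measure.restrict_apply (hXX hT),
      Measure.compProd_apply hT] at h1
    rw [inter_comm]
    refine h1.trans ?_
    have hconst : ∀ x, p r t x (Prod.mk x ⁻¹' {z : E d × E d | z.2 - z.1 ∈ B}) =
        (q r t : Measure (E d)) B := by
      intro x
      rw [hp r t hrt, shiftKernel_apply' _ _ (measurable_prodMk_left hT)]
      congr 1
      ext y
      simp
    simp only [hconst, lintegral_const]
    rw [Measure.map_apply (hm r) MeasurableSet.univ, preimage_univ, Measure.restrict_apply_univ,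
      mul_comm]

/-- Additive processes are Markov processes whose transition kernels are convolutions. -/
lemma IsAdditiveOn.isMarkovProcess [IsProbabilityMeasure P] (h : IsAdditiveOn q μ univ X P) :
    IsMarkovProcess (fun r t => shiftKernel (q r t)) X P where
  measurable := h.measurable
  markov r t hrt B hB := by
    have hm := h.measurable
    have hle := pastOn_le h.measurable univ r
    have hS : MeasurableSet (X t ⁻¹' B) := hm t hB
    have hXr : Measurable[pastOn X univ r] (X r) := measurable_pastOn (mem_univ r) le_rfl
    have hmeas : Measurable fun ω => shiftKernel (q r t) (X r ω) B :=
      ((shiftKernel (q r t)).measurable_coe hB).comp (hm r)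
    have hmeas' : Measurable[pastOn X univ r] fun ω => (shiftKernel (q r t) (X r ω)).real B :=
      (((shiftKernel (q r t)).measurable_coe hB).comp hXr).ennreal_toReal
    have hint : Integrable (fun ω => (shiftKernel (q r t) (X r ω)).real B) P :=
      Integrable.of_bound (C := 1) (hmeas'.mono hle le_rfl).aestronglyMeasurable
        (Eventually.of_forall fun ω => by
          rw [Real.norm_of_nonneg measureReal_nonneg]
          exact measureReal_le_one)
    rw [← pastOn_univ]
    refine (ae_eq_condExp_of_forall_setIntegral_eq hle
      ((integrable_const (1 : ℝ)).indicator hS) (fun _ _ _ => hint.integrableOn)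
      (fun A hA _ => ?_) hmeas'.aestronglyMeasurable).symm
    have hT : MeasurableSet {z : E d × E d | z.1 + z.2 ∈ B} := by
      have : Measurable fun z : E d × E d => z.1 + z.2 := by fun_prop
      exact this hB
    have hXD : Measurable fun ω => (X r ω, X t ω - X r ω) := (hm r).prodMk ((hm t).sub (hm r))
    have h1 := congrArg (fun ν => ν {z : E d × E d | z.1 + z.2 ∈ B})
      (h.map_restrict_prodMk (mem_univ r) (mem_univ t) hrt hA hXr)
    simp only [Measure.map_apply hXD hT, Measure.restrict_apply (hXD hT),
      Measure.prod_apply hT] at h1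
    rw [lintegral_map (measurable_measure_prodMk_left hT) (hm r)] at h1
    have e : P (X t ⁻¹' B ∩ A) = ∫⁻ ω in A, shiftKernel (q r t) (X r ω) B ∂P := by
      refine Eq.trans ?_ (h1.trans (lintegral_congr fun ω => ?_))
      · congr 1
        ext ω
        simp
      · rw [shiftKernel_apply' _ _ hB]
        rfl
    simp only [measureReal_def]
    rw [integral_toReal hmeas.aemeasurable (Eventually.of_forall fun ω => measure_lt_top _ _),
      ← e, setIntegral_indicator hS, setIntegral_const, smul_eq_mul, mul_one, inter_comm,
      measureReal_def]

/-- The increments are joined one at a time: each is independent of the past of its left end point,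
to which all earlier increments belong. -/
lemma IsAdditiveOn.hasIndepIncrements [IsProbabilityMeasure P] (h : IsAdditiveOn q μ univ X P) :
    HasIndepIncrements X P := by
  refine HasIndepIncrements.of_nat fun t ht _ => ?_
  have hm := h.measurable
  rw [iIndepFun_iff_measure_inter_preimage_eq_mul]
  intro S B hB
  induction S using Finset.induction_on_max with
  | empty => simp
  | insert a S ha ih =>
    have hpast : MeasurableSet[pastOn X univ (t a)]
        (⋂ i ∈ S, (fun ω => X (t (i + 1)) ω - X (t i) ω) ⁻¹' B i) := by
      refine Finset.measurableSet_biInter S fun i hi => ?_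
      have hi' : Measurable[pastOn X univ (t a)] fun ω => X (t (i + 1)) ω - X (t i) ω :=
        (measurable_pastOn (mem_univ _) (ht (ha i hi))).sub
          (measurable_pastOn (mem_univ _) (ht (ha i hi).le))
      exact hi' (hB i (Finset.mem_insert_of_mem hi))
    have hat : t a ≤ t (a + 1) := ht a.le_succ
    have hBa := hB a (Finset.mem_insert_self a S)
    have hD : Measurable fun ω => X (t (a + 1)) ω - X (t a) ω := (hm _).sub (hm _)
    rw [Finset.set_biInter_insert, inter_comm,
      h.increment (t a) (mem_univ _) _ (mem_univ _) hat _ hpast _ hBa,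
      ih fun i hi => hB i (Finset.mem_insert_of_mem hi),
      Finset.prod_insert (fun haS => (ha a haS).false), mul_comm,
      ← h.map_sub (mem_univ (t a)) (mem_univ _) hat, Measure.map_apply hD hBa]

/-- Stochastic continuity: the law of the increment between `s` and `t` depends continuously on `s`
and is `δ₀` for `s = t`. -/
lemma IsAdditiveOn.tendstoInMeasure [IsProbabilityMeasure P] (h : IsAdditiveOn q μ univ X P)
    (hq : ∀ t, q t t = diracProba 0) (hcont : Continuous fun z : ℝ≥0 × ℝ≥0 => q z.1 z.2)
    (t : ℝ≥0) : TendstoInMeasure P X (𝓝 t) (X t) := by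
  intro ε hε
  have hm := h.measurable
  set F : Set (E d) := {y | ε ≤ ‖y‖ₑ} with hF
  have hFc : IsClosed F := isClosed_le continuous_const continuous_enorm
  have hset : ∀ s, P {ω | ε ≤ edist (X s ω) (X t ω)} =
      (q (min s t) (max s t) : Measure (E d)) F := by
    intro s
    have hD : Measurable fun ω => X (max s t) ω - X (min s t) ω := (hm _).sub (hm _)
    rw [← h.map_sub (mem_univ _) (mem_univ _) min_le_max, Measure.map_apply hD hFc.measurableSet]
    congr 1
    ext ω
    rcases le_total s t with hst | hst
    · simp only [hF, mem_ofPred_eq, mem_preimage, max_eq_right hst, min_eq_left hst]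
      rw [edist_comm, edist_eq_enorm_sub]
    · simp only [hF, mem_ofPred_eq, mem_preimage, max_eq_left hst, min_eq_right hst]
      rw [edist_eq_enorm_sub]
  simp only [hset]
  have hc : Continuous fun s : ℝ≥0 => q (min s t) (max s t) := by
    have : Continuous fun s : ℝ≥0 => (min s t, max s t) := by fun_prop
    simpa only [Function.comp_def] using hcont.comp this
  have hlim := hc.tendsto t
  simp only [min_self, max_self, hq] at hlim
  have h0 : (0 : E d) ∉ F := by simpa [hF] using hε.ne'
  have hzero : (diracProba (0 : E d) : Measure (E d)) F = 0 := by
    simp [diracProba, hFc.measurableSet, h0]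
  rw [← hzero]
  exact ProbabilityMeasure.tendsto_measure_of_null_frontier_of_tendsto' hlim
    (measure_mono_null hFc.frontier_subset hzero)

/-- The one-dimensional distributions of an additive process. -/
lemma IsAdditiveOn.map_eq_convP [IsProbabilityMeasure P] (h : IsAdditiveOn q μ univ X P)
    (t : ℝ≥0) : P.map (X t) = (convP μ (q 0 t) : Measure (E d)) := by
  have hm := h.measurable
  have h1 := h.map_prodMk (mem_univ 0) (mem_univ t) zero_le
    (measurable_pastOn (X := X) (mem_univ 0) le_rfl)
  have h2 := congrArg (Measure.map fun z : E d × E d => z.1 + z.2) h1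
  rw [Measure.map_map (by fun_prop) (by fun_prop), h.map_zero] at h2
  rw [coe_convP, Measure.conv, ← h2]
  congr 1
  ext1 ω
  simp

/-- Uniqueness in law of additive processes. -/
lemma IsAdditiveOn.map_path_eq [IsProbabilityMeasure P] {R : Measure (ℝ≥0 → E d)}
    [IsProbabilityMeasure R] (h : IsAdditiveOn q μ univ X P)
    (hR : IsAdditiveOn q μ univ (fun t ω => ω t) R) : P.map (fun ω t => X t ω) = R := by
  have hm := h.measurable
  have hpath : Measurable fun ω t => X t ω := measurable_pi_lambda _ hm
  have : IsProbabilityMeasure (P.map fun ω t => X t ω) :=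
    Measure.isProbabilityMeasure_map hpath.aemeasurable
  have hres : ∀ I : Finset ℝ≥0, Measurable (I.restrict (π := fun _ => E d)) := fun I =>
    Finset.measurable_restrict I
  refine IsProjectiveLimit.unique (P := fun I : Finset ℝ≥0 => R.map I.restrict)
    (fun I => ?_) fun I => rfl
  rw [Measure.map_map (hres I) hpath]
  exact h.map_restrict_eq_of_subset (I := I) hR (subset_univ _) (subset_univ _)

/-! ### Nonlinear Lévy processes -/

variable {L : ProbabilityMeasure (E d) → LevyTriplet d} {κ : ℝ}

/-- The one-dimensional distributions of a nonlinear Lévy process solve the nonlinear kinetic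
equation, whence the process is additive with known increments. -/
lemma IsNonlinearLevyProcess.isAdditiveOn [IsProbabilityMeasure P] (hL : IsLipschitzFamily L κ)
    (h : IsNonlinearLevyProcess L μ X P) :
    IsAdditiveOn (fun r t : ℝ≥0 => transLaw (fun u => L (mildSol hL μ u)) r t) μ univ X P := by
  obtain ⟨m, p, hm0, hm, hp, hX⟩ := h
  have hmarg : ∀ t, p 0 t ∘ₘ (μ : Measure (E d)) = (m t : Measure (E d)) := by
    intro t
    have := hp.isMarkovKernel 0 t zero_le
    ext B hB
    have h1 := hX.measure_inter (zero_le : (0 : ℝ≥0) ≤ t) MeasurableSet.univ hB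
    rw [univ_inter, Measure.restrict_univ, ← Measure.map_apply (hX.measurable t) hB, hm] at h1
    rw [Measure.bind_apply hB (p 0 t).aemeasurable, h1, ← hm0, ← hm,
      lintegral_map ((p 0 t).measurable_coe hB) (hX.measurable 0)]
  have hsol : SolvesNonlinear L μ m := by
    refine ⟨hm0, ?_⟩
    have := hp.solves 0 μ
    simpa only [hmarg] using this
  have hmild : ∀ t : ℝ≥0, m t = mildSol hL μ t := fun t => hsol.eq_mildSol hL t
  have hΛ := hL.niceCurve (isMild_mildSol hL μ).continuous
  simp only [hmild] at hp
  refine hX.isAdditiveOn (fun r t hrt => hp.eq_transKernel hΛ hrt) ?_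
  rw [hm, hm0]

end

end NonlinearLevy

theorem mainTheorem3 {d : ℕ}
    (L : ProbabilityMeasure (NonlinearLevy.E d) → NonlinearLevy.LevyTriplet d) (κ : ℝ)
    (hL : ∀ μ η : ProbabilityMeasure (NonlinearLevy.E d),
      NonlinearLevy.tripletDist (L μ) (L η) ≤ κ * NonlinearLevy.c2DualDist μ η) :
    ∃ T : ℝ≥0 → ProbabilityMeasure (NonlinearLevy.E d) → ProbabilityMeasure (NonlinearLevy.E d),
      -- existence and uniqueness of the nonlinear Lévy semigroup
      NonlinearLevy.IsNonlinearLevySemigroup L T ∧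
      (∀ T', NonlinearLevy.IsNonlinearLevySemigroup L T' → T' = T) ∧
      -- its orbits are the only solutions of the nonlinear Cauchy problem
      (∀ μ m, NonlinearLevy.SolvesNonlinear L μ m → ∀ t, m t = T t μ) ∧
      ∀ μ : ProbabilityMeasure (NonlinearLevy.E d),
        -- uniqueness of the transition probabilities generated by `A_{T t μ}`
        (∀ p p' : ℝ≥0 → ℝ≥0 → Kernel (NonlinearLevy.E d) (NonlinearLevy.E d),
          NonlinearLevy.IsTransitionFamily (fun t => NonlinearLevy.levyOp (L (T t μ))) p →
          NonlinearLevy.IsTransitionFamily (fun t => NonlinearLevy.levyOp (L (T t μ))) p' →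
          ∀ r t, r ≤ t → p r t = p' r t) ∧
        -- existence of the nonlinear Lévy process, realized by the coordinates of path space
        ∃ P : Measure (ℝ≥0 → NonlinearLevy.E d), IsProbabilityMeasure P ∧
          NonlinearLevy.IsNonlinearLevyProcess L μ (fun t ω => ω t) P ∧
          (∀ t, P.map (fun ω => ω t) = (T t μ : Measure (NonlinearLevy.E d))) ∧
          HasIndepIncrements (fun (t : ℝ≥0) (ω : ℝ≥0 → NonlinearLevy.E d) => ω t) P ∧
          (∀ t : ℝ≥0, TendstoInMeasure P
            (fun (s : ℝ≥0) (ω : ℝ≥0 → NonlinearLevy.E d) => ω s) (𝓝 t) (fun ω => ω t)) ∧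
          -- uniqueness in law of the nonlinear Lévy process
          ∀ (Ω : Type*) [MeasurableSpace Ω] (X : ℝ≥0 → Ω → NonlinearLevy.E d) (Q : Measure Ω),
            IsProbabilityMeasure Q → NonlinearLevy.IsNonlinearLevyProcess L μ X Q →
              Q.map (fun ω t => X t ω) = P := by
  have hL' : NonlinearLevy.IsLipschitzFamily L κ := hL
  refine ⟨fun t μ => NonlinearLevy.mildSol hL' μ t,
    NonlinearLevy.isNonlinearLevySemigroup_mildSol hL',
    fun T' hT' => hT'.eq_mildSol hL', fun μ m hm t => hm.eq_mildSol hL' t, fun μ => ?_⟩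
  have hmild := NonlinearLevy.isMild_mildSol hL' μ
  have hΛ := hL'.niceCurve hmild.continuous
  refine ⟨fun p p' hp hp' r t hrt =>
    (hp.eq_transKernel hΛ hrt).trans (hp'.eq_transKernel hΛ hrt).symm, ?_⟩
  set q : ℝ≥0 → ℝ≥0 → ProbabilityMeasure (NonlinearLevy.E d) := fun r t =>
    NonlinearLevy.transLaw (fun u => L (NonlinearLevy.mildSol hL' μ u)) r t with hqdef
  have hq : ∀ t, q t t = diracProba 0 := fun t => NonlinearLevy.transLaw_self hΛ t
  have hconv : ∀ r s t, r ≤ s → s ≤ t → NonlinearLevy.convP (q r s) (q s t) = q r t :=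
    fun r s t hrs hst =>
      NonlinearLevy.convP_transLaw hΛ (by exact_mod_cast hrs) (by exact_mod_cast hst)
  have hcont : Continuous fun z : ℝ≥0 × ℝ≥0 => q z.1 z.2 := by
    have : Continuous fun z : ℝ≥0 × ℝ≥0 => ((z.1 : ℝ), (z.2 : ℝ)) := by fun_prop
    simpa only [Function.comp_def] using (NonlinearLevy.continuous_transLaw hΛ).comp this
  obtain ⟨P, hP, hadd⟩ := NonlinearLevy.exists_isAdditiveOn_univ hq hconv μ
  have hmarg : ∀ t : ℝ≥0, P.map (fun ω => ω t) =
      (NonlinearLevy.mildSol hL' μ t : Measure (NonlinearLevy.E d)) := fun t => by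
    rw [hmild.eq t t.2]
    exact hadd.map_eq_convP t
  refine ⟨P, hP, ⟨fun t => NonlinearLevy.mildSol hL' μ t,
    NonlinearLevy.transKernel fun u => L (NonlinearLevy.mildSol hL' μ u), ?_, hmarg,
    NonlinearLevy.isTransitionFamily_transKernel hΛ, hadd.isMarkovProcess⟩, hmarg,
    hadd.hasIndepIncrements, hadd.tendstoInMeasure hq hcont, fun Ω _ X Q hQ hX => ?_⟩
  · exact hmild.zero hL'
  · exact (hX.isAdditiveOn hL').map_path_eq hadd
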